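/- **Setting.** Let $d\ge 3$ and $p\in(d,\infty]$ (with $1/p=0$ if $p=\infty$). $L^p_\sigma(\mathbb R^d)$ is the space of vector fields in $L^p(\mathbb R^d;\mathbb R^d)$ whose distributional divergence vanishes. A strong ($=$ mild) Navier–Stokes solution on $(0,T]$ with initial data $u_0$ is a $u\in C((0,T];L^p)$ with $\sup_{0<t\le T}\|u(\cdot,t)\|_{L^p}<\infty$ and $$u(t)=e^{t\Delta}u_0-\int_0^t e^{(t-s)\Delta}\,\mathbb P\,\nabla\cdot(u\otimes u)(s)\,ds,\qquad 0<t\le T,$$ where $\mathbb P$ is the Leray projector. It is called unique if every such solution with the same data on a smaller interval $(0,T']\subseteq(0,T]$ is its restriction. Call $c_p\in(0,1]$ an *existence constant* if for all $u_0\in L^p_\sigma(\mathbb R^d)$ and $T>0$ with $\|u_0\|_{L^p}T^{\frac12(1-\frac dp)}\le c_p$ there is a unique strong solution $u$ on $(0,T]$ with data $u_0$, and it satisfies $\|u(\cdot,t)\|_{L^p}\le 2\|u_0\|_{L^p}$ for $0<t\le T$. For $\varepsilon,\beta\in(0,1)$ and $\ell>0$, a field $u_0\in L^p(\mathbb R^d)$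 is *$(\varepsilon,\beta,\ell)$-sparse in $L^p$* if there is a measurable set $S\subseteq\mathbb R^d$ with $$\|u_0\|_{L^p(S^c)}<\varepsilon\,\|u_0\|_{L^p},\qquad \sup_{x_0\in\mathbb R^d}\frac{|S\cap B_\ell(x_0)|}{|B_\ell(x_0)|}\le\beta .$$ **Theorem (regularity criterion).** Existence constants exist for all such $d,p$. Let $c_p$ be one. There is $C_0\ge1$, depending only on $d$, $p$ (and the choice of $c_p$), such that the following holds. Let $u_0\in L^p_\sigma(\mathbb R^d)$, let $\bar T>0$ satisfy $\|u_0\|_{L^p}\bar T^{\frac12(1-\frac dp)}=c_p$, and let $T_0>\bar T$. Define $\gamma\in(0,1)$ and $T>0$ by $$\|u_0\|_{L^p}\,T_0^{\frac12(1-\frac dp)}\,\gamma=c_p,\qquad \|u_0\|_{L^p}\,T^{\frac12(1-\frac dp)}=\frac{\gamma}{C_0}.$$ If $u_0$ is $(\varepsilon,\beta,\ell)$-sparse in $L^p$, where $\ell=\sqrt{T}\,\bar\ell$ and the parameters satisfy $$\bar\ell>0,\qquad \bar\ell^{\,2}\ge C_0\log(C_0/\gamma),\qquad \varepsilon=\frac{\gamma}{C_0},\qquad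 \beta^{1-\frac1p}\le\frac{\gamma}{C_0\,\bar\ell^{\,d}},$$ then the unique strong solution with initial data $u_0$ extends past time $T_0$: for some $T_1>T_0$ there is a unique strong solution on $(0,T_1]$ with data $u_0$. -/

import Mathlib

open MeasureTheory Set Filter Topology
open scoped ENNReal ContDiff

noncomputable section

namespace NavierStokes

/-- Euclidean space `ℝ^d`. -/
abbrev E (d : ℕ) : Type := EuclideanSpace ℝ (Fin d)

/-- The partial derivative `∂_j f` of a scalar function on `ℝ^d`. -/
def pderiv {d : ℕ} (j : Fin d) (f : E d → ℝ) (x : E d) : ℝ :=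
  lineDeriv ℝ f x (EuclideanSpace.single j (1 : ℝ))

/-- `L^p_σ(ℝ^d)`: vector fields in `L^p` whose distributional divergence vanishes. -/
def MemLpSigma (d : ℕ) (p : ℝ≥0∞) (u : E d → E d) : Prop :=
  MemLp u p volume ∧
    ∀ φ : E d → ℝ, ContDiff ℝ ∞ φ → HasCompactSupport φ →
      ∫ x, ∑ j, u x j * pderiv j φ x = 0

/-- The heat kernel `(4πt)^{-d/2} exp(-|x|²/(4t))`. -/
def heatKernel (d : ℕ) (t : ℝ) (x : E d) : ℝ :=
  (4 * Real.pi * t) ^ (-(d : ℝ) / 2) * Real.exp (-‖x‖ ^ 2 / (4 * t))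

/-- The heat semigroup `e^{tΔ} f`, for `t > 0`. -/
def heatFlow {d : ℕ} (t : ℝ) (f : E d → E d) (x : E d) : E d :=
  ∫ y, heatKernel d t (x - y) • f y

/-- The kernel of `e^{tΔ} ℙ div`, where `ℙ` is the Leray projector: it maps a matrix field `F`
to the vector field with components `∑_{k,l} K_{jkl}(t, ·) * F_{kl}`. Since
`ℙ_{jk} = δ_{jk} + ∂_j ∂_k (-Δ)⁻¹` and `(-Δ)⁻¹ e^{tΔ} = ∫_t^∞ e^{sΔ} ds`, this is
`K_{jkl}(t, ·) = δ_{jk} ∂_l Γ_t + ∫_t^∞ ∂_j ∂_k ∂_l Γ_s ds`, with `Γ` the heat kernel. -/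
def oseenKernel {d : ℕ} (j k l : Fin d) (t : ℝ) (x : E d) : ℝ :=
  (if j = k then pderiv l (heatKernel d t) x else 0) +
    ∫ s in Ioi t, pderiv j (pderiv k (pderiv l (heatKernel d s))) x

/-- The vector field `e^{tΔ} ℙ div (v ⊗ v)`, for `t > 0`. -/
def oseenFlow {d : ℕ} (t : ℝ) (v : E d → E d) (x : E d) : E d :=
  WithLp.toLp 2 fun j => ∫ y, ∑ k, ∑ l, oseenKernel j k l t (x - y) * (v y k * v y l)

/-- `u` is a mild (strong `L^p`) solution on `(0, T]` of the Navier–Stokes equations on `ℝ^d`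
with unit viscosity and initial velocity `u₀`: it belongs to `C((0, T]; L^p)`, is bounded in `L^p`,
and satisfies `u(t) = e^{tΔ} u₀ - ∫_0^t e^{(t-s)Δ} ℙ div (u ⊗ u)(s) ds` for all `t ∈ (0, T]`. -/
structure IsMildSolution (d : ℕ) (p : ℝ≥0∞) (u₀ : E d → E d) (T : ℝ)
    (u : ℝ → E d → E d) : Prop where
  memLp : ∀ t ∈ Ioc 0 T, MemLp (u t) p volume
  bounded : ∃ M : ℝ, ∀ t ∈ Ioc 0 T, eLpNorm (u t) p volume ≤ ENNReal.ofReal M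
  continuous : ∀ t ∈ Ioc 0 T,
    Tendsto (fun s => eLpNorm (u s - u t) p volume) (𝓝[Ioc 0 T] t) (𝓝 0)
  duhamel : ∀ t ∈ Ioc 0 T, ∀ᵐ x,
    u t x = heatFlow t u₀ x - ∫ s in (0 : ℝ)..t, oseenFlow (t - s) (u s) x

/-- `u` is the unique mild solution on `(0, T]` with data `u₀`: it is a mild solution there, and
every mild solution with the same data on an interval `(0, T'] ⊆ (0, T]` is its restriction. -/
def IsUniqueMildSolution (d : ℕ) (p : ℝ≥0∞) (u₀ : E d → E d) (T : ℝ)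
    (u : ℝ → E d → E d) : Prop :=
  IsMildSolution d p u₀ T u ∧
    ∀ (T' : ℝ) (v : ℝ → E d → E d), T' ≤ T → IsMildSolution d p u₀ T' v →
      ∀ t ∈ Ioc 0 T', v t =ᵐ[volume] u t

/-- The dimensionless size `‖u₀‖_{L^p} T^{(1 - d/p)/2}` of the data on the time scale `T`
(for `p = ∞`, `1/p = 0`). -/
def dataSize (d : ℕ) (p : ℝ≥0∞) (u₀ : E d → E d) (T : ℝ) : ℝ :=
  (eLpNorm u₀ p volume).toReal * T ^ ((1 - (d : ℝ) * p⁻¹.toReal) / 2)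

/-- `c ∈ (0, 1]` is an admissible constant in the guaranteed existence time: if
`‖u₀‖_{L^p} T^{(1 - d/p)/2} ≤ c`, then there is a unique mild solution on `(0, T]`, and its `L^p`
norm is at most `2 ‖u₀‖_{L^p}`. -/
def IsExistenceConstant (d : ℕ) (p : ℝ≥0∞) (c : ℝ) : Prop :=
  0 < c ∧ c ≤ 1 ∧
    ∀ u₀ : E d → E d, MemLpSigma d p u₀ → ∀ T : ℝ, 0 < T → dataSize d p u₀ T ≤ c →
      ∃ u : ℝ → E d → E d, IsUniqueMildSolution d p u₀ T u ∧
        ∀ t ∈ Ioc 0 T, eLpNorm (u t) p volume ≤ 2 * eLpNorm u₀ p volume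

/-- `(ε, β, ℓ)`-sparseness in `L^p`: off a measurable set `S`, which fills at most the fraction `β`
of each ball of radius `ℓ`, the `L^p` norm of `f` is less than `ε` times its full `L^p` norm. -/
def IsSparse (d : ℕ) (p : ℝ≥0∞) (ε β ℓ : ℝ) (f : E d → E d) : Prop :=
  ε ∈ Ioo (0 : ℝ) 1 ∧ β ∈ Ioo (0 : ℝ) 1 ∧ 0 < ℓ ∧
    ∃ S : Set (E d), MeasurableSet S ∧
      eLpNorm f p (volume.restrict Sᶜ) < ENNReal.ofReal ε * eLpNorm f p volume ∧
      ∀ x : E d, volume (S ∩ Metric.ball x ℓ) ≤ ENNReal.ofReal β * volume (Metric.ball x ℓ)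

end NavierStokes

end

/-! # Continuation of Navier–Stokes solutions with sparse data

The idea is that the heat flow shrinks sparse data. Let `σ = (1 - d/p)/2`. At the time `T` of the
statement, `e^{TΔ} u₀` is smaller than `u₀` by a factor of order `γ`
(`eLpNorm_heatFlow_le_of_sparse`): the part of `u₀` off `S` has norm at most `ε ‖u₀‖`; the part of
the heat kernel farther than `ℓ = √T lbar` from the diagonal is bounded by `exp (-lbar ^ 2 / 8)`
times another Gaussian; and the part of the kernel that is near the diagonal and lives on `S` has
mass at most of order `β lbar ^ d` in one variable and `1` in the other, so that Schur's test gives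
the operator norm `(β lbar ^ d) ^ (1 - 1/p)`. Up to time `T` the solution is bounded by `2 ‖u₀‖`,
and then the Duhamel term is at most a constant times `‖u₀‖² T^σ = ‖u₀‖ γ / C₀`. With `C₀` large,
`‖u(T)‖ ≤ γ ‖u₀‖`, hence `‖u(T)‖ T₀^σ ≤ c`, and the existence constant `c`, applied to the data
`u(T)`, gives a solution on another interval of length `T₀`. Gluing the two reaches the time
`T + T₀ > T₀` (`exists_continuation_of_sparse`).

This uses the local theory in `L^p`, `p > d`. It is developed for an abstract equation
`u(t) = S(t) x₀ - ∫₀ᵗ Q(t - s)(u(s)) ds` in a Banach space, where `S` is a contraction semigroup and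
the quadratic map `Q(τ)` is Lipschitz on bounded sets with the integrable constant `A τ^(σ - 1)`
(`IsMildSystem`). Solutions are unique, by contraction in a norm with exponential weight
(`IsAbstractMild.unique`); they exist if `A ‖x₀‖ T^σ / σ ≤ 1/8` (`IsAbstractMild.exists_of_small`);
and they can be concatenated (`IsAbstractMild.concat`), since the heat semigroup shifts the time in
both kernels.

The Navier–Stokes equations fit this scheme (`isMildSystem`) because the Oseen kernel is an integral
over times `s > t` of derivatives of the Gaussian `Γ_s` (`oseenKernel_eq_integral`), which are at
most a constant times `s^(-3/2) Γ_{2s}`. The kernel and its increments in time are thus dominated by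
explicit mixtures of Gaussians, whose mass and supremum are known (`isMajorant_gaussMix`), and
Schur's test gives the bounds for the bilinear map `L^p × L^p → L^p`.

Two points connect the abstract theory with the equation for vector fields. A Bochner integral in
`L^p` agrees almost everywhere with the pointwise integral (`coeFn_duhamelTerm`), so both notions of
mild solution coincide. And the values of a solution remain divergence free
(`IsAbstractMild.memLpSigma`), as is needed to restart at time `T`: testing the divergence against a
fixed function is a bounded functional on `L^p`, which commutes with the time integral and kills the
Oseen kernel, while the heat flow only averages translates of the data.
-/

noncomputable section

namespace NavierStokes

/-! ### Abstract mild equations with a weakly singular quadratic term -/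

/-- The structure of `u(t) = S t x₀ - ∫₀ᵗ Q (t - s) (u s) ds` in a Banach space that the theory of
mild solutions uses: `S` is a contraction semigroup, continuous for positive times, and `Q τ` is
quadratic with a norm `A τ ^ (σ - 1)` that is integrable at `τ = 0`. -/
structure IsMildSystem {X : Type*} [NormedAddCommGroup X] [NormedSpace ℝ X]
    (S : ℝ → X →L[ℝ] X) (Q : ℝ → X → X) (A σ : ℝ) : Prop where
  exponent_pos : 0 < σ
  const_pos : 0 < A
  norm_le : ∀ t > 0, ∀ x, ‖S t x‖ ≤ ‖x‖
  continuousOn_linear : ∀ x, ContinuousOn (fun t => S t x) (Ioi 0)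
  map_zero : ∀ τ > 0, Q τ 0 = 0
  norm_sub_le : ∀ τ > 0, ∀ x y, ‖Q τ x - Q τ y‖ ≤ A * τ ^ (σ - 1) * ((‖x‖ + ‖y‖) * ‖x - y‖)
  continuousOn_quadratic : ∀ x, ContinuousOn (fun τ => Q τ x) (Ioi 0)
  semigroup : ∀ t > 0, ∀ s > 0, ∀ x, S t (S s x) = S (t + s) x
  semigroup_quadratic : ∀ t > 0, ∀ s > 0, ∀ x, S t (Q s x) = Q (t + s) x

/-- The Duhamel term `∫₀ᵗ Q (t - s) (U s) ds`. -/
def duhamelTerm {X : Type*} [NormedAddCommGroup X] [NormedSpace ℝ X]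
    (Q : ℝ → X → X) (U : ℝ → X) (t : ℝ) : X :=
  ∫ s in (0 : ℝ)..t, Q (t - s) (U s)

/-- A mild solution on `(0, T]` with values in the Banach space `X`. -/
structure IsAbstractMild {X : Type*} [NormedAddCommGroup X] [NormedSpace ℝ X]
    (S : ℝ → X →L[ℝ] X) (Q : ℝ → X → X) (x₀ : X) (T : ℝ) (U : ℝ → X) : Prop where
  continuousOn : ContinuousOn U (Ioc 0 T)
  bounded : ∃ M : ℝ, ∀ t ∈ Ioc 0 T, ‖U t‖ ≤ M
  eq : ∀ t ∈ Ioc 0 T, U t = S t x₀ - duhamelTerm Q U t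

/-- A family of maps, continuous in the parameter and with the Lipschitz bound of a quadratic map,
is jointly continuous. -/
lemma continuousAt_of_quadratic_bound {X Y : Type*} [NormedAddCommGroup X] [NormedAddCommGroup Y]
    {Q : ℝ → X → Y} {b : ℝ → ℝ} {τ : ℝ} {x : X} (hτ : 0 < τ) (hb : ContinuousAt b τ)
    (hQ : ∀ s > 0, ∀ y, ‖Q s y - Q s x‖ ≤ b s * ((‖y‖ + ‖x‖) * ‖y - x‖))
    (hc : ContinuousAt (fun s => Q s x) τ) :
    ContinuousAt (fun z : ℝ × X => Q z.1 z.2) (τ, x) := by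
  have h1 : Tendsto (fun z : ℝ × X => Q z.1 x) (𝓝 (τ, x)) (𝓝 (Q τ x)) :=
    hc.tendsto.comp (continuous_fst.tendsto (τ, x))
  have h2 : Tendsto (fun z : ℝ × X => Q z.1 z.2 - Q z.1 x) (𝓝 (τ, x)) (𝓝 0) := by
    have hb' : Tendsto (fun z : ℝ × X => b z.1 * ((‖z.2‖ + ‖x‖) * ‖z.2 - x‖))
        (𝓝 (τ, x)) (𝓝 0) := by
      have hb1 : ContinuousAt (fun z : ℝ × X => b z.1) (τ, x) :=
        hb.comp (f := fun z : ℝ × X => z.1) continuousAt_fst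
      have : ContinuousAt (fun z : ℝ × X => b z.1 * ((‖z.2‖ + ‖x‖) * ‖z.2 - x‖)) (τ, x) :=
        hb1.mul (by fun_prop)
      simpa [ContinuousAt] using this
    refine squeeze_zero_norm' ?_ hb'
    filter_upwards [(continuous_fst.tendsto (τ, x)).eventually (Ioi_mem_nhds hτ)] with z hz
    exact hQ z.1 hz z.2
  simpa [ContinuousAt] using h2.add h1

namespace IsMildSystem

variable {X : Type*} [NormedAddCommGroup X] [NormedSpace ℝ X]
  {S : ℝ → X →L[ℝ] X} {Q : ℝ → X → X} {A σ : ℝ}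

lemma norm_quadratic_le (h : IsMildSystem S Q A σ) {τ : ℝ} (hτ : 0 < τ) {x : X} {M : ℝ}
    (hx : ‖x‖ ≤ M) : ‖Q τ x‖ ≤ A * M ^ 2 * τ ^ (σ - 1) := by
  have h1 := h.norm_sub_le τ hτ x 0
  rw [h.map_zero τ hτ, sub_zero, sub_zero, norm_zero, add_zero] at h1
  have hM := (norm_nonneg x).trans hx
  calc ‖Q τ x‖ ≤ A * τ ^ (σ - 1) * (‖x‖ * ‖x‖) := h1
    _ ≤ A * τ ^ (σ - 1) * (M * M) := by
        have := h.const_pos.le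
        gcongr
    _ = _ := by ring

lemma continuousAt_quadratic (h : IsMildSystem S Q A σ) {τ : ℝ} (hτ : 0 < τ) (x : X) :
    ContinuousAt (fun z : ℝ × X => Q z.1 z.2) (τ, x) :=
  continuousAt_of_quadratic_bound hτ (b := fun τ => A * τ ^ (σ - 1))
    (continuousAt_const.mul (continuousAt_id.rpow_const (Or.inl hτ.ne')))
    (fun s hs y => h.norm_sub_le s hs y x)
    ((h.continuousOn_quadratic x).continuousAt (Ioi_mem_nhds hτ))

lemma continuousAt_integrand (h : IsMildSystem S Q A σ) {U : ℝ → X} {t s : ℝ} (hst : s < t)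
    (hU : ContinuousAt U s) : ContinuousAt (fun s => Q (t - s) (U s)) s :=
  (h.continuousAt_quadratic (sub_pos.2 hst) (U s)).comp (f := fun s => (t - s, U s))
    ((continuousAt_const.sub continuousAt_id).prodMk hU)

lemma aestronglyMeasurable_integrand (h : IsMildSystem S Q A σ) {U : ℝ → X} {a t : ℝ}
    (hU : ContinuousOn U (Ioo 0 t \ {a})) :
    AEStronglyMeasurable (fun s => Q (t - s) (U s)) (volume.restrict (Ioc 0 t)) := by
  have ho : IsOpen (Ioo 0 t \ {a}) := isOpen_Ioo.sdiff isClosed_singleton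
  have hc : ContinuousOn (fun s => Q (t - s) (U s)) (Ioo 0 t \ {a}) := fun s hs =>
    (h.continuousAt_integrand hs.1.2 (hU.continuousAt (ho.mem_nhds hs))).continuousWithinAt
  have hm := hc.aestronglyMeasurable (μ := volume) ho.measurableSet
  have hae : (Ioo 0 t \ {a} : Set ℝ) =ᵐ[volume] Ioc 0 t :=
    (sdiff_null_ae_eq_self (by simp)).trans Ioo_ae_eq_Ioc
  rwa [Measure.restrict_congr_set hae] at hm

lemma intervalIntegrable_kernel (hσ : 0 < σ) (t : ℝ) :
    IntervalIntegrable (fun s => (t - s) ^ (σ - 1)) volume 0 t := by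
  have := (intervalIntegral.intervalIntegrable_rpow' (a := 0) (b := t)
    (show -1 < σ - 1 by linarith)).comp_sub_left t
  simpa using this.symm

lemma integral_kernel (hσ : 0 < σ) (t : ℝ) :
    ∫ s in (0 : ℝ)..t, (t - s) ^ (σ - 1) = t ^ σ / σ := by
  rw [intervalIntegral.integral_comp_sub_left (fun s => s ^ (σ - 1)) t, sub_self, sub_zero,
    integral_rpow (Or.inl (by linarith)), sub_add_cancel, Real.zero_rpow hσ.ne', sub_zero]

lemma intervalIntegrable_integrand (h : IsMildSystem S Q A σ) {U : ℝ → X} {a t M : ℝ}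
    (ht : 0 < t) (hU : ContinuousOn U (Ioo 0 t \ {a})) (hM : ∀ s ∈ Ioc 0 t, ‖U s‖ ≤ M) :
    IntervalIntegrable (fun s => Q (t - s) (U s)) volume 0 t := by
  refine ((intervalIntegrable_kernel h.exponent_pos t).const_mul (A * M ^ 2)).mono_fun'
    (by simpa [uIoc_of_le ht.le] using h.aestronglyMeasurable_integrand hU) ?_
  rw [uIoc_of_le ht.le]
  filter_upwards [ae_restrict_mem measurableSet_Ioc, Measure.ae_ne (volume.restrict (Ioc 0 t)) t]
    with s hs hst
  exact h.norm_quadratic_le (sub_pos.2 (lt_of_le_of_ne hs.2 hst)) (hM s hs)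

lemma norm_duhamelTerm_sub_le (h : IsMildSystem S Q A σ) {U V : ℝ → X} {a t M N : ℝ} {w : ℝ → ℝ}
    (ht : 0 < t) (hU : ContinuousOn U (Ioo 0 t \ {a})) (hV : ContinuousOn V (Ioo 0 t \ {a}))
    (hUM : ∀ s ∈ Ioc 0 t, ‖U s‖ ≤ M) (hVN : ∀ s ∈ Ioc 0 t, ‖V s‖ ≤ N)
    (hw : ∀ s ∈ Ioc 0 t, ‖U s - V s‖ ≤ w s)
    (hi : IntervalIntegrable (fun s => (t - s) ^ (σ - 1) * w s) volume 0 t) :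
    ‖duhamelTerm Q U t - duhamelTerm Q V t‖ ≤
      A * (M + N) * ∫ s in (0 : ℝ)..t, (t - s) ^ (σ - 1) * w s := by
  rw [duhamelTerm, duhamelTerm, ← intervalIntegral.integral_sub
    (h.intervalIntegrable_integrand ht hU hUM) (h.intervalIntegrable_integrand ht hV hVN),
    ← intervalIntegral.integral_const_mul]
  refine intervalIntegral.norm_integral_le_of_norm_le ht.le ?_ (hi.const_mul _)
  filter_upwards [Measure.ae_ne volume t] with s hst hs
  have hs' : 0 < t - s := sub_pos.2 (lt_of_le_of_ne hs.2 hst)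
  calc _ ≤ A * (t - s) ^ (σ - 1) * ((‖U s‖ + ‖V s‖) * ‖U s - V s‖) := h.norm_sub_le _ hs' _ _
    _ ≤ A * (t - s) ^ (σ - 1) * ((M + N) * w s) := by
        have h1 := h.const_pos.le
        have h2 := (norm_nonneg _).trans (hUM s hs)
        have h3 := (norm_nonneg _).trans (hVN s hs)
        gcongr
        exacts [hUM s hs, hVN s hs, hw s hs]
    _ = _ := by ring

lemma norm_duhamelTerm_le (h : IsMildSystem S Q A σ) {U : ℝ → X} {t M : ℝ}
    (ht : 0 < t) (hUM : ∀ s ∈ Ioc 0 t, ‖U s‖ ≤ M) :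
    ‖duhamelTerm Q U t‖ ≤ A * M ^ 2 * (t ^ σ / σ) := by
  rw [duhamelTerm, ← integral_kernel h.exponent_pos, ← intervalIntegral.integral_const_mul]
  refine intervalIntegral.norm_integral_le_of_norm_le ht.le ?_
    ((intervalIntegrable_kernel h.exponent_pos t).const_mul _)
  filter_upwards [Measure.ae_ne volume t] with s hst hs
  exact h.norm_quadratic_le (sub_pos.2 (lt_of_le_of_ne hs.2 hst)) (hUM s hs)

/-- The Duhamel term of a bounded curve with at most one discontinuity is continuous. After the
substitution `r = t - s` the singularity of `Q` no longer moves with `t`, and dominated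
convergence applies. -/
lemma continuousOn_duhamelTerm (h : IsMildSystem S Q A σ) {U : ℝ → X} {a T M : ℝ}
    (hU : ContinuousOn U (Ioo 0 T \ {a})) (hM : ∀ s ∈ Ioc 0 T, ‖U s‖ ≤ M) :
    ContinuousOn (duhamelTerm Q U) (Ioc 0 T) := by
  have ho : IsOpen (Ioo 0 T \ {a}) := isOpen_Ioo.sdiff isClosed_singleton
  have key : ∀ t ∈ Ioc 0 T, duhamelTerm Q U t =
      ∫ r in Ioc 0 T, (Ioo 0 t).indicator (fun r => Q r (U (t - r))) r := by
    intro t ht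
    have := intervalIntegral.integral_comp_sub_left (fun r => Q r (U (t - r))) (a := 0) (b := t) t
    simp only [sub_sub_cancel, sub_self, sub_zero] at this
    rw [duhamelTerm, this, intervalIntegral.integral_of_le ht.1.le,
      setIntegral_indicator measurableSet_Ioo, integral_Ioc_eq_integral_Ioo,
      inter_eq_self_of_subset_right]
    exact fun r hr => ⟨hr.1, hr.2.le.trans ht.2⟩
  intro t₀ ht₀
  have hlim : Tendsto (fun t => ∫ r in Ioc 0 T, (Ioo 0 t).indicator (fun r => Q r (U (t - r))) r)
      (𝓝[Ioc 0 T] t₀)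
      (𝓝 (∫ r in Ioc 0 T, (Ioo 0 t₀).indicator (fun r => Q r (U (t₀ - r))) r)) := by
    refine tendsto_integral_filter_of_dominated_convergence
      (fun r => A * M ^ 2 * r ^ (σ - 1)) ?_ ?_ ?_ ?_
    · filter_upwards [self_mem_nhdsWithin] with t ht
      refine AEStronglyMeasurable.mono_measure ?_ Measure.restrict_le_self
      rw [aestronglyMeasurable_indicator_iff measurableSet_Ioo,
        Measure.restrict_congr_set Ioo_ae_eq_Ioc]
      have hsub : ContinuousOn U (Ioo 0 t \ {a}) :=
        hU.mono (sdiff_subset_sdiff_left (Ioo_subset_Ioo_right ht.2))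
      have ho' : IsOpen (Ioo 0 t \ {t - a}) := isOpen_Ioo.sdiff isClosed_singleton
      have hc : ContinuousOn (fun r => Q r (U (t - r))) (Ioo 0 t \ {t - a}) := by
        intro r hr
        have hmem : t - r ∈ Ioo 0 T \ {a} := by
          refine ⟨⟨by linarith [hr.1.2], by linarith [hr.1.1, ht.2]⟩, fun hh => hr.2 ?_⟩
          simp only [mem_singleton_iff] at hh ⊢
          linarith
        have hUc : ContinuousAt (fun r => U (t - r)) r :=
          (hU.continuousAt (ho.mem_nhds hmem)).comp (f := fun r => t - r) (by fun_prop)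
        exact ((h.continuousAt_quadratic hr.1.1 (U (t - r))).comp (f := fun r => (r, U (t - r)))
          (continuousAt_id.prodMk hUc)).continuousWithinAt
      have hm := hc.aestronglyMeasurable (μ := volume) ho'.measurableSet
      have hae : (Ioo 0 t \ {t - a} : Set ℝ) =ᵐ[volume] Ioc 0 t :=
        (sdiff_null_ae_eq_self (by simp)).trans Ioo_ae_eq_Ioc
      rwa [Measure.restrict_congr_set hae] at hm
    · filter_upwards [self_mem_nhdsWithin] with t ht
      filter_upwards [ae_restrict_mem measurableSet_Ioc] with r hr
      by_cases hrt : r ∈ Ioo 0 t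
      · rw [indicator_of_mem hrt]
        exact h.norm_quadratic_le hr.1 (hM _ ⟨by linarith [hrt.2], by linarith [hr.1, ht.2]⟩)
      · rw [indicator_of_notMem hrt, norm_zero]
        have := h.const_pos.le
        have := Real.rpow_nonneg hr.1.le (σ - 1)
        positivity
    · have := (intervalIntegral.intervalIntegrable_rpow' (a := 0) (b := T)
        (show -1 < σ - 1 by linarith [h.exponent_pos])).const_mul (A * M ^ 2)
      rwa [intervalIntegrable_iff_integrableOn_Ioc_of_le (ht₀.1.le.trans ht₀.2)] at this
    · filter_upwards [ae_restrict_mem measurableSet_Ioc,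
        Measure.ae_ne (volume.restrict (Ioc 0 T)) t₀,
        Measure.ae_ne (volume.restrict (Ioc 0 T)) (t₀ - a)] with r hr h1 h2
      rcases lt_or_gt_of_ne h1 with hlt | hgt
      · rw [indicator_of_mem (show r ∈ Ioo 0 t₀ from ⟨hr.1, hlt⟩)]
        have hmem : t₀ - r ∈ Ioo 0 T \ {a} := by
          refine ⟨⟨by linarith, by linarith [hr.1, ht₀.2]⟩, fun hh => h2 ?_⟩
          simp only [mem_singleton_iff] at hh
          linarith
        have hUc : ContinuousAt (fun t => U (t - r)) t₀ :=
          (hU.continuousAt (ho.mem_nhds hmem)).comp (f := fun t => t - r) (by fun_prop)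
        have hc : ContinuousAt (fun t => Q r (U (t - r))) t₀ :=
          (h.continuousAt_quadratic hr.1 (U (t₀ - r))).comp (f := fun t => (r, U (t - r)))
            (continuousAt_const.prodMk hUc)
        refine (hc.tendsto.mono_left nhdsWithin_le_nhds).congr' ?_
        filter_upwards [nhdsWithin_le_nhds (Ioi_mem_nhds hlt)] with t ht
        rw [indicator_of_mem (show r ∈ Ioo 0 t from ⟨hr.1, ht⟩)]
      · rw [indicator_of_notMem (fun hh : r ∈ Ioo 0 t₀ => absurd hh.2 (not_lt.2 hgt.le))]
        refine tendsto_const_nhds.congr' ?_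
        filter_upwards [nhdsWithin_le_nhds (Iio_mem_nhds hgt)] with t ht
        rw [indicator_of_notMem (fun hh : r ∈ Ioo 0 t => absurd hh.2 (not_lt.2 (le_of_lt ht)))]
  rw [ContinuousWithinAt, key t₀ ht₀]
  refine hlim.congr' ?_
  filter_upwards [self_mem_nhdsWithin] with t ht using (key t ht).symm

end IsMildSystem

namespace IsAbstractMild

variable {X : Type*} [NormedAddCommGroup X] [NormedSpace ℝ X]
  {S : ℝ → X →L[ℝ] X} {Q : ℝ → X → X} {A σ : ℝ}

lemma duhamelTerm_congr {U V : ℝ → X} {t : ℝ} (ht : 0 ≤ t) (h : ∀ s ∈ Ioc 0 t, U s = V s) :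
    duhamelTerm Q U t = duhamelTerm Q V t := by
  rw [duhamelTerm, duhamelTerm, intervalIntegral.integral_of_le ht,
    intervalIntegral.integral_of_le ht]
  exact setIntegral_congr_fun measurableSet_Ioc fun s hs => by simp only [h s hs]

lemma mono {x₀ : X} {T T' : ℝ} {U : ℝ → X} (hU : IsAbstractMild S Q x₀ T U) (hT : T' ≤ T) :
    IsAbstractMild S Q x₀ T' U where
  continuousOn := hU.continuousOn.mono (Ioc_subset_Ioc_right hT)
  bounded := hU.bounded.imp fun _ hM t ht => hM t (Ioc_subset_Ioc_right hT ht)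
  eq t ht := hU.eq t (Ioc_subset_Ioc_right hT ht)

/-- Mild solutions are unique: in the norm weighted by `exp (-lam * t)` with `lam` large, the
Duhamel term contracts the difference of two bounded solutions, whatever the length of the time
interval. -/
lemma unique (h : IsMildSystem S Q A σ) {x₀ : X} {T : ℝ} {U V : ℝ → X}
    (hU : IsAbstractMild S Q x₀ T U) (hV : IsAbstractMild S Q x₀ T V) :
    ∀ t ∈ Ioc 0 T, U t = V t := by
  obtain ⟨M, hM⟩ := hU.bounded
  obtain ⟨N, hN⟩ := hV.bounded
  intro t₁ ht₁
  have hM0 : 0 ≤ M := (norm_nonneg _).trans (hM t₁ ht₁)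
  have hN0 : 0 ≤ N := (norm_nonneg _).trans (hN t₁ ht₁)
  have hσ := h.exponent_pos
  have hA := h.const_pos
  have hΓ : 0 < Real.Gamma σ := Real.Gamma_pos_of_pos hσ
  -- `lam ^ (-σ) = 1 / B`, so that `A (M + N)` times the Laplace transform `Γ(σ) lam ^ (-σ)` of the
  -- kernel `r ^ (σ - 1)` is at most `1 / 2`.
  set B : ℝ := 2 * (A * (M + N) * Real.Gamma σ) + 1 with hB
  have hBpos : 0 < B := by positivity
  set lam : ℝ := B ^ (1 / σ) with hlam
  have hlampos : 0 < lam := Real.rpow_pos_of_pos hBpos _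
  have hlamσ : (1 / lam) ^ σ = 1 / B := by
    rw [Real.div_rpow zero_le_one hlampos.le, Real.one_rpow, hlam, ← Real.rpow_mul hBpos.le,
      one_div_mul_cancel hσ.ne', Real.rpow_one]
  have hint : ∀ t, IntervalIntegrable (fun s => (t - s) ^ (σ - 1) * Real.exp (lam * s))
      volume 0 t := fun t =>
    (IsMildSystem.intervalIntegrable_kernel hσ t).mul_continuousOn (by fun_prop)
  have hbound : ∀ t, 0 < t → ∫ s in (0 : ℝ)..t, (t - s) ^ (σ - 1) * Real.exp (lam * s) ≤
      Real.exp (lam * t) * (1 / B * Real.Gamma σ) := by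
    intro t ht
    have h1 : ∫ s in (0 : ℝ)..t, (t - s) ^ (σ - 1) * Real.exp (lam * s) =
        ∫ r in (0 : ℝ)..t, Real.exp (lam * t) * (r ^ (σ - 1) * Real.exp (-(lam * r))) := by
      have := intervalIntegral.integral_comp_sub_left
        (fun r => Real.exp (lam * t) * (r ^ (σ - 1) * Real.exp (-(lam * r)))) (a := 0) (b := t) t
      rw [sub_self, sub_zero] at this
      rw [← this]
      refine intervalIntegral.integral_congr fun s _ => ?_
      rw [mul_left_comm, ← Real.exp_add]
      ring_nf
    rw [h1, intervalIntegral.integral_const_mul, ← hlamσ,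
      ← Real.integral_rpow_mul_exp_neg_mul_Ioi hσ hlampos, intervalIntegral.integral_of_le ht.le]
    refine mul_le_mul_of_nonneg_left ?_ (Real.exp_pos _).le
    refine setIntegral_mono_set ?_ ?_ (Ioc_subset_Ioi_self.eventuallyLE)
    · have := integrableOn_rpow_mul_exp_neg_mul_rpow (p := 1) (s := σ - 1) (b := lam)
        (by linarith) one_pos hlampos
      simpa only [Real.rpow_one, neg_mul] using this
    · filter_upwards [ae_restrict_mem measurableSet_Ioi] with r hr
      have := Real.rpow_nonneg (le_of_lt hr) (σ - 1)
      have := Real.exp_pos (-(lam * r))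
      positivity
  have step : ∀ K : ℝ, 0 ≤ K → (∀ t ∈ Ioc 0 T, ‖U t - V t‖ ≤ K * Real.exp (lam * t)) →
      ∀ t ∈ Ioc 0 T, ‖U t - V t‖ ≤ K / 2 * Real.exp (lam * t) := by
    intro K hK hw t ht
    have hsub : Ioc 0 t ⊆ Ioc 0 T := Ioc_subset_Ioc_right ht.2
    have hsub' : Ioo 0 t \ {0} ⊆ Ioc 0 T := fun s hs => hsub ⟨hs.1.1, hs.1.2.le⟩
    have heq : U t - V t = duhamelTerm Q V t - duhamelTerm Q U t := by
      rw [hU.eq t ht, hV.eq t ht]; abel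
    have hle := h.norm_duhamelTerm_sub_le (a := 0) ht.1 (hU.continuousOn.mono hsub')
      (hV.continuousOn.mono hsub') (fun s hs => hM s (hsub hs)) (fun s hs => hN s (hsub hs))
      (w := fun s => K * Real.exp (lam * s)) (fun s hs => hw s (hsub hs))
      (by simpa only [mul_left_comm] using (hint t).const_mul K)
    rw [heq, norm_sub_rev]
    refine hle.trans ?_
    have h2 : ∫ s in (0 : ℝ)..t, (t - s) ^ (σ - 1) * (K * Real.exp (lam * s)) =
        K * ∫ s in (0 : ℝ)..t, (t - s) ^ (σ - 1) * Real.exp (lam * s) := by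
      rw [← intervalIntegral.integral_const_mul]
      exact intervalIntegral.integral_congr fun s _ => by simp only [mul_left_comm]
    rw [h2]
    have hfrac : A * (M + N) * (1 / B * Real.Gamma σ) ≤ 1 / 2 := by
      have h3 : A * (M + N) * (1 / B * Real.Gamma σ) = A * (M + N) * Real.Gamma σ / B := by ring
      rw [h3, div_le_div_iff₀ hBpos two_pos, hB]
      linarith
    calc A * (M + N) * (K * ∫ s in (0 : ℝ)..t, (t - s) ^ (σ - 1) * Real.exp (lam * s))
        ≤ A * (M + N) * (K * (Real.exp (lam * t) * (1 / B * Real.Gamma σ))) := by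
          have := hbound t ht.1
          gcongr
      _ = A * (M + N) * (1 / B * Real.Gamma σ) * (K * Real.exp (lam * t)) := by ring
      _ ≤ 1 / 2 * (K * Real.exp (lam * t)) := by gcongr
      _ = _ := by ring
  have iter : ∀ n : ℕ, ∀ t ∈ Ioc 0 T,
      ‖U t - V t‖ ≤ (M + N) / 2 ^ n * Real.exp (lam * t) := by
    intro n
    induction n with
    | zero =>
      intro t ht
      have h1 : (1 : ℝ) ≤ Real.exp (lam * t) := Real.one_le_exp (by have := ht.1; positivity)
      calc ‖U t - V t‖ ≤ ‖U t‖ + ‖V t‖ := norm_sub_le _ _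
        _ ≤ (M + N) * 1 := by linarith [hM t ht, hN t ht]
        _ ≤ (M + N) / 2 ^ 0 * Real.exp (lam * t) := by rw [pow_zero, div_one]; gcongr
    | succ n ih =>
      intro t ht
      have := step _ (by positivity) ih t ht
      rwa [div_div, ← pow_succ] at this
  have hlim : Tendsto (fun n : ℕ => (M + N) / 2 ^ n * Real.exp (lam * t₁)) atTop (𝓝 0) := by
    have := ((tendsto_pow_atTop_nhds_zero_of_lt_one (r := (1 / 2 : ℝ)) (by norm_num)
      (by norm_num)).const_mul (M + N)).mul_const (Real.exp (lam * t₁))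
    simpa [div_eq_mul_inv] using this
  exact sub_eq_zero.1 (norm_le_zero_iff.1
    (ge_of_tendsto' hlim fun n => iter n t₁ ht₁))

/-- A mild solution from `x₀` on `(0, T]` and one from its value at time `T` on `(0, T']` join to
a mild solution on `(0, T + T']`. -/
lemma concat [CompleteSpace X] (h : IsMildSystem S Q A σ) {x₀ : X} {T T' : ℝ} (hT : 0 < T)
    {U V : ℝ → X}
    (hU : IsAbstractMild S Q x₀ T U) (hV : IsAbstractMild S Q (U T) T' V) :
    IsAbstractMild S Q x₀ (T + T') (fun t => if t ≤ T then U t else V (t - T)) := by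
  obtain ⟨M, hM⟩ := hU.bounded
  obtain ⟨N, hN⟩ := hV.bounded
  set W : ℝ → X := fun t => if t ≤ T then U t else V (t - T) with hW
  have hWU : ∀ t, t ≤ T → W t = U t := fun t ht => if_pos ht
  have hWV : ∀ t, T < t → W t = V (t - T) := fun t ht => if_neg (not_le.2 ht)
  have hWb : ∀ t ∈ Ioc 0 (T + T'), ‖W t‖ ≤ max M N := by
    intro t ht
    rcases le_or_gt t T with h1 | h1
    · rw [hWU t h1]
      exact (hM t ⟨ht.1, h1⟩).trans (le_max_left _ _)
    · rw [hWV t h1]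
      exact (hN _ ⟨sub_pos.2 h1, by linarith [ht.2]⟩).trans (le_max_right _ _)
  have hWc : ContinuousOn W (Ioo 0 (T + T') \ {T}) := by
    intro t ht
    refine ContinuousAt.continuousWithinAt ?_
    rcases lt_or_gt_of_ne ht.2 with h1 | h1
    · refine ((hU.continuousOn.mono Ioo_subset_Ioc_self).continuousAt
        (Ioo_mem_nhds ht.1.1 h1)).congr ?_
      filter_upwards [Iio_mem_nhds h1] with s hs using (hWU s (le_of_lt hs)).symm
    · have hc : ContinuousAt V (t - T) :=
        (hV.continuousOn.mono Ioo_subset_Ioc_self).continuousAt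
          (Ioo_mem_nhds (sub_pos.2 h1) (by linarith [ht.1.2]))
      refine (hc.comp (f := fun s => s - T) (by fun_prop)).congr ?_
      filter_upwards [Ioi_mem_nhds h1] with s hs using (hWV s hs).symm
  have heq : ∀ t ∈ Ioc 0 (T + T'), W t = S t x₀ - duhamelTerm Q W t := by
    intro t ht
    rcases le_or_gt t T with h1 | h1
    · rw [hWU t h1, hU.eq t ⟨ht.1, h1⟩,
        duhamelTerm_congr ht.1.le (fun s hs => hWU s (hs.2.trans h1))]
    · have hr : 0 < t - T := sub_pos.2 h1
      have hsplit := h.intervalIntegrable_integrand (a := T) ht.1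
        (hWc.mono (sdiff_subset_sdiff_left (Ioo_subset_Ioo_right ht.2)))
        (fun s hs => hWb s ⟨hs.1, hs.2.trans ht.2⟩)
      have hA1 : (∫ s in (0 : ℝ)..T, Q (t - s) (W s)) = S (t - T) (duhamelTerm Q U T) := by
        have hi := h.intervalIntegrable_integrand (a := 0) hT
          (hU.continuousOn.mono fun s hs => ⟨hs.1.1, hs.1.2.le⟩) hM
        rw [duhamelTerm, ← ContinuousLinearMap.intervalIntegral_comp_comm _ hi,
          intervalIntegral.integral_of_le hT.le, intervalIntegral.integral_of_le hT.le,
          integral_Ioc_eq_integral_Ioo, integral_Ioc_eq_integral_Ioo]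
        refine setIntegral_congr_fun measurableSet_Ioo fun s hs => ?_
        rw [h.semigroup_quadratic _ hr _ (sub_pos.2 hs.2), hWU s hs.2.le, sub_add_sub_cancel]
      have hA2 : (∫ s in T..t, Q (t - s) (W s)) = duhamelTerm Q V (t - T) := by
        have := intervalIntegral.integral_comp_sub_right (a := T) (b := t)
          (fun s => Q (t - T - s) (V s)) T
        rw [sub_self] at this
        rw [duhamelTerm, ← this, intervalIntegral.integral_of_le h1.le,
          intervalIntegral.integral_of_le h1.le]
        refine setIntegral_congr_fun measurableSet_Ioc fun s hs => ?_
        rw [hWV s hs.1, sub_sub_sub_cancel_right]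
      have hi1 := hsplit.mono_set (c := 0) (d := T) (by
        rw [uIcc_of_le hT.le, uIcc_of_le ht.1.le]; exact Icc_subset_Icc_right h1.le)
      have hi2 := hsplit.mono_set (c := T) (d := t) (by
        rw [uIcc_of_le h1.le, uIcc_of_le ht.1.le]; exact Icc_subset_Icc_left hT.le)
      rw [duhamelTerm, ← intervalIntegral.integral_add_adjacent_intervals hi1 hi2, hA1, hA2,
        hWV t h1, hV.eq _ ⟨hr, by linarith [ht.2]⟩, hU.eq T ⟨hT, le_rfl⟩, map_sub,
        h.semigroup _ hr _ hT, sub_add_cancel, sub_sub]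
  refine ⟨?_, ⟨_, hWb⟩, heq⟩
  exact (((h.continuousOn_linear x₀).mono fun s hs => hs.1).sub
    (h.continuousOn_duhamelTerm hWc hWb)).congr heq

/-- Local existence by Banach's fixed point theorem in the bounded continuous functions on
`(0, T]`, on the ball of radius `2 * ‖x₀‖`. -/
lemma exists_of_small [CompleteSpace X] (h : IsMildSystem S Q A σ) {x₀ : X} {T : ℝ} (hT : 0 < T)
    (hsmall : A * ‖x₀‖ * (T ^ σ / σ) ≤ 1 / 8) :
    ∃ U, IsAbstractMild S Q x₀ T U ∧ ∀ t ∈ Ioc 0 T, ‖U t‖ ≤ 2 * ‖x₀‖ := by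
  have hσ := h.exponent_pos
  have hA := h.const_pos
  -- Elements of `Y` are curves on `(0, T]`; `ext` extends them by `0`, as the Duhamel term is
  -- stated for functions on `ℝ`.
  let Y := BoundedContinuousFunction (Ioc 0 T) X
  let ext : Y → ℝ → X := fun u => Function.extend Subtype.val u 0
  have ext_apply : ∀ (u : Y) (t : Ioc 0 T), ext u t = u t := fun u t =>
    Subtype.val_injective.extend_apply _ _ _
  have ext_cont : ∀ u : Y, ContinuousOn (ext u) (Ioc 0 T) := fun u => by
    rw [continuousOn_iff_continuous_domRestrict]
    exact u.continuous.congr fun t => (ext_apply u t).symm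
  have ext_cont' : ∀ (u : Y) (t : ℝ), t ≤ T → ContinuousOn (ext u) (Ioo 0 t \ {0}) := fun u t ht =>
    (ext_cont u).mono fun s hs => ⟨hs.1.1, hs.1.2.le.trans ht⟩
  have ext_norm : ∀ (u : Y) (t : ℝ), t ∈ Ioc 0 T → ‖ext u t‖ ≤ ‖u‖ := fun u t ht => by
    rw [ext_apply u ⟨t, ht⟩]; exact u.norm_coe_le_norm _
  have hpow : ∀ t ∈ Ioc 0 T, t ^ σ / σ ≤ T ^ σ / σ := fun t ht => by
    have := Real.rpow_le_rpow ht.1.le ht.2 hσ.le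
    gcongr
  have hval : ∀ (u : Y) (t : Ioc 0 T), ‖S t x₀ - duhamelTerm Q (ext u) t‖ ≤
      ‖x₀‖ + A * ‖u‖ ^ 2 * (T ^ σ / σ) := fun u t => by
    refine (norm_sub_le _ _).trans (add_le_add (h.norm_le _ t.2.1 _) ?_)
    refine (h.norm_duhamelTerm_le t.2.1
      (fun s hs => ext_norm u s ⟨hs.1, hs.2.trans t.2.2⟩)).trans ?_
    have := hpow t t.2
    gcongr
  have hcont : ∀ u : Y, Continuous fun t : Ioc 0 T => S t x₀ - duhamelTerm Q (ext u) t := by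
    intro u
    have hc : ContinuousOn (fun t => S t x₀ - duhamelTerm Q (ext u) t) (Ioc 0 T) :=
      ((h.continuousOn_linear x₀).mono fun s hs => hs.1).sub
        (h.continuousOn_duhamelTerm (ext_cont' u T le_rfl) (ext_norm u))
    exact continuousOn_iff_continuous_domRestrict.1 hc
  let Φ : Y → Y := fun u => BoundedContinuousFunction.ofNormedAddCommGroup
    (fun t : Ioc 0 T => S t x₀ - duhamelTerm Q (ext u) t) (hcont u) _ (hval u)
  set R := 2 * ‖x₀‖ with hR
  have hR0 : 0 ≤ R := by positivity
  have hmaps : MapsTo Φ (Metric.closedBall 0 R) (Metric.closedBall 0 R) := by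
    intro u hu
    rw [mem_closedBall_zero_iff] at hu ⊢
    rw [BoundedContinuousFunction.norm_le hR0]
    intro t
    refine (hval u t).trans ?_
    have hTσ : 0 ≤ T ^ σ / σ := by positivity
    calc ‖x₀‖ + A * ‖u‖ ^ 2 * (T ^ σ / σ) ≤ ‖x₀‖ + A * R ^ 2 * (T ^ σ / σ) := by gcongr
      _ = ‖x₀‖ + 4 * ‖x₀‖ * (A * ‖x₀‖ * (T ^ σ / σ)) := by rw [hR]; ring
      _ ≤ ‖x₀‖ + 4 * ‖x₀‖ * (1 / 8) := by gcongr
      _ ≤ R := by rw [hR]; linarith [norm_nonneg x₀]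
  have hcontr : ContractingWith (1 / 2) (hmaps.restrict Φ _ _) := by
    refine ⟨by rw [← NNReal.coe_lt_coe]; norm_num, LipschitzWith.of_dist_le_mul fun u v => ?_⟩
    have hu := mem_closedBall_zero_iff.1 u.2
    have hv := mem_closedBall_zero_iff.1 v.2
    rw [Subtype.dist_eq, Subtype.dist_eq, BoundedContinuousFunction.dist_le (by positivity)]
    intro t
    have hsub : ∀ s ∈ Ioc 0 (t : ℝ), s ∈ Ioc 0 T := fun s hs => ⟨hs.1, hs.2.trans t.2.2⟩
    have hd : ∀ s ∈ Ioc 0 (t : ℝ), ‖ext v s - ext u s‖ ≤ dist (u : Y) v := by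
      intro s hs
      have h1 := ext_apply v ⟨s, hsub s hs⟩
      have h2 := ext_apply u ⟨s, hsub s hs⟩
      simp only at h1 h2
      rw [h1, h2, ← dist_eq_norm, dist_comm]
      exact BoundedContinuousFunction.dist_coe_le_dist _
    have hle := h.norm_duhamelTerm_sub_le (a := 0) t.2.1 (ext_cont' v t t.2.2)
      (ext_cont' u t t.2.2) (fun s hs => (ext_norm v s (hsub s hs)).trans hv)
      (fun s hs => (ext_norm u s (hsub s hs)).trans hu) hd
      ((IsMildSystem.intervalIntegrable_kernel hσ t).mul_const _)
    rw [intervalIntegral.integral_mul_const, IsMildSystem.integral_kernel hσ] at hle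
    have hΦ : dist ((Φ u : Y) t) ((Φ v : Y) t) =
        ‖duhamelTerm Q (ext v) t - duhamelTerm Q (ext u) t‖ := by
      rw [dist_eq_norm]
      congr 1
      change S t x₀ - duhamelTerm Q (ext u) t - (S t x₀ - duhamelTerm Q (ext v) t) = _
      abel
    change dist ((Φ u : Y) t) ((Φ v : Y) t) ≤ _
    rw [hΦ]
    refine hle.trans ?_
    have hp := hpow t t.2
    calc A * (R + R) * ((t : ℝ) ^ σ / σ * dist (u : Y) v)
        ≤ A * (R + R) * (T ^ σ / σ * dist (u : Y) v) := by gcongr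
      _ = 4 * (A * ‖x₀‖ * (T ^ σ / σ)) * dist (u : Y) v := by
          rw [show R + R = 4 * ‖x₀‖ by rw [hR]; ring]
          ring
      _ ≤ 4 * (1 / 8) * dist (u : Y) v := by gcongr
      _ = _ := by push_cast; ring
  obtain ⟨u, huR, hfix, -⟩ := hcontr.exists_fixedPoint' (s := Metric.closedBall (0 : Y) R)
    (Metric.isClosed_closedBall.isComplete) hmaps (x := 0) (by simpa using hR0) (edist_ne_top _ _)
  have hun := mem_closedBall_zero_iff.1 huR
  refine ⟨ext u, ⟨ext_cont u, ⟨_, ext_norm u⟩, fun t ht => ?_⟩,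
    fun t ht => (ext_norm u t ht).trans hun⟩
  have h1 : (Φ u) ⟨t, ht⟩ = u ⟨t, ht⟩ := by rw [hfix.eq]
  rw [ext_apply u ⟨t, ht⟩, ← h1]
  rfl

end IsAbstractMild

/-! ### Integral operators with nonnegative kernels -/

section KernelEstimates

variable {α β : Type*} [MeasurableSpace α] [MeasurableSpace β] {μ : Measure α} {ν : Measure β}
  {p : ℝ≥0∞}

lemma toReal_inv_eq (p : ℝ≥0∞) : p⁻¹.toReal = 1 / p.toReal := by
  rw [ENNReal.toReal_inv, one_div]

lemma toReal_inv_le_one (hp : 1 ≤ p) : p⁻¹.toReal ≤ 1 := by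
  have := ENNReal.toReal_mono ENNReal.one_ne_top (ENNReal.inv_le_one.2 hp)
  simpa using this

lemma toReal_inv_le_half (hp : 2 ≤ p) : p⁻¹.toReal ≤ 1 / 2 := by
  have := ENNReal.toReal_mono (by simp) (ENNReal.inv_le_inv.2 hp)
  simpa using this

lemma eLpNorm_eq_rpow_toReal_inv (hp : 1 ≤ p) (hp' : p ≠ ⊤) (f : α → ℝ≥0∞) :
    eLpNorm f p μ = (∫⁻ x, f x ^ p.toReal ∂μ) ^ p⁻¹.toReal := by
  rw [eLpNorm_eq_lintegral_rpow_enorm_toReal (one_pos.trans_le hp).ne' hp', toReal_inv_eq]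
  simp only [enorm_eq_self]

/-- Hölder's inequality with respect to the weight `k`, for one factor. -/
lemma lintegral_mul_le_rpow {k f : α → ℝ≥0∞} (hk : AEMeasurable k μ) (hf : AEMeasurable f μ)
    (hp : 1 ≤ p) (hp' : p ≠ ⊤) :
    ∫⁻ y, k y * f y ∂μ ≤
      (∫⁻ y, k y ∂μ) ^ (1 - p⁻¹.toReal) * (∫⁻ y, k y * f y ^ p.toReal ∂μ) ^ p⁻¹.toReal := by
  have hpos : 0 < p.toReal := ENNReal.toReal_pos (one_pos.trans_le hp).ne' hp'
  have hr1 := toReal_inv_le_one hp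
  have hr0 : 0 ≤ p⁻¹.toReal := ENNReal.toReal_nonneg
  refine le_trans (lintegral_mono fun y => le_of_eq ?_)
    (ENNReal.lintegral_mul_norm_pow_le hk (hk.mul (hf.pow_const p.toReal)) (sub_nonneg.2 hr1) hr0
      (by ring))
  simp only [Pi.mul_apply]
  rw [ENNReal.mul_rpow_of_nonneg _ _ hr0, ← mul_assoc,
    ← ENNReal.rpow_add_of_nonneg _ _ (sub_nonneg.2 hr1) hr0, sub_add_cancel, ENNReal.rpow_one,
    ← ENNReal.rpow_mul, toReal_inv_eq, mul_one_div_cancel hpos.ne', ENNReal.rpow_one]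

/-- Hölder's inequality with respect to the weight `k`, for two factors. -/
lemma lintegral_mul_mul_le_rpow {k f g : α → ℝ≥0∞} (hk : AEMeasurable k μ)
    (hf : AEMeasurable f μ) (hg : AEMeasurable g μ) (hp : 2 ≤ p) (hp' : p ≠ ⊤) :
    ∫⁻ y, k y * (f y * g y) ∂μ ≤ (∫⁻ y, k y ∂μ) ^ (1 - 2 * p⁻¹.toReal) *
      ((∫⁻ y, k y * f y ^ p.toReal ∂μ) ^ p⁻¹.toReal *
        (∫⁻ y, k y * g y ^ p.toReal ∂μ) ^ p⁻¹.toReal) := by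
  have hpos : 0 < p.toReal := ENNReal.toReal_pos (two_pos.trans_le hp).ne' hp'
  have hr1 := toReal_inv_le_half hp
  have hr0 : 0 ≤ p⁻¹.toReal := ENNReal.toReal_nonneg
  have h := ENNReal.lintegral_mul_prod_norm_pow_le (μ := μ) (Finset.univ : Finset (Fin 2)) (g := k)
    (f := ![fun y => k y * f y ^ p.toReal, fun y => k y * g y ^ p.toReal]) hk
    (by
      intro i _
      fin_cases i
      exacts [hk.mul (hf.pow_const _), hk.mul (hg.pow_const _)])
    (1 - 2 * p⁻¹.toReal) (p := fun _ => p⁻¹.toReal)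
    (by simp only [Fin.sum_univ_two]; ring) (by linarith) (fun _ _ => hr0)
  simp only [Fin.prod_univ_two, Matrix.cons_val_zero, Matrix.cons_val_one] at h
  refine le_trans (lintegral_mono fun y => le_of_eq ?_) h
  have e : ∀ a : ℝ≥0∞, (a ^ p.toReal) ^ p⁻¹.toReal = a := fun a => by
    rw [← ENNReal.rpow_mul, toReal_inv_eq, mul_one_div_cancel hpos.ne', ENNReal.rpow_one]
  rw [ENNReal.mul_rpow_of_nonneg _ _ hr0, ENNReal.mul_rpow_of_nonneg _ _ hr0, e, e,
    mul_mul_mul_comm, ← ENNReal.rpow_add_of_nonneg _ _ hr0 hr0,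
    ← mul_assoc (k y ^ (1 - 2 * p⁻¹.toReal)),
    ← ENNReal.rpow_add_of_nonneg _ _ (by linarith) (by linarith)]
  rw [show 1 - 2 * p⁻¹.toReal + (p⁻¹.toReal + p⁻¹.toReal) = 1 by ring, ENNReal.rpow_one]

lemma rpow_lintegral_mul_le_of_le {k f : α → ℝ≥0∞} {M : ℝ≥0∞} (hf : AEMeasurable f μ)
    (hM : ∀ y, k y ≤ M) (hp : 1 ≤ p) (hp' : p ≠ ⊤) :
    (∫⁻ y, k y * f y ^ p.toReal ∂μ) ^ p⁻¹.toReal ≤ M ^ p⁻¹.toReal * eLpNorm f p μ := by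
  have hr0 : 0 ≤ p⁻¹.toReal := ENNReal.toReal_nonneg
  rw [eLpNorm_eq_rpow_toReal_inv hp hp', ← ENNReal.mul_rpow_of_nonneg _ _ hr0,
    ← lintegral_const_mul'' _ (hf.pow_const _)]
  gcongr with y
  exact hM y

lemma lintegral_mul_le_eLpNorm {k f : α → ℝ≥0∞} {A M : ℝ≥0∞} (hk : AEMeasurable k μ)
    (hf : AEMeasurable f μ) (hA : ∫⁻ y, k y ∂μ ≤ A) (hM : ∀ y, k y ≤ M) (hp : 1 ≤ p) :
    ∫⁻ y, k y * f y ∂μ ≤ A ^ (1 - p⁻¹.toReal) * M ^ p⁻¹.toReal * eLpNorm f p μ := by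
  rcases eq_or_ne p ⊤ with rfl | hp'
  · simp only [ENNReal.inv_top, ENNReal.toReal_zero, sub_zero, ENNReal.rpow_one, ENNReal.rpow_zero,
      mul_one]
    calc ∫⁻ y, k y * f y ∂μ ≤ ∫⁻ y, k y * eLpNorm f ⊤ μ ∂μ := by
          refine lintegral_mono_ae ?_
          filter_upwards [ae_le_eLpNormEssSup (f := f) (μ := μ)] with y hy
          rw [eLpNorm_exponent_top]
          gcongr
          simpa using hy
      _ ≤ _ := by rw [lintegral_mul_const'' _ hk]; gcongr
  · have hr1 := toReal_inv_le_one hp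
    refine (lintegral_mul_le_rpow hk hf hp hp').trans ?_
    rw [mul_assoc]
    exact mul_le_mul' (ENNReal.rpow_le_rpow hA (by linarith))
      (rpow_lintegral_mul_le_of_le hf hM hp hp')

lemma lintegral_mul_mul_le_eLpNorm {k f g : α → ℝ≥0∞} {A M : ℝ≥0∞} (hk : AEMeasurable k μ)
    (hf : AEMeasurable f μ) (hg : AEMeasurable g μ) (hA : ∫⁻ y, k y ∂μ ≤ A) (hM : ∀ y, k y ≤ M)
    (hp : 2 ≤ p) :
    ∫⁻ y, k y * (f y * g y) ∂μ ≤
      A ^ (1 - 2 * p⁻¹.toReal) * M ^ (2 * p⁻¹.toReal) * (eLpNorm f p μ * eLpNorm g p μ) := by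
  rcases eq_or_ne p ⊤ with rfl | hp'
  · simp only [ENNReal.inv_top, ENNReal.toReal_zero, mul_zero, sub_zero, ENNReal.rpow_one,
      ENNReal.rpow_zero, mul_one]
    calc ∫⁻ y, k y * (f y * g y) ∂μ
        ≤ ∫⁻ y, k y * (eLpNorm f ⊤ μ * eLpNorm g ⊤ μ) ∂μ := by
          refine lintegral_mono_ae ?_
          filter_upwards [ae_le_eLpNormEssSup (f := f) (μ := μ),
            ae_le_eLpNormEssSup (f := g) (μ := μ)] with y hy hy'
          rw [eLpNorm_exponent_top, eLpNorm_exponent_top]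
          gcongr
          · simpa using hy
          · simpa using hy'
      _ ≤ _ := by rw [lintegral_mul_const'' _ hk]; gcongr
  · have hr1 := toReal_inv_le_half hp
    have hp1 : 1 ≤ p := one_le_two.trans hp
    have hr0 : 0 ≤ p⁻¹.toReal := ENNReal.toReal_nonneg
    refine (lintegral_mul_mul_le_rpow hk hf hg hp hp').trans ?_
    rw [mul_assoc, two_mul p⁻¹.toReal, ENNReal.rpow_add_of_nonneg _ _ hr0 hr0, mul_mul_mul_comm,
      ← two_mul]
    exact mul_le_mul' (ENNReal.rpow_le_rpow hA (by linarith)) (mul_le_mul'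
      (rpow_lintegral_mul_le_of_le hf hM hp1 hp') (rpow_lintegral_mul_le_of_le hg hM hp1 hp'))

variable [SFinite μ] [SFinite ν]

lemma eLpNorm_rpow_lintegral_le {k : α → β → ℝ≥0∞} (hk : Measurable (Function.uncurry k))
    {f : β → ℝ≥0∞} (hf : AEMeasurable f ν) {B : ℝ≥0∞} (hB : ∀ y, ∫⁻ x, k x y ∂μ ≤ B)
    (hp : 1 ≤ p) (hp' : p ≠ ⊤) :
    eLpNorm (fun x => (∫⁻ y, k x y * f y ^ p.toReal ∂ν) ^ p⁻¹.toReal) p μ ≤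
      B ^ p⁻¹.toReal * eLpNorm f p ν := by
  have hpos : 0 < p.toReal := ENNReal.toReal_pos (one_pos.trans_le hp).ne' hp'
  have hr0 : 0 ≤ p⁻¹.toReal := ENNReal.toReal_nonneg
  rw [eLpNorm_eq_rpow_toReal_inv hp hp', eLpNorm_eq_rpow_toReal_inv hp hp',
    ← ENNReal.mul_rpow_of_nonneg _ _ hr0]
  refine ENNReal.rpow_le_rpow ?_ hr0
  have e : ∀ a : ℝ≥0∞, (a ^ p⁻¹.toReal) ^ p.toReal = a := fun a => by
    rw [← ENNReal.rpow_mul, toReal_inv_eq, one_div_mul_cancel hpos.ne', ENNReal.rpow_one]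
  simp only [e]
  rw [lintegral_lintegral_swap, ← lintegral_const_mul'' _ (hf.pow_const _)]
  · refine lintegral_mono fun y => ?_
    rw [lintegral_mul_const (f := fun x => k x y) _
      (hk.comp (measurable_id.prodMk measurable_const))]
    gcongr
    exact hB y
  · exact hk.aemeasurable.mul ((hf.pow_const _).comp_snd)

/-- **Schur's test** in `L^p`, with the two kernel bounds entering with the exponents given by
interpolation between `L^∞` and `L^1`. -/
lemma eLpNorm_lintegral_mul_le {k : α → β → ℝ≥0∞} (hk : Measurable (Function.uncurry k))
    {f : β → ℝ≥0∞} (hf : AEMeasurable f ν) {A B : ℝ≥0∞} (hA : ∀ x, ∫⁻ y, k x y ∂ν ≤ A)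
    (hB : ∀ y, ∫⁻ x, k x y ∂μ ≤ B) (hp : 1 ≤ p) :
    eLpNorm (fun x => ∫⁻ y, k x y * f y ∂ν) p μ ≤
      A ^ (1 - p⁻¹.toReal) * B ^ p⁻¹.toReal * eLpNorm f p ν := by
  have hkx : ∀ x, AEMeasurable (k x) ν := fun x =>
    (hk.comp (measurable_const.prodMk measurable_id)).aemeasurable
  rcases eq_or_ne p ⊤ with rfl | hp'
  · rw [eLpNorm_exponent_top, eLpNorm_exponent_top]
    refine eLpNormEssSup_le_of_ae_enorm_bound (.of_forall fun x => ?_)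
    have := lintegral_mul_le_eLpNorm (p := ⊤) (M := ⊤) (hkx x) hf (hA x) (fun _ => le_top) hp
    simpa using this
  · have hr1 := toReal_inv_le_one hp
    rw [mul_assoc]
    refine le_trans ?_ (mul_le_mul_right (eLpNorm_rpow_lintegral_le hk hf hB hp hp') _)
    refine eLpNorm_le_mul_eLpNorm_of_ae_le_mul'' p ?_ (.of_forall fun x => ?_)
    · refine AEMeasurable.aestronglyMeasurable (AEMeasurable.pow_const ?_ _)
      exact AEMeasurable.lintegral_prod_right'
        (f := fun z : α × β => k z.1 z.2 * f z.2 ^ p.toReal)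
        (hk.aemeasurable.mul ((hf.pow_const _).comp_snd))
    · simp only [enorm_eq_self]
      exact (lintegral_mul_le_rpow (hkx x) hf hp hp').trans
        (mul_le_mul_left (ENNReal.rpow_le_rpow (hA x) (by linarith)) _)

/-- The bilinear counterpart of Schur's test: a kernel which is also bounded maps products of two
`L^p` functions to `L^p`. For a convolution kernel this is Young's inequality
`L^{p/2} * L^{p'} ⊆ L^p`. -/
lemma eLpNorm_lintegral_mul_mul_le {k : α → β → ℝ≥0∞} (hk : Measurable (Function.uncurry k))
    {f g : β → ℝ≥0∞} (hf : AEMeasurable f ν) (hg : AEMeasurable g ν) {A M : ℝ≥0∞}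
    (hA : ∀ x, ∫⁻ y, k x y ∂ν ≤ A) (hB : ∀ y, ∫⁻ x, k x y ∂μ ≤ A) (hM : ∀ x y, k x y ≤ M)
    (hp : 2 ≤ p) :
    eLpNorm (fun x => ∫⁻ y, k x y * (f y * g y) ∂ν) p μ ≤
      A ^ (1 - p⁻¹.toReal) * M ^ p⁻¹.toReal * (eLpNorm f p ν * eLpNorm g p ν) := by
  have hkx : ∀ x, AEMeasurable (k x) ν := fun x =>
    (hk.comp (measurable_const.prodMk measurable_id)).aemeasurable
  rcases eq_or_ne p ⊤ with rfl | hp'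
  · rw [eLpNorm_exponent_top]
    refine eLpNormEssSup_le_of_ae_enorm_bound (.of_forall fun x => ?_)
    have := lintegral_mul_mul_le_eLpNorm (p := ⊤) (hkx x) hf hg (hA x) (hM x) hp
    simpa using this
  · have hp1 : 1 ≤ p := one_le_two.trans hp
    have hr1 := toReal_inv_le_half hp
    have hr0 : 0 ≤ p⁻¹.toReal := ENNReal.toReal_nonneg
    have key : eLpNorm (fun x => ∫⁻ y, k x y * (f y * g y) ∂ν) p μ ≤
        A ^ (1 - 2 * p⁻¹.toReal) * (M ^ p⁻¹.toReal * eLpNorm f p ν) *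
          (A ^ p⁻¹.toReal * eLpNorm g p ν) := by
      refine le_trans ?_ (mul_le_mul_right (eLpNorm_rpow_lintegral_le hk hg hB hp1 hp') _)
      refine eLpNorm_le_mul_eLpNorm_of_ae_le_mul'' p ?_ (.of_forall fun x => ?_)
      · refine AEMeasurable.aestronglyMeasurable (AEMeasurable.pow_const ?_ _)
        exact AEMeasurable.lintegral_prod_right'
          (f := fun z : α × β => k z.1 z.2 * g z.2 ^ p.toReal)
          (hk.aemeasurable.mul ((hg.pow_const _).comp_snd))
      · simp only [enorm_eq_self]
        refine (lintegral_mul_mul_le_rpow (hkx x) hf hg hp hp').trans ?_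
        rw [← mul_assoc]
        exact mul_le_mul_left (mul_le_mul' (ENNReal.rpow_le_rpow (hA x) (by linarith))
          (rpow_lintegral_mul_le_of_le hf (hM x) hp1 hp')) _
    refine key.trans (le_of_eq ?_)
    rw [show 1 - p⁻¹.toReal = 1 - 2 * p⁻¹.toReal + p⁻¹.toReal by ring,
      ENNReal.rpow_add_of_nonneg _ _ (by linarith) hr0]
    ring

end KernelEstimates

/-! ### Derivatives of the heat kernel -/

section HeatKernel

variable {d : ℕ}

/-- The Kronecker delta. -/
def delta (i j : Fin d) : ℝ := if i = j then 1 else 0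

/-- `∂_l Γ_s`. -/
def heatD1 (l : Fin d) (s : ℝ) (x : E d) : ℝ := -(x l) / (2 * s) * heatKernel d s x

/-- `∂_k ∂_l Γ_s`. -/
def heatD2 (k l : Fin d) (s : ℝ) (x : E d) : ℝ :=
  (x k * x l / (4 * s ^ 2) - delta k l / (2 * s)) * heatKernel d s x

/-- `∂_j ∂_k ∂_l Γ_s`. -/
def heatD3 (j k l : Fin d) (s : ℝ) (x : E d) : ℝ :=
  ((delta k l * x j + delta j k * x l + delta j l * x k) / (4 * s ^ 2)
    - x j * x k * x l / (8 * s ^ 3)) * heatKernel d s x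

lemma delta_comm (i j : Fin d) : delta i j = delta j i := by simp only [delta, eq_comm]

lemma abs_delta_le (i j : Fin d) : |delta i j| ≤ 1 := by
  unfold delta; split_ifs <;> simp

lemma abs_coord_le (x : E d) (i : Fin d) : |x i| ≤ ‖x‖ := by
  simpa using PiLp.norm_apply_le x i

lemma hasDerivAt_coord (x : E d) (l k : Fin d) :
    HasDerivAt (fun τ : ℝ => (x + τ • EuclideanSpace.single l (1 : ℝ)) k) (delta l k) 0 := by
  have : (fun τ : ℝ => (x + τ • EuclideanSpace.single l (1 : ℝ)) k) =
      fun τ => x k + τ * delta l k := by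
    funext τ
    simp [delta, eq_comm]
  rw [this]
  simpa using ((hasDerivAt_id (0 : ℝ)).mul_const (delta l k)).const_add (x k)

lemma hasLineDerivAt_heatKernel (l : Fin d) {s : ℝ} (hs : 0 < s) (x : E d) :
    HasLineDerivAt ℝ (heatKernel d s) (heatD1 l s x) x (EuclideanSpace.single l 1) := by
  have h1 : HasDerivAt (fun τ : ℝ => x + τ • EuclideanSpace.single l (1 : ℝ))
      (EuclideanSpace.single l 1) 0 := by
    simpa using ((hasDerivAt_id (0 : ℝ)).smul_const (EuclideanSpace.single l (1 : ℝ))).const_add x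
  have h2 := (((h1.norm_sq.neg).div_const (4 * s)).exp).const_mul
    ((4 * Real.pi * s) ^ (-(d : ℝ) / 2))
  refine h2.congr_deriv ?_
  simp only [zero_smul, add_zero, Pi.neg_apply, EuclideanSpace.inner_single_right, heatD1,
    heatKernel]
  simp
  field_simp
  ring

lemma hasLineDerivAt_heatD1 (k l : Fin d) {s : ℝ} (hs : 0 < s) (x : E d) :
    HasLineDerivAt ℝ (heatD1 l s) (heatD2 k l s x) x (EuclideanSpace.single k 1) := by
  have h := ((hasDerivAt_coord x k l).neg.div_const (2 * s)).mul (hasLineDerivAt_heatKernel k hs x)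
  refine h.congr_deriv ?_
  simp only [zero_smul, add_zero, Pi.neg_apply, heatD1, heatD2]
  field_simp
  ring

lemma hasLineDerivAt_heatD2 (j k l : Fin d) {s : ℝ} (hs : 0 < s) (x : E d) :
    HasLineDerivAt ℝ (heatD2 k l s) (heatD3 j k l s x) x (EuclideanSpace.single j 1) := by
  have h := ((((hasDerivAt_coord x j k).mul (hasDerivAt_coord x j l)).div_const
    (4 * s ^ 2)).sub_const (delta k l / (2 * s))).mul (hasLineDerivAt_heatKernel j hs x)
  refine h.congr_deriv ?_
  simp only [zero_smul, add_zero, Pi.mul_apply, heatD1, heatD3]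
  field_simp
  ring

lemma pderiv_heatKernel (l : Fin d) {s : ℝ} (hs : 0 < s) :
    pderiv l (heatKernel d s) = heatD1 l s :=
  funext fun x => (hasLineDerivAt_heatKernel l hs x).lineDeriv

lemma pderiv_heatD1 (k l : Fin d) {s : ℝ} (hs : 0 < s) : pderiv k (heatD1 l s) = heatD2 k l s :=
  funext fun x => (hasLineDerivAt_heatD1 k l hs x).lineDeriv

lemma pderiv_heatD2 (j k l : Fin d) {s : ℝ} (hs : 0 < s) :
    pderiv j (heatD2 k l s) = heatD3 j k l s :=
  funext fun x => (hasLineDerivAt_heatD2 j k l hs x).lineDeriv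

lemma sum_delta_mul (l : Fin d) (a : Fin d → ℝ) : ∑ m, delta m l * a m = a l := by
  simp [delta]

lemma sum_delta_self : ∑ m : Fin d, delta m m = d := by simp [delta]

lemma sum_coord_sq (x : E d) : ∑ m, x m * x m = ‖x‖ ^ 2 := by
  rw [EuclideanSpace.real_norm_sq_eq]
  simp only [sq]

/-- `Δ ∂_l Γ_s` in closed form. -/
lemma sum_heatD3 (l : Fin d) (s : ℝ) (x : E d) :
    ∑ m, heatD3 m m l s x =
      ((d + 2) * x l / (4 * s ^ 2) - ‖x‖ ^ 2 * x l / (8 * s ^ 3)) * heatKernel d s x := by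
  simp only [heatD3]
  rw [← Finset.sum_mul, Finset.sum_sub_distrib, ← Finset.sum_div, ← Finset.sum_div,
    Finset.sum_add_distrib, Finset.sum_add_distrib, ← Finset.sum_mul, ← Finset.sum_mul,
    sum_delta_self, sum_delta_mul l (fun m => x m), sum_coord_sq]
  ring

lemma hasDerivAt_heatKernel_time {s : ℝ} (hs : 0 < s) (x : E d) :
    HasDerivAt (fun s => heatKernel d s x)
      ((‖x‖ ^ 2 / (4 * s ^ 2) - d / (2 * s)) * heatKernel d s x) s := by
  have hpi := Real.pi_pos
  have h1 : HasDerivAt (fun s : ℝ => 4 * Real.pi * s) (4 * Real.pi) s := by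
    simpa using (hasDerivAt_id s).const_mul (4 * Real.pi)
  have h2 := h1.rpow_const (p := -(d : ℝ) / 2) (Or.inl (by positivity))
  have h3 : HasDerivAt (fun s : ℝ => -‖x‖ ^ 2 / (4 * s)) (‖x‖ ^ 2 / (4 * s ^ 2)) s := by
    have := (((hasDerivAt_id s).const_mul 4).inv (by simpa using hs.ne')).const_mul (-‖x‖ ^ 2)
    refine this.congr_deriv ?_
    simp only [id]
    field_simp
  refine (h2.mul h3.exp).congr_deriv ?_
  rw [Real.rpow_sub_one (by positivity), heatKernel]
  field_simp
  ring

/-- The heat equation for `∂_l Γ_s`. -/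
lemma hasDerivAt_heatD1_time (l : Fin d) {s : ℝ} (hs : 0 < s) (x : E d) :
    HasDerivAt (fun s => heatD1 l s x) (∑ m, heatD3 m m l s x) s := by
  rw [sum_heatD3]
  have h1 : HasDerivAt (fun s : ℝ => -(x l) / (2 * s)) (x l / (2 * s ^ 2)) s := by
    have := (((hasDerivAt_id s).const_mul 2).inv (by simpa using hs.ne')).const_mul (-(x l))
    refine this.congr_deriv ?_
    simp only [id]
    field_simp
  refine (h1.mul (hasDerivAt_heatKernel_time hs x)).congr_deriv ?_
  field_simp
  ring

/-! ### Gaussian bounds -/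

lemma heatKernel_nonneg {s : ℝ} (hs : 0 ≤ s) (x : E d) : 0 ≤ heatKernel d s x := by
  have := Real.pi_pos
  unfold heatKernel; positivity

lemma heatKernel_le {s : ℝ} (hs : 0 < s) (x : E d) :
    heatKernel d s x ≤ (4 * Real.pi * s) ^ (-(d : ℝ) / 2) := by
  have := Real.pi_pos
  unfold heatKernel
  refine mul_le_of_le_one_right (by positivity) (Real.exp_le_one_iff.2 ?_)
  rw [neg_div]
  exact neg_nonpos.2 (by positivity)

lemma heatKernel_neg (s : ℝ) (x : E d) : heatKernel d s (-x) = heatKernel d s x := by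
  simp only [heatKernel, norm_neg]

lemma continuous_heatKernel (s : ℝ) : Continuous (heatKernel d s) := by
  unfold heatKernel; fun_prop

lemma measurable_heatKernel : Measurable fun z : ℝ × E d => heatKernel d z.1 z.2 := by
  unfold heatKernel
  refine Measurable.mul ?_ ?_
  · exact (measurable_fst.const_mul _).pow_const _
  · fun_prop

/-- Half of the Gaussian decay is kept in a heat kernel at twice the time, half is available to
absorb polynomial factors. -/
lemma heatKernel_eq_mul_two {s : ℝ} (hs : 0 < s) (x : E d) :
    heatKernel d s x =
      2 ^ ((d : ℝ) / 2) * Real.exp (-(‖x‖ ^ 2 / (8 * s))) * heatKernel d (2 * s) x := by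
  have hpi := Real.pi_pos
  have h1 : (4 * Real.pi * (2 * s)) ^ (-(d : ℝ) / 2) =
      2 ^ (-(d : ℝ) / 2) * (4 * Real.pi * s) ^ (-(d : ℝ) / 2) := by
    rw [← Real.mul_rpow (by norm_num) (by positivity)]; ring_nf
  have h2 : (2 : ℝ) ^ ((d : ℝ) / 2) * 2 ^ (-(d : ℝ) / 2) = 1 := by
    rw [← Real.rpow_add two_pos, neg_div, add_neg_cancel, Real.rpow_zero]
  have h3 : Real.exp (-‖x‖ ^ 2 / (4 * s)) =
      Real.exp (-(‖x‖ ^ 2 / (8 * s))) * Real.exp (-‖x‖ ^ 2 / (4 * (2 * s))) := by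
    rw [← Real.exp_add]
    congr 1
    field_simp
    ring
  unfold heatKernel
  rw [h1, h3]
  linear_combination -(((4 * Real.pi * s) ^ (-(d : ℝ) / 2)) *
    (Real.exp (-(‖x‖ ^ 2 / (8 * s))) * Real.exp (-‖x‖ ^ 2 / (4 * (2 * s))))) * h2

lemma cubic_le_exp (ρ : ℝ) : 1 + ρ + ρ ^ 2 + ρ ^ 3 ≤ 128 * Real.exp (ρ ^ 2 / 8) := by
  have h := Real.quadratic_le_exp_of_nonneg (show 0 ≤ ρ ^ 2 / 8 by positivity)
  nlinarith [sq_nonneg (ρ - 1), sq_nonneg (ρ ^ 2 - ρ), sq_nonneg ρ]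

/-- Constant in the Gaussian bounds for the derivatives of the heat kernel. -/
def gaussConst (d : ℕ) : ℝ := 128 * 2 ^ ((d : ℝ) / 2)

lemma gaussConst_pos (d : ℕ) : 0 < gaussConst d := by unfold gaussConst; positivity

lemma cubic_mul_heatKernel_le {s : ℝ} (hs : 0 < s) (x : E d) :
    (1 + ‖x‖ / √s + (‖x‖ / √s) ^ 2 + (‖x‖ / √s) ^ 3) * heatKernel d s x ≤
      gaussConst d * heatKernel d (2 * s) x := by
  have hρ : (‖x‖ / √s) ^ 2 = ‖x‖ ^ 2 / s := by rw [div_pow, Real.sq_sqrt hs.le]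
  have h := cubic_le_exp (‖x‖ / √s)
  rw [show (‖x‖ / √s) ^ 2 / 8 = ‖x‖ ^ 2 / (8 * s) by rw [hρ]; field_simp] at h
  have hk := heatKernel_nonneg (d := d) (s := 2 * s) (by positivity) x
  rw [heatKernel_eq_mul_two hs x, gaussConst]
  calc _ ≤ 128 * Real.exp (‖x‖ ^ 2 / (8 * s)) *
        (2 ^ ((d : ℝ) / 2) * Real.exp (-(‖x‖ ^ 2 / (8 * s))) * heatKernel d (2 * s) x) := by gcongr
    _ = 128 * 2 ^ ((d : ℝ) / 2) * heatKernel d (2 * s) x *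
        (Real.exp (‖x‖ ^ 2 / (8 * s)) * Real.exp (-(‖x‖ ^ 2 / (8 * s)))) := by ring
    _ = _ := by rw [← Real.exp_add, add_neg_cancel, Real.exp_zero, mul_one]

lemma abs_mul_heatKernel_le {s a c : ℝ} (hs : 0 < s) (ha : 0 ≤ a) (x : E d)
    (hc : |c| ≤ a * (1 + ‖x‖ / √s + (‖x‖ / √s) ^ 2 + (‖x‖ / √s) ^ 3)) :
    |c * heatKernel d s x| ≤ gaussConst d * a * heatKernel d (2 * s) x := by
  rw [abs_mul, abs_of_nonneg (heatKernel_nonneg hs.le x)]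
  calc |c| * heatKernel d s x
      ≤ a * (1 + ‖x‖ / √s + (‖x‖ / √s) ^ 2 + (‖x‖ / √s) ^ 3) * heatKernel d s x :=
        mul_le_mul_of_nonneg_right hc (heatKernel_nonneg hs.le x)
    _ = a * ((1 + ‖x‖ / √s + (‖x‖ / √s) ^ 2 + (‖x‖ / √s) ^ 3) * heatKernel d s x) := by ring
    _ ≤ a * (gaussConst d * heatKernel d (2 * s) x) :=
        mul_le_mul_of_nonneg_left (cubic_mul_heatKernel_le hs x) ha
    _ = _ := by ring

lemma abs_heatD1_le (l : Fin d) {s : ℝ} (hs : 0 < s) (x : E d) :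
    |heatD1 l s x| ≤ gaussConst d * (1 / √s) * heatKernel d (2 * s) x := by
  have hsq : 0 < √s := Real.sqrt_pos.2 hs
  have hs2 : √s ^ 2 = s := Real.sq_sqrt hs.le
  have hc : |-(x l) / (2 * s)| ≤
      1 / √s * (1 + ‖x‖ / √s + (‖x‖ / √s) ^ 2 + (‖x‖ / √s) ^ 3) := by
    have h1 : |-(x l) / (2 * s)| ≤ ‖x‖ / s := by
      rw [abs_div, abs_neg, abs_of_pos (show 0 < 2 * s by positivity)]
      exact div_le_div₀ (norm_nonneg x) (abs_coord_le x l) hs (by linarith)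
    refine h1.trans ?_
    have h2 : ‖x‖ / s = 1 / √s * (‖x‖ / √s) := by
      rw [div_mul_div_comm, one_mul, ← sq, hs2]
    rw [h2]
    gcongr
    have : 0 ≤ (‖x‖ / √s) ^ 2 := by positivity
    have : 0 ≤ (‖x‖ / √s) ^ 3 := by positivity
    linarith
  exact abs_mul_heatKernel_le hs (by positivity) x hc

lemma abs_heatD2_le (k l : Fin d) {s : ℝ} (hs : 0 < s) (x : E d) :
    |heatD2 k l s x| ≤ gaussConst d * (1 / s) * heatKernel d (2 * s) x := by
  have hsq : 0 < √s := Real.sqrt_pos.2 hs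
  have hs2 : √s ^ 2 = s := Real.sq_sqrt hs.le
  have hc : |x k * x l / (4 * s ^ 2) - delta k l / (2 * s)| ≤
      1 / s * (1 + ‖x‖ / √s + (‖x‖ / √s) ^ 2 + (‖x‖ / √s) ^ 3) := by
    have h1 : |x k * x l / (4 * s ^ 2)| ≤ 1 / s * (‖x‖ / √s) ^ 2 := by
      rw [abs_div, abs_mul, abs_of_pos (show 0 < 4 * s ^ 2 by positivity), div_pow, hs2]
      calc |x k| * |x l| / (4 * s ^ 2) ≤ ‖x‖ * ‖x‖ / (1 * s ^ 2) := by
            gcongr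
            exacts [abs_coord_le x k, abs_coord_le x l, by norm_num]
        _ = _ := by field_simp
    have h2 : |delta k l / (2 * s)| ≤ 1 / s := by
      rw [abs_div, abs_of_pos (show 0 < 2 * s by positivity)]
      exact div_le_div₀ zero_le_one (abs_delta_le k l) hs (by linarith)
    refine (abs_sub _ _).trans ((add_le_add h1 h2).trans ?_)
    have : 0 ≤ 1 / s * (‖x‖ / √s) := by positivity
    have : 0 ≤ 1 / s * (‖x‖ / √s) ^ 3 := by positivity
    linarith
  exact abs_mul_heatKernel_le hs (by positivity) x hc

lemma abs_heatD3_le (j k l : Fin d) {s : ℝ} (hs : 0 < s) (x : E d) :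
    |heatD3 j k l s x| ≤ gaussConst d * (1 / (s * √s)) * heatKernel d (2 * s) x := by
  have hsq : 0 < √s := Real.sqrt_pos.2 hs
  have hs2 : √s ^ 2 = s := Real.sq_sqrt hs.le
  have hc : |(delta k l * x j + delta j k * x l + delta j l * x k) / (4 * s ^ 2)
      - x j * x k * x l / (8 * s ^ 3)| ≤
      1 / (s * √s) * (1 + ‖x‖ / √s + (‖x‖ / √s) ^ 2 + (‖x‖ / √s) ^ 3) := by
    have hm : ∀ a b c : Fin d, |delta a b * x c| ≤ ‖x‖ := fun a b c => by
      rw [abs_mul]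
      calc _ ≤ 1 * ‖x‖ := by gcongr; exacts [abs_delta_le a b, abs_coord_le x c]
        _ = _ := one_mul _
    have h1 : |(delta k l * x j + delta j k * x l + delta j l * x k) / (4 * s ^ 2)| ≤
        1 / (s * √s) * (‖x‖ / √s) := by
      rw [abs_div, abs_of_pos (show 0 < 4 * s ^ 2 by positivity), div_mul_div_comm, one_mul,
        mul_assoc, ← sq, hs2, ← sq, div_le_div_iff₀ (by positivity) (by positivity)]
      have := abs_add_three (delta k l * x j) (delta j k * x l) (delta j l * x k)
      have h4 : |delta k l * x j + delta j k * x l + delta j l * x k| ≤ 4 * ‖x‖ := by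
        linarith [hm k l j, hm j k l, hm j l k, norm_nonneg x]
      calc _ ≤ 4 * ‖x‖ * s ^ 2 := by gcongr
        _ = _ := by ring
    have h2 : |x j * x k * x l / (8 * s ^ 3)| ≤ 1 / (s * √s) * (‖x‖ / √s) ^ 3 := by
      have e : 1 / (s * √s) * (‖x‖ / √s) ^ 3 = ‖x‖ * ‖x‖ * ‖x‖ / (1 * s ^ 3) := by
        rw [div_pow, div_mul_div_comm, one_mul, one_mul]
        congr 1
        · ring
        · rw [mul_assoc, ← pow_succ', show √s ^ (3 + 1) = (√s ^ 2) ^ 2 by ring, hs2]; ring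
      rw [e, abs_div, abs_mul, abs_mul, abs_of_pos (show 0 < 8 * s ^ 3 by positivity)]
      gcongr
      exacts [abs_coord_le x j, abs_coord_le x k, abs_coord_le x l, by norm_num]
    refine (abs_sub _ _).trans ((add_le_add h1 h2).trans ?_)
    have : 0 ≤ 1 / (s * √s) := by positivity
    have : 0 ≤ 1 / (s * √s) * (‖x‖ / √s) ^ 2 := by positivity
    linarith
  exact abs_mul_heatKernel_le hs (by positivity) x hc

lemma abs_heatKernel_time_deriv_le {s : ℝ} (hs : 0 < s) (x : E d) :
    |(‖x‖ ^ 2 / (4 * s ^ 2) - d / (2 * s)) * heatKernel d s x| ≤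
      gaussConst d * ((1 + d) * (1 / s)) * heatKernel d (2 * s) x := by
  have hs2 : √s ^ 2 = s := Real.sq_sqrt hs.le
  have hc : |‖x‖ ^ 2 / (4 * s ^ 2) - d / (2 * s)| ≤
      (1 + d) * (1 / s) * (1 + ‖x‖ / √s + (‖x‖ / √s) ^ 2 + (‖x‖ / √s) ^ 3) := by
    have h1 : |‖x‖ ^ 2 / (4 * s ^ 2)| ≤ 1 / s * (‖x‖ / √s) ^ 2 := by
      rw [abs_of_nonneg (by positivity), div_pow, hs2]
      calc ‖x‖ ^ 2 / (4 * s ^ 2) ≤ ‖x‖ ^ 2 / (1 * s ^ 2) := by gcongr; norm_num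
        _ = _ := by field_simp
    have h2 : |(d : ℝ) / (2 * s)| ≤ d * (1 / s) := by
      rw [abs_of_nonneg (by positivity), mul_one_div]
      gcongr
      linarith
    refine (abs_sub _ _).trans ((add_le_add h1 h2).trans ?_)
    have e1 : (1 : ℝ) / s * (‖x‖ / √s) ^ 2 ≤ (1 + d) * (1 / s) * (‖x‖ / √s) ^ 2 := by
      have : (0 : ℝ) ≤ d := Nat.cast_nonneg d
      gcongr
      exact le_mul_of_one_le_left (by positivity) (by linarith)
    have e2 : (d : ℝ) * (1 / s) ≤ (1 + d) * (1 / s) := by gcongr; linarith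
    have : 0 ≤ (1 + d) * (1 / s) * (‖x‖ / √s) := by positivity
    have : 0 ≤ (1 + d) * (1 / s) * (‖x‖ / √s) ^ 3 := by positivity
    linarith
  exact abs_mul_heatKernel_le hs (by positivity) x hc

end HeatKernel

section HeatKernelIntegrals

variable {d : ℕ}

/-! ### Mass and convolution of heat kernels -/

lemma integral_heatKernel {s : ℝ} (hs : 0 < s) : ∫ x, heatKernel d s x = 1 := by
  have hpi := Real.pi_pos
  have h := GaussianFourier.integral_rexp_neg_mul_sq_norm (V := E d)
    (show 0 < 1 / (4 * s) by positivity)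
  rw [finrank_euclideanSpace_fin] at h
  have e : ∀ x : E d, heatKernel d s x =
      (4 * Real.pi * s) ^ (-(d : ℝ) / 2) * Real.exp (-(1 / (4 * s)) * ‖x‖ ^ 2) := fun x => by
    rw [heatKernel]
    congr 2
    ring
  simp only [e]
  rw [integral_const_mul, h, show Real.pi / (1 / (4 * s)) = 4 * Real.pi * s by field_simp,
    ← Real.rpow_add (by positivity)]
  rw [neg_div, neg_add_cancel, Real.rpow_zero]

lemma integrable_heatKernel {s : ℝ} (hs : 0 < s) : Integrable (heatKernel d s) :=
  integrable_of_integral_eq_one (integral_heatKernel hs)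

lemma lintegral_heatKernel {s : ℝ} (hs : 0 < s) :
    ∫⁻ x, ENNReal.ofReal (heatKernel d s x) = 1 := by
  rw [← ofReal_integral_eq_lintegral_ofReal (integrable_heatKernel hs)
    (.of_forall fun x => heatKernel_nonneg hs.le x), integral_heatKernel hs, ENNReal.ofReal_one]

lemma heatKernel_mul_heatKernel {t s : ℝ} (ht : 0 < t) (hs : 0 < s) (x y : E d) :
    heatKernel d t (x - y) * heatKernel d s y =
      heatKernel d (t + s) x * heatKernel d (t * s / (t + s)) (y - (s / (t + s)) • x) := by
  have hpi := Real.pi_pos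
  have hts : 0 < t + s := by positivity
  have h1 : (4 * Real.pi * t) ^ (-(d : ℝ) / 2) * (4 * Real.pi * s) ^ (-(d : ℝ) / 2) =
      (4 * Real.pi * (t + s)) ^ (-(d : ℝ) / 2) *
        (4 * Real.pi * (t * s / (t + s))) ^ (-(d : ℝ) / 2) := by
    rw [← Real.mul_rpow (by positivity) (by positivity),
      ← Real.mul_rpow (by positivity) (by positivity)]
    congr 1
    field_simp
  have h2 : -‖x - y‖ ^ 2 / (4 * t) + -‖y‖ ^ 2 / (4 * s) = -‖x‖ ^ 2 / (4 * (t + s)) +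
      -‖y - (s / (t + s)) • x‖ ^ 2 / (4 * (t * s / (t + s))) := by
    rw [norm_sub_sq_real, norm_sub_sq_real, inner_smul_right, norm_smul, Real.norm_eq_abs,
      mul_pow, sq_abs, real_inner_comm x y]
    field_simp
    ring
  simp only [heatKernel]
  rw [mul_mul_mul_comm, h1, ← Real.exp_add, h2, Real.exp_add]
  ring

lemma integral_heatKernel_conv {t s : ℝ} (ht : 0 < t) (hs : 0 < s) (x : E d) :
    ∫ y, heatKernel d t (x - y) * heatKernel d s y = heatKernel d (t + s) x := by
  simp only [heatKernel_mul_heatKernel ht hs]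
  rw [integral_const_mul, integral_sub_right_eq_self (heatKernel d (t * s / (t + s))),
    integral_heatKernel (by positivity), mul_one]

/-- Differentiation of a convolution: the derivative falls on the smooth bounded factor. -/
lemma hasLineDerivAt_conv {h h' g : E d → ℝ} {v : E d} {C : ℝ} (hm : Measurable h)
    (hm' : Measurable h') (hg : Integrable g) (hb : ∀ x, |h x| ≤ C) (hb' : ∀ x, |h' x| ≤ C)
    (hd : ∀ x, HasLineDerivAt ℝ h (h' x) x v) (x : E d) :
    HasLineDerivAt ℝ (fun x => ∫ y, h (x - y) * g y) (∫ y, h' (x - y) * g y) x v := by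
  have hmeas : ∀ {f : E d → ℝ}, Measurable f → ∀ z : E d,
      AEStronglyMeasurable (fun y => f (z - y) * g y) volume := fun hf z =>
    (hf.comp (measurable_const.sub measurable_id)).aestronglyMeasurable.mul hg.1
  have key := (hasDerivAt_integral_of_dominated_loc_of_deriv_le (μ := (volume : Measure (E d)))
    (F := fun τ y => h (x + τ • v - y) * g y) (F' := fun τ y => h' (x + τ • v - y) * g y)
    (x₀ := (0 : ℝ)) (s := univ) (bound := fun y => C * |g y|) univ_mem
    (.of_forall fun τ => hmeas hm _) ?_ (hmeas hm' _) ?_ (hg.abs.const_mul C) ?_).2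
  · simpa [HasLineDerivAt] using key
  · exact (hg.abs.const_mul C).mono' (hmeas hm _) (.of_forall fun y => by
      rw [Real.norm_eq_abs, abs_mul]; gcongr; exact hb _)
  · exact .of_forall fun y τ _ => by rw [Real.norm_eq_abs, abs_mul]; gcongr; exact hb' _
  · refine .of_forall fun y τ _ => HasDerivAt.mul_const ?_ _
    have h0 : HasDerivAt (fun σ : ℝ => h (x + τ • v - y + σ • v)) (h' (x + τ • v - y)) (τ - τ) := by
      rw [sub_self]; exact hd _
    refine (h0.comp_sub_const τ τ).congr_of_eventuallyEq (.of_forall fun σ => ?_)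
    simp only
    congr 1
    rw [sub_smul]
    abel

lemma measurable_coord (i : Fin d) : Measurable fun x : E d => x i := by fun_prop

lemma measurable_heatD1 (l : Fin d) : Measurable fun z : ℝ × E d => heatD1 l z.1 z.2 := by
  have := measurable_heatKernel (d := d)
  unfold heatD1; fun_prop

lemma measurable_heatD2 (k l : Fin d) : Measurable fun z : ℝ × E d => heatD2 k l z.1 z.2 := by
  have := measurable_heatKernel (d := d)
  unfold heatD2; fun_prop

lemma measurable_heatD3 (j k l : Fin d) : Measurable fun z : ℝ × E d => heatD3 j k l z.1 z.2 := by
  have := measurable_heatKernel (d := d)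
  unfold heatD3; fun_prop

lemma measurable_time_space {γ : Type*} [MeasurableSpace γ] {f : ℝ → E d → ℝ}
    (hf : Measurable fun z : ℝ × E d => f z.1 z.2) {a : γ → ℝ} {b : γ → E d} (ha : Measurable a)
    (hb : Measurable b) : Measurable fun z => f (a z) (b z) := hf.comp (ha.prodMk hb)

lemma measurable_of_time {f : ℝ → E d → ℝ} (hf : Measurable fun z : ℝ × E d => f z.1 z.2) (s : ℝ) :
    Measurable (f s) := hf.comp (measurable_const.prodMk measurable_id)

/-- A bound on a derivative of `Γ_s` that is valid at all points of space. -/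
lemma abs_le_of_gaussian {s a b : ℝ} (hs : 0 < s) (ha : 0 ≤ a) (x : E d)
    (h : |b| ≤ gaussConst d * a * heatKernel d (2 * s) x) :
    |b| ≤ gaussConst d * a * (4 * Real.pi * (2 * s)) ^ (-(d : ℝ) / 2) :=
  h.trans (mul_le_mul_of_nonneg_left (heatKernel_le (by positivity) x)
    (mul_nonneg (gaussConst_pos d).le ha))

lemma integral_heatD_conv {f f' : ℝ → E d → ℝ} {v : E d} {t s : ℝ} {C : ℝ} (ht : 0 < t)
    (hm : Measurable (f s)) (hm' : Measurable (f' s)) (hb : ∀ x, |f s x| ≤ C)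
    (hb' : ∀ x, |f' s x| ≤ C) (hd : ∀ r > 0, ∀ x, HasLineDerivAt ℝ (f r) (f' r x) x v)
    (hs : 0 < s) (h : ∀ x, ∫ y, f s (x - y) * heatKernel d t y = f (s + t) x) (x : E d) :
    ∫ y, f' s (x - y) * heatKernel d t y = f' (s + t) x := by
  have h1 := hasLineDerivAt_conv hm hm' (integrable_heatKernel ht) hb hb' (hd s hs) x
  rw [show (fun x => ∫ y, f s (x - y) * heatKernel d t y) = f (s + t) from funext h] at h1
  exact h1.lineDeriv.symm.trans (hd (s + t) (by positivity) x).lineDeriv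

lemma integral_heatD3_conv (j k l : Fin d) {t s : ℝ} (ht : 0 < t) (hs : 0 < s) (x : E d) :
    ∫ y, heatD3 j k l s (x - y) * heatKernel d t y = heatD3 j k l (s + t) x := by
  have hpi := Real.pi_pos
  have b0 : ∀ x : E d, |heatKernel d s x| ≤ (4 * Real.pi * s) ^ (-(d : ℝ) / 2) := fun x => by
    rw [abs_of_nonneg (heatKernel_nonneg hs.le x)]; exact heatKernel_le hs x
  have b1 : ∀ (l : Fin d) (x : E d), |heatD1 l s x| ≤ _ := fun l x =>
    abs_le_of_gaussian hs (by positivity) x (abs_heatD1_le l hs x)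
  have b2 : ∀ (k l : Fin d) (x : E d), |heatD2 k l s x| ≤ _ := fun k l x =>
    abs_le_of_gaussian hs (by positivity) x (abs_heatD2_le k l hs x)
  have b3 : ∀ (j k l : Fin d) (x : E d), |heatD3 j k l s x| ≤ _ := fun j k l x =>
    abs_le_of_gaussian hs (by positivity) x (abs_heatD3_le j k l hs x)
  have m0 := measurable_of_time (measurable_heatKernel (d := d)) s
  have m1 := measurable_of_time (measurable_heatD1 l) s
  have m2 := measurable_of_time (measurable_heatD2 k l) s
  have m3 := measurable_of_time (measurable_heatD3 j k l) s
  have h1 := integral_heatD_conv (f := heatKernel d) (f' := heatD1 l) ht m0 m1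
    (fun x => (b0 x).trans (le_max_left _ _)) (fun x => (b1 l x).trans (le_max_right _ _))
    (fun r hr x => hasLineDerivAt_heatKernel l hr x) hs (fun x => integral_heatKernel_conv hs ht x)
  have h2 := integral_heatD_conv (f := heatD1 l) (f' := heatD2 k l) ht m1 m2
    (fun x => (b1 l x).trans (le_max_left _ _)) (fun x => (b2 k l x).trans (le_max_right _ _))
    (fun r hr x => hasLineDerivAt_heatD1 k l hr x) hs h1
  exact integral_heatD_conv (f := heatD2 k l) (f' := heatD3 j k l) ht m2 m3
    (fun x => (b2 k l x).trans (le_max_left _ _)) (fun x => (b3 j k l x).trans (le_max_right _ _))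
    (fun r hr x => hasLineDerivAt_heatD2 j k l hr x) hs h2 x

/-! ### The Oseen kernel as an integral over time -/

/-- `∂_j ∂_k ∂_l Γ_s - δ_{jk} Δ ∂_l Γ_s`. By the heat equation the Oseen kernel at time `t` is the
integral of this density over `s > t`. -/
def oseenDensity (j k l : Fin d) (s : ℝ) (x : E d) : ℝ :=
  heatD3 j k l s x - delta j k * ∑ m, heatD3 m m l s x

/-- Constant in the Gaussian bound for `oseenDensity`. -/
def oseenConst (d : ℕ) : ℝ := (1 + d) * gaussConst d

lemma oseenConst_pos (d : ℕ) : 0 < oseenConst d := by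
  have := gaussConst_pos d
  unfold oseenConst; positivity

lemma measurable_oseenDensity (j k l : Fin d) :
    Measurable fun z : ℝ × E d => oseenDensity j k l z.1 z.2 :=
  (measurable_heatD3 j k l).sub
    (measurable_const.mul (Finset.measurable_fun_sum _ fun m _ => measurable_heatD3 m m l))

lemma one_div_mul_sqrt {s : ℝ} (hs : 0 < s) : 1 / (s * √s) = s ^ (-(3 / 2) : ℝ) := by
  rw [Real.rpow_neg hs.le, one_div, show (3 / 2 : ℝ) = 1 + 1 / 2 by norm_num,
    Real.rpow_add hs, Real.rpow_one, Real.sqrt_eq_rpow]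

lemma abs_oseenDensity_le (j k l : Fin d) {s : ℝ} (hs : 0 < s) (x : E d) :
    |oseenDensity j k l s x| ≤ oseenConst d * (s ^ (-(3 / 2) : ℝ) * heatKernel d (2 * s) x) := by
  have h := fun j k l : Fin d => abs_heatD3_le j k l hs x
  rw [one_div_mul_sqrt hs] at h
  have hsum : |∑ m, heatD3 m m l s x| ≤
      d * (gaussConst d * s ^ (-(3 / 2) : ℝ) * heatKernel d (2 * s) x) := by
    refine (Finset.abs_sum_le_sum_abs _ _).trans ((Finset.sum_le_sum fun m _ => h m m l).trans ?_)
    simp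
  calc |oseenDensity j k l s x| ≤ |heatD3 j k l s x| + |delta j k * ∑ m, heatD3 m m l s x| :=
        abs_sub _ _
    _ ≤ gaussConst d * s ^ (-(3 / 2) : ℝ) * heatKernel d (2 * s) x +
        1 * (d * (gaussConst d * s ^ (-(3 / 2) : ℝ) * heatKernel d (2 * s) x)) := by
        rw [abs_mul]
        exact add_le_add (h j k l) (mul_le_mul (abs_delta_le j k) hsum (abs_nonneg _) zero_le_one)
    _ = _ := by rw [oseenConst]; ring

lemma heatKernel_le_of_le {a s : ℝ} (ha : 0 < a) (has : a ≤ s) (x : E d) :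
    heatKernel d s x ≤ (4 * Real.pi * a) ^ (-(d : ℝ) / 2) := by
  have hpi := Real.pi_pos
  refine (heatKernel_le (ha.trans_le has) x).trans
    (Real.rpow_le_rpow_of_nonpos (by positivity) (by gcongr) ?_)
  rw [neg_div]
  exact neg_nonpos.2 (by positivity)

lemma integrableOn_Ioi_of_gaussian {f : ℝ → ℝ} {t C : ℝ} (ht : 0 < t) (hC : 0 ≤ C) (x : E d)
    (hf : Measurable f)
    (h : ∀ s > 0, |f s| ≤ C * (s ^ (-(3 / 2) : ℝ) * heatKernel d (2 * s) x)) :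
    IntegrableOn f (Ioi t) := by
  refine ((integrableOn_Ioi_rpow_of_lt (a := -(3 / 2)) (by norm_num) ht).const_mul
    (C * (4 * Real.pi * (2 * t)) ^ (-(d : ℝ) / 2))).mono' hf.aestronglyMeasurable ?_
  filter_upwards [ae_restrict_mem measurableSet_Ioi] with s hs
  have hs0 : 0 < s := ht.trans hs
  refine (h s hs0).trans ?_
  have h1 := heatKernel_le_of_le (d := d) (a := 2 * t) (s := 2 * s) (by positivity)
    (by have := mem_Ioi.1 hs; linarith) x
  calc C * (s ^ (-(3 / 2) : ℝ) * heatKernel d (2 * s) x)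
      ≤ C * (s ^ (-(3 / 2) : ℝ) * (4 * Real.pi * (2 * t)) ^ (-(d : ℝ) / 2)) := by gcongr
    _ = _ := by ring

lemma integrableOn_heatD3 (j k l : Fin d) {t : ℝ} (ht : 0 < t) (x : E d) :
    IntegrableOn (fun s => heatD3 j k l s x) (Ioi t) := by
  refine integrableOn_Ioi_of_gaussian ht (gaussConst_pos d).le x
    ((measurable_heatD3 j k l).comp (measurable_id.prodMk measurable_const)) fun s hs => ?_
  rw [← mul_assoc, ← one_div_mul_sqrt hs]
  exact abs_heatD3_le j k l hs x

lemma integrableOn_oseenDensity (j k l : Fin d) {t : ℝ} (ht : 0 < t) (x : E d) :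
    IntegrableOn (fun s => oseenDensity j k l s x) (Ioi t) := by
  have hm : Measurable fun s => oseenDensity j k l s x :=
    measurable_time_space (measurable_oseenDensity j k l) measurable_id measurable_const
  exact integrableOn_Ioi_of_gaussian ht (oseenConst_pos d).le x hm
    fun s hs => abs_oseenDensity_le j k l hs x

lemma tendsto_heatD1_atTop (l : Fin d) (x : E d) :
    Tendsto (fun s => heatD1 l s x) atTop (𝓝 0) := by
  have hpi := Real.pi_pos
  have h1 : Tendsto (fun s : ℝ => gaussConst d * (1 / √s) *
      (4 * Real.pi * (2 * 1)) ^ (-(d : ℝ) / 2)) atTop (𝓝 0) := by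
    have := ((tendsto_const_nhds (x := (1 : ℝ))).div_atTop Real.tendsto_sqrt_atTop).const_mul
      (gaussConst d)
    simpa using this.mul_const ((4 * Real.pi * (2 * 1)) ^ (-(d : ℝ) / 2))
  refine squeeze_zero_norm' ?_ h1
  filter_upwards [eventually_ge_atTop 1] with s hs
  have hs0 : 0 < s := one_pos.trans_le hs
  refine (abs_heatD1_le l hs0 x).trans (mul_le_mul_of_nonneg_left
    (heatKernel_le_of_le (by norm_num) (by linarith) x) ?_)
  have := gaussConst_pos d
  positivity

lemma heatD1_eq_neg_integral (l : Fin d) {t : ℝ} (ht : 0 < t) (x : E d) :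
    heatD1 l t x = -∫ s in Ioi t, ∑ m, heatD3 m m l s x := by
  rw [integral_Ioi_of_hasDerivAt_of_tendsto (f := fun s => heatD1 l s x) (m := 0)
    (hasDerivAt_heatD1_time l ht x).continuousAt.continuousWithinAt
    (fun s hs => hasDerivAt_heatD1_time l (ht.trans hs) x)
    (integrable_finsetSum _ fun m _ => integrableOn_heatD3 m m l ht x)
    (tendsto_heatD1_atTop l x)]
  ring

lemma oseenKernel_eq_integral (j k l : Fin d) {t : ℝ} (ht : 0 < t) (x : E d) :
    oseenKernel j k l t x = ∫ s in Ioi t, oseenDensity j k l s x := by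
  have h1 : ∫ s in Ioi t, pderiv j (pderiv k (pderiv l (heatKernel d s))) x =
      ∫ s in Ioi t, heatD3 j k l s x :=
    setIntegral_congr_fun measurableSet_Ioi fun s hs => by
      simp only [pderiv_heatKernel l (ht.trans hs), pderiv_heatD1 k l (ht.trans hs),
        pderiv_heatD2 j k l (ht.trans hs)]
  simp only [oseenDensity]
  rw [oseenKernel, h1, integral_sub (integrableOn_heatD3 j k l ht x)
    ((integrable_finsetSum _ fun m _ => integrableOn_heatD3 m m l ht x).const_mul _),
    integral_const_mul, pderiv_heatKernel l ht, heatD1_eq_neg_integral l ht]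
  by_cases hjk : j = k
  · simp [delta, hjk]; ring
  · simp [delta, hjk]

lemma measurable_oseenKernel (j k l : Fin d) {t : ℝ} (ht : 0 < t) :
    Measurable (oseenKernel j k l t) := by
  rw [show oseenKernel j k l t = fun x => ∫ s in Ioi t, oseenDensity j k l s x from
    funext fun x => oseenKernel_eq_integral j k l ht x]
  have h : StronglyMeasurable fun z : E d × ℝ => oseenDensity j k l z.2 z.1 :=
    ((measurable_oseenDensity j k l).comp measurable_swap).stronglyMeasurable
  exact h.integral_prod_right'.measurable

lemma integral_oseenDensity_conv (j k l : Fin d) {t s : ℝ} (ht : 0 < t) (hs : 0 < s) (x : E d) :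
    ∫ y, oseenDensity j k l s (x - y) * heatKernel d t y = oseenDensity j k l (s + t) x := by
  have hi : ∀ j k l : Fin d, Integrable fun y => heatD3 j k l s (x - y) * heatKernel d t y :=
    fun j k l => (integrable_heatKernel ht).bdd_mul (c :=
      gaussConst d * (1 / (s * √s)) * (4 * Real.pi * (2 * s)) ^ (-(d : ℝ) / 2))
      ((measurable_of_time (measurable_heatD3 j k l) s).comp
        (measurable_const.sub measurable_id)).aestronglyMeasurable
      (.of_forall fun y => abs_le_of_gaussian hs (by positivity) _ (abs_heatD3_le j k l hs (x - y)))
  simp only [oseenDensity, sub_mul, mul_assoc, Finset.sum_mul]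
  rw [integral_sub (hi j k l) ((integrable_finsetSum _ fun m _ => hi m m l).const_mul _),
    integral_const_mul, integral_finsetSum _ fun m _ => hi m m l]
  simp only [integral_heatD3_conv _ _ _ ht hs]

lemma integral_Ioi_comp_add (f : ℝ → ℝ) (s t : ℝ) :
    ∫ r in Ioi s, f (r + t) = ∫ r in Ioi (s + t), f r := by
  have := (measurePreserving_add_right volume t).setIntegral_preimage_emb
    (measurableEmbedding_addRight t) f (Ioi (s + t))
  rw [← this]
  congr 2
  ext r
  simp

/-- Fubini's theorem for the time integral that defines the Oseen kernel: it reduces identities for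
the kernel to identities for derivatives of Gaussians. -/
lemma integral_mul_oseenKernel_comp (j k l : Fin d) {s : ℝ} (hs : 0 < s) {ψ : E d → ℝ}
    (hψ : Integrable ψ) {b : E d → E d} (hb : Measurable b) :
    IntegrableOn (fun r => ∫ y, ψ y * oseenDensity j k l r (b y)) (Ioi s) ∧
      ∫ y, ψ y * oseenKernel j k l s (b y) =
        ∫ r in Ioi s, ∫ y, ψ y * oseenDensity j k l r (b y) := by
  have hpi := Real.pi_pos
  suffices hint : Integrable (Function.uncurry fun y r => ψ y * oseenDensity j k l r (b y))
      (volume.prod (volume.restrict (Ioi s))) by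
    refine ⟨hint.integral_prod_right, ?_⟩
    simp only [oseenKernel_eq_integral j k l hs, ← integral_const_mul]
    exact integral_integral_swap hint
  have hdom : Integrable (fun z : E d × ℝ => ‖ψ z.1‖ * (oseenConst d *
      (4 * Real.pi * (2 * s)) ^ (-(d : ℝ) / 2) * z.2 ^ (-(3 / 2) : ℝ)))
      (volume.prod (volume.restrict (Ioi s))) :=
    hψ.norm.mul_prod
      ((integrableOn_Ioi_rpow_of_lt (a := -(3 / 2)) (by norm_num) hs).const_mul _)
  have hm : AEStronglyMeasurable (fun z : E d × ℝ => ψ z.1 * oseenDensity j k l z.2 (b z.1))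
      (volume.prod (volume.restrict (Ioi s))) :=
    hψ.1.comp_fst.mul (measurable_time_space (measurable_oseenDensity j k l) measurable_snd
      (hb.comp measurable_fst)).aestronglyMeasurable
  refine Integrable.mono' hdom hm ?_
  have hae : ∀ᵐ z : E d × ℝ ∂(volume.prod (volume.restrict (Ioi s))), z.2 ∈ Ioi s :=
    Measure.quasiMeasurePreserving_snd.ae (ae_restrict_mem measurableSet_Ioi)
  filter_upwards [hae] with z hz
  have hz0 : 0 < z.2 := hs.trans hz
  have h2 := heatKernel_le_of_le (d := d) (a := 2 * s) (s := 2 * z.2) (by positivity)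
    (by have := mem_Ioi.1 hz; linarith) (b z.1)
  have hC := oseenConst_pos d
  rw [Function.uncurry, norm_mul]
  refine mul_le_mul_of_nonneg_left ((abs_oseenDensity_le j k l hz0 _).trans ?_) (norm_nonneg _)
  calc _ ≤ oseenConst d * (z.2 ^ (-(3 / 2) : ℝ) * (4 * Real.pi * (2 * s)) ^ (-(d : ℝ) / 2)) := by
        gcongr
    _ = _ := by ring

/-- The heat semigroup shifts the time of the Oseen kernel. -/
lemma integral_heatKernel_mul_oseenKernel (j k l : Fin d) {t s : ℝ} (ht : 0 < t) (hs : 0 < s)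
    (x : E d) : ∫ y, heatKernel d t (x - y) * oseenKernel j k l s y =
      oseenKernel j k l (t + s) x := by
  rw [← integral_sub_left_eq_self
    (fun y => heatKernel d t (x - y) * oseenKernel j k l s y) volume x]
  simp only [sub_sub_cancel]
  rw [(integral_mul_oseenKernel_comp j k l hs (integrable_heatKernel ht)
    (b := fun y => x - y) (by fun_prop)).2, add_comm t s,
    oseenKernel_eq_integral j k l (by positivity : 0 < s + t), ← integral_Ioi_comp_add]
  refine setIntegral_congr_fun measurableSet_Ioi fun r hr => ?_
  simp only [mul_comm (heatKernel d t _)]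
  exact integral_oseenDensity_conv j k l ht (hs.trans hr) x

end HeatKernelIntegrals

section Majorants

variable {d : ℕ}

/-! ### Integrable and bounded majorants of convolution kernels -/

/-- `κ` has mass at most `A` and supremum at most `M * A`. Normalizing the supremum by the mass
makes the operator norms of convolution with `κ` linear in `A`. -/
structure IsMajorant (κ : E d → ℝ≥0∞) (A M : ℝ≥0∞) : Prop where
  measurable : Measurable κ
  lintegral_le : ∫⁻ x, κ x ≤ A
  le : ∀ x, κ x ≤ M * A

lemma rpow_mul_rpow_aux {A M : ℝ≥0∞} {r q : ℝ} (hq : 0 ≤ q) (hr : q = 1 - r) (hr0 : 0 ≤ r) :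
    A ^ q * (M * A) ^ r = M ^ r * A := by
  rw [ENNReal.mul_rpow_of_nonneg _ _ hr0, mul_left_comm, ← ENNReal.rpow_add_of_nonneg _ _ hq hr0,
    hr, sub_add_cancel, ENNReal.rpow_one]

namespace IsMajorant

variable {κ : E d → ℝ≥0∞} {A M p : ℝ≥0∞}

lemma measurable_sub (h : IsMajorant κ A M) :
    Measurable (Function.uncurry fun x y : E d => κ (x - y)) :=
  h.measurable.comp (measurable_fst.sub measurable_snd)

lemma aemeasurable_sub (h : IsMajorant κ A M) (x : E d) : AEMeasurable (fun y => κ (x - y)) :=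
  (h.measurable.comp (measurable_const.sub measurable_id)).aemeasurable

lemma lintegral_sub_le (h : IsMajorant κ A M) (x : E d) : ∫⁻ y, κ (x - y) ≤ A := by
  rw [lintegral_sub_left_eq_self κ x]; exact h.lintegral_le

lemma lintegral_sub_le' (h : IsMajorant κ A M) (y : E d) : ∫⁻ x, κ (x - y) ≤ A := by
  rw [lintegral_sub_right_eq_self κ y]; exact h.lintegral_le

lemma eLpNorm_conv_le (h : IsMajorant κ A M) {f : E d → ℝ≥0∞} (hf : AEMeasurable f) (hp : 1 ≤ p) :
    eLpNorm (fun x => ∫⁻ y, κ (x - y) * f y) p volume ≤ A * eLpNorm f p volume := by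
  have hr := toReal_inv_le_one hp
  refine (eLpNorm_lintegral_mul_le (μ := (volume : Measure (E d))) h.measurable_sub hf
    h.lintegral_sub_le h.lintegral_sub_le' hp).trans (le_of_eq ?_)
  rw [← ENNReal.rpow_add_of_nonneg _ _ (by linarith) ENNReal.toReal_nonneg, sub_add_cancel,
    ENNReal.rpow_one]

lemma conv_le (h : IsMajorant κ A M) {f : E d → ℝ≥0∞} (hf : AEMeasurable f) (hp : 1 ≤ p)
    (x : E d) :
    ∫⁻ y, κ (x - y) * f y ≤ M ^ p⁻¹.toReal * A * eLpNorm f p volume := by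
  have hr := toReal_inv_le_one hp
  refine (lintegral_mul_le_eLpNorm (h.aemeasurable_sub x) hf (h.lintegral_sub_le x)
    (fun y => h.le _) hp).trans (le_of_eq ?_)
  rw [rpow_mul_rpow_aux (by linarith) rfl ENNReal.toReal_nonneg]

lemma eLpNorm_conv_mul_le (h : IsMajorant κ A M) {f g : E d → ℝ≥0∞} (hf : AEMeasurable f)
    (hg : AEMeasurable g) (hp : 2 ≤ p) :
    eLpNorm (fun x => ∫⁻ y, κ (x - y) * (f y * g y)) p volume ≤
      M ^ p⁻¹.toReal * A * (eLpNorm f p volume * eLpNorm g p volume) := by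
  have hr := toReal_inv_le_half hp
  refine (eLpNorm_lintegral_mul_mul_le (μ := (volume : Measure (E d))) h.measurable_sub hf hg
    h.lintegral_sub_le h.lintegral_sub_le' (fun x y => h.le _) hp).trans (le_of_eq ?_)
  rw [rpow_mul_rpow_aux (by linarith) rfl ENNReal.toReal_nonneg]

lemma conv_mul_le (h : IsMajorant κ A M) {f g : E d → ℝ≥0∞} (hf : AEMeasurable f)
    (hg : AEMeasurable g) (hp : 2 ≤ p) (x : E d) :
    ∫⁻ y, κ (x - y) * (f y * g y) ≤
      M ^ (2 * p⁻¹.toReal) * A * (eLpNorm f p volume * eLpNorm g p volume) := by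
  have hr := toReal_inv_le_half hp
  have hr0 : 0 ≤ p⁻¹.toReal := ENNReal.toReal_nonneg
  refine (lintegral_mul_mul_le_eLpNorm (h.aemeasurable_sub x) hf hg (h.lintegral_sub_le x)
    (fun y => h.le _) hp).trans (le_of_eq ?_)
  rw [rpow_mul_rpow_aux (by linarith) rfl (by linarith)]

end IsMajorant

/-- The mixture `∫_I w(s) Γ_{2s} ds` of Gaussians, with values in `[0, ∞]`. -/
def gaussMix (w : ℝ → ℝ) (I : Set ℝ) (x : E d) : ℝ≥0∞ :=
  ∫⁻ s in I, ENNReal.ofReal (w s * heatKernel d (2 * s) x)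

/-- The maximum of `Γ_{2a}`. -/
def gaussSup (d : ℕ) (a : ℝ) : ℝ := (4 * Real.pi * (2 * a)) ^ (-(d : ℝ) / 2)

lemma gaussSup_pos {a : ℝ} (ha : 0 < a) : 0 < gaussSup d a := by
  have := Real.pi_pos
  unfold gaussSup; positivity

/-- Each Gaussian has mass one, and those with time in `I` are bounded by `Γ_{2a}(0)`, so mass and
supremum of the mixture are both controlled by the mass of the weight. -/
lemma isMajorant_gaussMix {w : ℝ → ℝ} {I : Set ℝ} {a : ℝ} {A : ℝ≥0∞} (ha : 0 < a)
    (hw : Measurable w) (hI : MeasurableSet I) (hIa : I ⊆ Ici a) (hw0 : ∀ s ∈ I, 0 ≤ w s)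
    (hA : ∫⁻ s in I, ENNReal.ofReal (w s) ≤ A) :
    IsMajorant (gaussMix (d := d) w I) A (ENNReal.ofReal (gaussSup d a)) := by
  have hm : Measurable fun z : E d × ℝ => ENNReal.ofReal (w z.2 * heatKernel d (2 * z.2) z.1) :=
    ((hw.comp measurable_snd).mul (measurable_time_space measurable_heatKernel
      (measurable_snd.const_mul 2) measurable_fst)).ennreal_ofReal
  refine ⟨hm.lintegral_prod_right', ?_, fun x => ?_⟩
  · simp only [gaussMix]
    rw [lintegral_lintegral_swap hm.aemeasurable]
    refine le_trans (le_of_eq (setLIntegral_congr_fun hI fun s hs => ?_)) hA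
    have hs0 : 0 < 2 * s := by have := hIa hs; simp only [mem_Ici] at this; linarith
    simp only [ENNReal.ofReal_mul (hw0 s hs)]
    rw [lintegral_const_mul _ (continuous_heatKernel _).measurable.ennreal_ofReal,
      lintegral_heatKernel hs0, mul_one]
  · refine le_trans ?_ (mul_le_mul_right hA _)
    rw [← lintegral_const_mul _ hw.ennreal_ofReal]
    refine setLIntegral_mono' hI fun s hs => ?_
    have hs' : a ≤ s := hIa hs
    rw [mul_comm, ENNReal.ofReal_mul' (hw0 s hs)]
    gcongr
    exact heatKernel_le_of_le (by positivity) (by linarith) x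

lemma isMajorant_heatKernel {t : ℝ} (ht : 0 < t) :
    IsMajorant (fun x : E d => ENNReal.ofReal (heatKernel d t x)) 1
      (ENNReal.ofReal ((4 * Real.pi * t) ^ (-(d : ℝ) / 2))) where
  measurable := (continuous_heatKernel t).measurable.ennreal_ofReal
  lintegral_le := (lintegral_heatKernel ht).le
  le x := by rw [mul_one]; exact ENNReal.ofReal_le_ofReal (heatKernel_le ht x)

/-- The weight `s^{-3/2}` of the mixture dominating the Oseen kernel. -/
def oseenWeight (s : ℝ) : ℝ := s ^ (-(3 / 2) : ℝ)

lemma measurable_oseenWeight : Measurable oseenWeight := by unfold oseenWeight; fun_prop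

lemma isMajorant_oseenWeight_Ioi {t : ℝ} (ht : 0 < t) :
    IsMajorant (gaussMix (d := d) oseenWeight (Ioi t)) (ENNReal.ofReal (2 * t ^ (-(1 / 2) : ℝ)))
      (ENNReal.ofReal (gaussSup d t)) := by
  refine isMajorant_gaussMix ht measurable_oseenWeight measurableSet_Ioi Ioi_subset_Ici_self
    (fun s hs => Real.rpow_nonneg (ht.trans hs).le _) (le_of_eq ?_)
  unfold oseenWeight
  rw [← ofReal_integral_eq_lintegral_ofReal (integrableOn_Ioi_rpow_of_lt (by norm_num) ht),
    integral_Ioi_rpow_of_lt (by norm_num) ht]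
  · congr 1
    norm_num
    ring
  · filter_upwards [ae_restrict_mem measurableSet_Ioi] with s hs using
      Real.rpow_nonneg (ht.trans hs).le _

lemma isMajorant_gaussMix_Ioc {w : ℝ → ℝ} (hw : Measurable w) (hw0 : ∀ s > 0, 0 ≤ w s) {a t t' : ℝ}
    (ha : 0 < a) (hanti : ∀ s, a ≤ s → w s ≤ w a) (hat : a ≤ t) :
    IsMajorant (gaussMix (d := d) w (Ioc t t')) (ENNReal.ofReal (w a * (t' - t)))
      (ENNReal.ofReal (gaussSup d a)) := by
  have hsub : Ioc t t' ⊆ Ici a := fun s hs => hat.trans hs.1.le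
  refine isMajorant_gaussMix ha hw measurableSet_Ioc hsub
    (fun s hs => hw0 s (ha.trans_le (hsub hs))) ?_
  calc ∫⁻ s in Ioc t t', ENNReal.ofReal (w s) ≤ ∫⁻ s in Ioc t t', ENNReal.ofReal (w a) :=
        setLIntegral_mono' measurableSet_Ioc fun s hs =>
          ENNReal.ofReal_le_ofReal (hanti s (hsub hs))
    _ = _ := by rw [setLIntegral_const, Real.volume_Ioc, ENNReal.ofReal_mul (hw0 a ha)]

lemma oseenWeight_anti {a s : ℝ} (ha : 0 < a) (h : a ≤ s) : oseenWeight s ≤ oseenWeight a :=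
  Real.rpow_le_rpow_of_nonpos ha h (by norm_num)

lemma enorm_setIntegral_le_gaussMix {f : ℝ → ℝ} {w : ℝ → ℝ} {I : Set ℝ} {C : ℝ} (hC : 0 ≤ C)
    (hI : MeasurableSet I) (x : E d) (h : ∀ s ∈ I, |f s| ≤ C * (w s * heatKernel d (2 * s) x)) :
    ‖∫ s in I, f s‖ₑ ≤ ENNReal.ofReal C * gaussMix w I x := by
  refine (enorm_integral_le_lintegral_enorm _).trans ?_
  rw [gaussMix, ← lintegral_const_mul' _ _ ENNReal.ofReal_ne_top]
  refine setLIntegral_mono' hI fun s hs => ?_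
  rw [← ENNReal.ofReal_mul hC, Real.enorm_eq_ofReal_abs]
  exact ENNReal.ofReal_le_ofReal (h s hs)

lemma enorm_oseenKernel_le (j k l : Fin d) {t : ℝ} (ht : 0 < t) (x : E d) :
    ‖oseenKernel j k l t x‖ₑ ≤
      ENNReal.ofReal (oseenConst d) * gaussMix oseenWeight (Ioi t) x := by
  rw [oseenKernel_eq_integral j k l ht]
  exact enorm_setIntegral_le_gaussMix (oseenConst_pos d).le measurableSet_Ioi x
    fun s hs => abs_oseenDensity_le j k l (ht.trans hs) x

lemma enorm_oseenKernel_sub_le (j k l : Fin d) {t t' : ℝ} (ht : 0 < t) (h : t ≤ t') (x : E d) :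
    ‖oseenKernel j k l t x - oseenKernel j k l t' x‖ₑ ≤
      ENNReal.ofReal (oseenConst d) * gaussMix oseenWeight (Ioc t t') x := by
  rw [oseenKernel_eq_integral j k l ht, oseenKernel_eq_integral j k l (ht.trans_le h),
    intervalIntegral.integral_Ioi_sub_Ioi (integrableOn_oseenDensity j k l ht x) h,
    intervalIntegral.integral_of_le h]
  exact enorm_setIntegral_le_gaussMix (oseenConst_pos d).le measurableSet_Ioc x
    fun s hs => abs_oseenDensity_le j k l (ht.trans hs.1) x

lemma enorm_heatKernel_sub_le {t t' : ℝ} (ht : 0 < t) (h : t ≤ t') (x : E d) :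
    ‖heatKernel d t x - heatKernel d t' x‖ₑ ≤
      ENNReal.ofReal (oseenConst d) * gaussMix (fun s => 1 / s) (Ioc t t') x := by
  have hd : ∀ s ∈ uIcc t t', HasDerivAt (fun s => heatKernel d s x)
      ((‖x‖ ^ 2 / (4 * s ^ 2) - d / (2 * s)) * heatKernel d s x) s := fun s hs => by
    rw [uIcc_of_le h] at hs
    exact hasDerivAt_heatKernel_time (ht.trans_le hs.1) x
  have hc : ContinuousOn (fun s : ℝ => (‖x‖ ^ 2 / (4 * s ^ 2) - d / (2 * s)) * heatKernel d s x)
      (uIcc t t') := by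
    intro s hs
    have hs' := hs
    rw [uIcc_of_le h] at hs'
    have hs0 : s ≠ 0 := (ht.trans_le hs'.1).ne'
    refine ContinuousWithinAt.mul (ContinuousAt.continuousWithinAt ?_)
      (hd s hs).continuousAt.continuousWithinAt
    have h1 : 4 * s ^ 2 ≠ 0 := by positivity
    have h2 : 2 * s ≠ 0 := by positivity
    fun_prop (disch := assumption)
  have := intervalIntegral.integral_eq_sub_of_hasDerivAt hd hc.intervalIntegrable
  rw [enorm_sub_rev, ← this, intervalIntegral.integral_of_le h]
  refine enorm_setIntegral_le_gaussMix (oseenConst_pos d).le measurableSet_Ioc x fun s hs => ?_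
  refine (abs_heatKernel_time_deriv_le (ht.trans hs.1) x).trans (le_of_eq ?_)
  rw [oseenConst]
  ring

end Majorants

section Operators

variable {d : ℕ} {p : ℝ≥0∞}

/-! ### Convolution operators on vector fields -/

/-- The kernel `k` is measurable and dominated by a multiple `c` of a majorant `κ`. -/
structure KernelBound (k : E d → ℝ) (κ : E d → ℝ≥0∞) (c A M : ℝ≥0∞) : Prop where
  measurable : Measurable k
  isMajorant : IsMajorant κ A M
  enorm_le : ∀ x, ‖k x‖ₑ ≤ c * κ x
  const_ne_top : c ≠ ⊤
  mass_ne_top : A ≠ ⊤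
  sup_ne_top : M ≠ ⊤

/-- The convolution `k * f` of a scalar kernel with a vector field. -/
def scalarConv (k : E d → ℝ) (f : E d → E d) (x : E d) : E d := ∫ y, k (x - y) • f y

/-- The vector field with components `∑_{k,l} K_{jkl} * (v_k v_l)`. -/
def tensorConv (K : Fin d → Fin d → Fin d → E d → ℝ) (v : E d → E d) (x : E d) : E d :=
  WithLp.toLp 2 fun j => ∫ y, ∑ k, ∑ l, K j k l (x - y) * (v y k * v y l)

lemma scalarConv_congr (k : E d → ℝ) {f g : E d → E d} (h : f =ᵐ[volume] g) :
    scalarConv k f = scalarConv k g :=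
  funext fun x => integral_congr_ae (h.mono fun y hy => by simp only [hy])

lemma tensorConv_congr (K : Fin d → Fin d → Fin d → E d → ℝ) {v w : E d → E d}
    (h : v =ᵐ[volume] w) : tensorConv K v = tensorConv K w := by
  funext x
  unfold tensorConv
  congr 1
  funext j
  exact integral_congr_ae (h.mono fun y hy => by simp only [hy])

lemma enorm_coord_le (x : E d) (i : Fin d) : ‖x i‖ₑ ≤ ‖x‖ₑ := by
  rw [enorm_le_iff_norm_le]; exact PiLp.norm_apply_le x i

lemma enorm_le_sum_coord (x : E d) : ‖x‖ₑ ≤ ∑ i, ‖x i‖ₑ := by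
  have h : ‖x‖ ≤ ∑ i, ‖x i‖ := by
    rw [EuclideanSpace.norm_eq, Real.sqrt_le_left (Finset.sum_nonneg fun i _ => norm_nonneg _)]
    exact Finset.sum_sq_le_sq_sum_of_nonneg fun i _ => norm_nonneg _
  have h2 := ENNReal.ofReal_le_ofReal h
  rw [ENNReal.ofReal_sum_of_nonneg fun i _ => norm_nonneg _] at h2
  simpa only [ofReal_norm] using h2

lemma eLpNorm_enorm_eq (f : E d → E d) : eLpNorm (fun y => ‖f y‖ₑ) p volume = eLpNorm f p volume :=
  eLpNorm_enorm f

namespace KernelBound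

variable {k : E d → ℝ} {κ : E d → ℝ≥0∞} {c A M : ℝ≥0∞}

lemma measurable_sub (h : KernelBound k κ c A M) :
    Measurable fun z : E d × E d => k (z.1 - z.2) :=
  h.measurable.comp (measurable_fst.sub measurable_snd)

lemma measurable_const_sub (h : KernelBound k κ c A M) (x : E d) : Measurable fun y => k (x - y) :=
  h.measurable.comp (measurable_const.sub measurable_id)

lemma lintegral_enorm_le (h : KernelBound k κ c A M) (f : E d → ℝ≥0∞) (x : E d) :
    ∫⁻ y, ‖k (x - y)‖ₑ * f y ≤ c * ∫⁻ y, κ (x - y) * f y := by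
  rw [← lintegral_const_mul' _ _ h.const_ne_top]
  refine lintegral_mono fun y => ?_
  rw [← mul_assoc]
  exact mul_le_mul_left (h.enorm_le _) _

/-- The convolution integral of the absolute values is finite at every point. -/
lemma lintegral_enorm_lt_top (h : KernelBound k κ c A M) (hp : 1 ≤ p) {f : E d → E d}
    (hf : MemLp f p volume) (x : E d) : ∫⁻ y, ‖k (x - y)‖ₑ * ‖f y‖ₑ < ⊤ := by
  refine (h.lintegral_enorm_le _ x).trans_lt (ENNReal.mul_lt_top h.const_ne_top.lt_top ?_)
  refine (h.isMajorant.conv_le hf.1.enorm hp x).trans_lt ?_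
  rw [eLpNorm_enorm_eq]
  exact ENNReal.mul_lt_top (ENNReal.mul_lt_top
    (ENNReal.rpow_lt_top_of_nonneg ENNReal.toReal_nonneg h.sup_ne_top) h.mass_ne_top.lt_top) hf.2

lemma integrable_smul (h : KernelBound k κ c A M) (hp : 1 ≤ p) {f : E d → E d}
    (hf : MemLp f p volume) (x : E d) : Integrable fun y => k (x - y) • f y := by
  refine ⟨(h.measurable_const_sub x).aestronglyMeasurable.smul hf.1, ?_⟩
  rw [hasFiniteIntegral_iff_enorm]
  simpa only [enorm_smul] using h.lintegral_enorm_lt_top hp hf x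

lemma enorm_scalarConv_le (h : KernelBound k κ c A M) (f : E d → E d) (x : E d) :
    ‖scalarConv k f x‖ₑ ≤ c * ∫⁻ y, κ (x - y) * ‖f y‖ₑ := by
  refine (enorm_integral_le_lintegral_enorm _).trans ?_
  simp only [enorm_smul]
  exact h.lintegral_enorm_le _ x

lemma eLpNorm_scalarConv_le (h : KernelBound k κ c A M) (hp : 1 ≤ p) {f : E d → E d}
    (hf : AEStronglyMeasurable f volume) :
    eLpNorm (scalarConv k f) p volume ≤ c * (A * eLpNorm f p volume) := by
  have h1 := h.isMajorant.eLpNorm_conv_le hf.enorm hp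
  rw [eLpNorm_enorm_eq] at h1
  refine le_trans ?_ (mul_le_mul_right h1 c)
  refine eLpNorm_le_mul_eLpNorm_of_ae_le_mul'' p ?_
    (.of_forall fun x => h.enorm_scalarConv_le f x)
  exact (AEMeasurable.lintegral_prod_right'
    (f := fun z : E d × E d => κ (z.1 - z.2) * ‖f z.2‖ₑ)
    (h.isMajorant.measurable_sub.aemeasurable.mul hf.enorm.comp_snd)).aestronglyMeasurable

lemma aestronglyMeasurable_scalarConv (h : KernelBound k κ c A M) {f : E d → E d}
    (hf : AEStronglyMeasurable f volume) : AEStronglyMeasurable (scalarConv k f) volume :=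
  AEStronglyMeasurable.integral_prod_right' (f := fun z : E d × E d => k (z.1 - z.2) • f z.2)
    (h.measurable_sub.aestronglyMeasurable.smul hf.comp_snd)

lemma memLp_scalarConv (h : KernelBound k κ c A M) (hp : 1 ≤ p) {f : E d → E d}
    (hf : MemLp f p volume) : MemLp (scalarConv k f) p volume :=
  ⟨h.aestronglyMeasurable_scalarConv hf.1, (h.eLpNorm_scalarConv_le hp hf.1).trans_lt
    (ENNReal.mul_lt_top h.const_ne_top.lt_top (ENNReal.mul_lt_top h.mass_ne_top.lt_top hf.2))⟩

lemma scalarConv_add (h : KernelBound k κ c A M) (hp : 1 ≤ p) {f g : E d → E d}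
    (hf : MemLp f p volume) (hg : MemLp g p volume) :
    scalarConv k (f + g) = scalarConv k f + scalarConv k g := by
  funext x
  simp only [scalarConv, Pi.add_apply, smul_add]
  exact integral_add (h.integrable_smul hp hf x) (h.integrable_smul hp hg x)

lemma scalarConv_const_smul (a : ℝ) (k : E d → ℝ) (f : E d → E d) :
    scalarConv k (a • f) = a • scalarConv k f := by
  funext x
  simp only [scalarConv, Pi.smul_apply, smul_comm _ a]
  exact integral_smul a _

/-- The integrands of `tensorConv` are integrable at every point, for all pairs of components. -/
lemma lintegral_enorm_mul_lt_top (h : KernelBound k κ c A M) (hp : 2 ≤ p) {f g : E d → E d}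
    (hf : MemLp f p volume) (hg : MemLp g p volume) (x : E d) :
    ∫⁻ y, κ (x - y) * (‖f y‖ₑ * ‖g y‖ₑ) < ⊤ := by
  refine (h.isMajorant.conv_mul_le hf.1.enorm hg.1.enorm hp x).trans_lt ?_
  rw [eLpNorm_enorm_eq, eLpNorm_enorm_eq]
  exact ENNReal.mul_lt_top (ENNReal.mul_lt_top (ENNReal.rpow_lt_top_of_nonneg
    (mul_nonneg zero_le_two ENNReal.toReal_nonneg) h.sup_ne_top) h.mass_ne_top.lt_top)
    (ENNReal.mul_lt_top hf.2 hg.2)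

lemma aestronglyMeasurable_coord {v : E d → E d} (hv : AEStronglyMeasurable v volume) (i : Fin d) :
    AEStronglyMeasurable (fun y => v y i) volume :=
  ((measurable_coord i).comp_aemeasurable hv.aemeasurable).aestronglyMeasurable

lemma integrable_mul (h : KernelBound k κ c A M) (hp : 2 ≤ p) {v : E d → E d}
    (hv : MemLp v p volume) (x : E d) (i j : Fin d) :
    Integrable fun y => k (x - y) * (v y i * v y j) := by
  refine ⟨(h.measurable_const_sub x).aestronglyMeasurable.mul
    ((aestronglyMeasurable_coord hv.1 i).mul (aestronglyMeasurable_coord hv.1 j)), ?_⟩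
  rw [hasFiniteIntegral_iff_enorm]
  refine lt_of_le_of_lt ?_ (ENNReal.mul_lt_top h.const_ne_top.lt_top
    (h.lintegral_enorm_mul_lt_top hp hv hv x))
  refine le_trans (lintegral_mono fun y => ?_) (h.lintegral_enorm_le _ x)
  rw [enorm_mul, enorm_mul]
  gcongr <;> exact enorm_coord_le _ _

end KernelBound

section Tensor

variable {K K' : Fin d → Fin d → Fin d → E d → ℝ} {κ : E d → ℝ≥0∞} {c A M : ℝ≥0∞}

lemma enorm_mul_sub_mul_le (v w : E d) (k l : Fin d) :
    ‖v k * v l - w k * w l‖ₑ ≤ (‖v‖ₑ + ‖w‖ₑ) * ‖v - w‖ₑ := by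
  have e : v k * v l - w k * w l = v k * (v - w) l + w l * (v - w) k := by
    simp only [PiLp.sub_apply]; ring
  rw [e, add_mul]
  refine (enorm_add_le _ _).trans (add_le_add ?_ ?_)
  all_goals
    rw [enorm_mul]
    gcongr <;> exact enorm_coord_le _ _

lemma enorm_tensorConv_sub_le (h : ∀ j k l, KernelBound (K j k l) κ c A M) (hp : 2 ≤ p)
    {v w : E d → E d} (hv : MemLp v p volume) (hw : MemLp w p volume) (x : E d) :
    ‖tensorConv K v x - tensorConv K w x‖ₑ ≤
      d ^ 3 * c * ∫⁻ y, κ (x - y) * ((‖v y‖ₑ + ‖w y‖ₑ) * ‖(v - w) y‖ₑ) := by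
  set J := ∫⁻ y, κ (x - y) * ((‖v y‖ₑ + ‖w y‖ₑ) * ‖(v - w) y‖ₑ) with hJ
  have hi : ∀ {u : E d → E d}, MemLp u p volume → ∀ j,
      Integrable fun y => ∑ k, ∑ l, K j k l (x - y) * (u y k * u y l) := fun hu j =>
    integrable_finsetSum _ fun k _ => integrable_finsetSum _ fun l _ =>
      (h j k l).integrable_mul hp hu x k l
  have hij : ∀ {u : E d → E d}, MemLp u p volume → ∀ j k l,
      Integrable fun y => K j k l (x - y) * (u y k * u y l) := fun hu j k l =>
      (h j k l).integrable_mul hp hu x k l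
  have comp : ∀ j, ‖(tensorConv K v x - tensorConv K w x) j‖ₑ ≤ d ^ 2 * c * J := by
    intro j
    have e : (tensorConv K v x - tensorConv K w x) j =
        ∑ k, ∑ l, ∫ y, K j k l (x - y) * (v y k * v y l - w y k * w y l) := by
      simp only [tensorConv, PiLp.sub_apply, mul_sub]
      rw [integral_finsetSum _ fun k _ => integrable_finsetSum _ fun l _ => hij hv j k l,
        integral_finsetSum _ fun k _ => integrable_finsetSum _ fun l _ => hij hw j k l,
        ← Finset.sum_sub_distrib]
      refine Finset.sum_congr rfl fun k _ => ?_
      rw [integral_finsetSum _ fun l _ => hij hv j k l,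
        integral_finsetSum _ fun l _ => hij hw j k l, ← Finset.sum_sub_distrib]
      exact Finset.sum_congr rfl fun l _ => (integral_sub (hij hv j k l) (hij hw j k l)).symm
    have hterm : ∀ k l, ‖∫ y, K j k l (x - y) * (v y k * v y l - w y k * w y l)‖ₑ ≤ c * J := by
      intro k l
      refine (enorm_integral_le_lintegral_enorm _).trans
        (le_trans (lintegral_mono fun y => ?_) ((h j k l).lintegral_enorm_le _ x))
      rw [enorm_mul]
      gcongr
      exact enorm_mul_sub_mul_le _ _ _ _
    rw [e]
    calc _ ≤ ∑ k : Fin d, ∑ l : Fin d, c * J := by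
          refine (enorm_sum_le _ _).trans (Finset.sum_le_sum fun k _ => ?_)
          exact (enorm_sum_le _ _).trans (Finset.sum_le_sum fun l _ => hterm k l)
      _ = _ := by simp; ring
  calc _ ≤ ∑ j : Fin d, d ^ 2 * c * J :=
        (enorm_le_sum_coord _).trans (Finset.sum_le_sum fun j _ => comp j)
    _ = _ := by simp; ring

lemma tensorConv_zero (K : Fin d → Fin d → Fin d → E d → ℝ) : tensorConv K 0 = 0 := by
  funext x
  ext j
  simp [tensorConv]

lemma aestronglyMeasurable_tensorConv (h : ∀ j k l, KernelBound (K j k l) κ c A M)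
    {v : E d → E d} (hv : AEStronglyMeasurable v volume) :
    AEStronglyMeasurable (tensorConv K v) volume := by
  refine AEMeasurable.aestronglyMeasurable ((WithLp.measurable_toLp 2 _).comp_aemeasurable
    (aemeasurable_pi_lambda _ fun j => AEStronglyMeasurable.aemeasurable ?_))
  refine AEStronglyMeasurable.integral_prod_right'
    (f := fun z : E d × E d => ∑ k, ∑ l, K j k l (z.1 - z.2) * (v z.2 k * v z.2 l)) ?_
  refine Finset.aestronglyMeasurable_fun_sum _ fun k _ =>
    Finset.aestronglyMeasurable_fun_sum _ fun l _ => ?_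
  exact (h j k l).measurable_sub.aestronglyMeasurable.mul
    (((KernelBound.aestronglyMeasurable_coord hv k).comp_snd).mul
      ((KernelBound.aestronglyMeasurable_coord hv l).comp_snd))

lemma stronglyMeasurable_tensorConv (h : ∀ j k l, KernelBound (K j k l) κ c A M)
    {v : E d → E d} (hv : StronglyMeasurable v) : StronglyMeasurable (tensorConv K v) := by
  refine Measurable.stronglyMeasurable ((WithLp.measurable_toLp 2 _).comp
    (measurable_pi_lambda _ fun j => StronglyMeasurable.measurable ?_))
  refine StronglyMeasurable.integral_prod_right'
    (f := fun z : E d × E d => ∑ k, ∑ l, K j k l (z.1 - z.2) * (v z.2 k * v z.2 l)) ?_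
  refine Measurable.stronglyMeasurable (Finset.measurable_fun_sum _ fun k _ =>
    Finset.measurable_fun_sum _ fun l _ => ?_)
  exact (h j k l).measurable_sub.mul
    (((measurable_coord k).comp (hv.measurable.comp measurable_snd)).mul
      ((measurable_coord l).comp (hv.measurable.comp measurable_snd)))

lemma eLpNorm_tensorConv_sub_le (h : ∀ j k l, KernelBound (K j k l) κ c A M) (hp : 2 ≤ p)
    (hκ : IsMajorant κ A M) {v w : E d → E d} (hv : MemLp v p volume) (hw : MemLp w p volume) :
    eLpNorm (tensorConv K v - tensorConv K w) p volume ≤ d ^ 3 * c * (M ^ p⁻¹.toReal * A *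
      ((eLpNorm v p volume + eLpNorm w p volume) * eLpNorm (v - w) p volume)) := by
  have hm : AEMeasurable (fun y => ‖v y‖ₑ + ‖w y‖ₑ) volume := hv.1.enorm.add hw.1.enorm
  have hvw := (hv.sub hw).1.enorm
  have h1 := hκ.eLpNorm_conv_mul_le hm hvw hp
  have h2 : eLpNorm (fun y => ‖v y‖ₑ + ‖w y‖ₑ) p volume ≤
      eLpNorm v p volume + eLpNorm w p volume := by
    have := eLpNorm_add_le hv.1.enorm.aestronglyMeasurable hw.1.enorm.aestronglyMeasurable
      (one_le_two.trans hp)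
    rwa [eLpNorm_enorm_eq, eLpNorm_enorm_eq] at this
  rw [eLpNorm_enorm_eq] at h1
  refine le_trans ?_ (mul_le_mul_right (h1.trans (mul_le_mul_right (mul_le_mul_left h2 _) _)) _)
  refine eLpNorm_le_mul_eLpNorm_of_ae_le_mul'' p ?_
    (.of_forall fun x => enorm_tensorConv_sub_le h hp hv hw x)
  exact (AEMeasurable.lintegral_prod_right'
    (f := fun z : E d × E d => κ (z.1 - z.2) * ((‖v z.2‖ₑ + ‖w z.2‖ₑ) * ‖(v - w) z.2‖ₑ))
    (hκ.measurable_sub.aemeasurable.mul (hm.comp_snd.mul hvw.comp_snd))).aestronglyMeasurable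

lemma enorm_tensorConv_sub_apply_le (h : ∀ j k l, KernelBound (K j k l) κ c A M) (hp : 2 ≤ p)
    (hκ : IsMajorant κ A M) {v w : E d → E d} (hv : MemLp v p volume) (hw : MemLp w p volume)
    (x : E d) :
    ‖tensorConv K v x - tensorConv K w x‖ₑ ≤ d ^ 3 * c * (M ^ (2 * p⁻¹.toReal) * A *
      ((eLpNorm v p volume + eLpNorm w p volume) * eLpNorm (v - w) p volume)) := by
  have hm : AEMeasurable (fun y => ‖v y‖ₑ + ‖w y‖ₑ) volume := hv.1.enorm.add hw.1.enorm
  have h1 := hκ.conv_mul_le hm (hv.sub hw).1.enorm hp x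
  have h2 : eLpNorm (fun y => ‖v y‖ₑ + ‖w y‖ₑ) p volume ≤
      eLpNorm v p volume + eLpNorm w p volume := by
    have := eLpNorm_add_le hv.1.enorm.aestronglyMeasurable hw.1.enorm.aestronglyMeasurable
      (one_le_two.trans hp)
    rwa [eLpNorm_enorm_eq, eLpNorm_enorm_eq] at this
  rw [eLpNorm_enorm_eq] at h1
  exact (enorm_tensorConv_sub_le h hp hv hw x).trans
    (mul_le_mul_right (h1.trans (mul_le_mul_right (mul_le_mul_left h2 _) _)) _)

lemma memLp_tensorConv (h : ∀ j k l, KernelBound (K j k l) κ c A M) (hp : 2 ≤ p)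
    (hκ : IsMajorant κ A M) (hc : c ≠ ⊤) (hA : A ≠ ⊤) (hM : M ≠ ⊤) {v : E d → E d}
    (hv : MemLp v p volume) : MemLp (tensorConv K v) p volume := by
  refine ⟨aestronglyMeasurable_tensorConv h hv.1, ?_⟩
  have h1 := eLpNorm_tensorConv_sub_le h hp hκ hv (MemLp.zero (ε := E d))
  rw [tensorConv_zero, sub_zero, sub_zero, eLpNorm_zero, add_zero] at h1
  refine h1.trans_lt (ENNReal.mul_lt_top (ENNReal.mul_lt_top (by finiteness) hc.lt_top)
    (ENNReal.mul_lt_top (ENNReal.mul_lt_top (ENNReal.rpow_lt_top_of_nonneg ENNReal.toReal_nonneg hM)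
      hA.lt_top) (ENNReal.mul_lt_top hv.2 hv.2)))

lemma tensorConv_sub_kernel {κ' : E d → ℝ≥0∞} {c' A' M' : ℝ≥0∞}
    (h : ∀ j k l, KernelBound (K j k l) κ c A M)
    (h' : ∀ j k l, KernelBound (K' j k l) κ' c' A' M') (hp : 2 ≤ p) {v : E d → E d}
    (hv : MemLp v p volume) :
    tensorConv K v - tensorConv K' v =
      tensorConv (fun j k l x => K j k l x - K' j k l x) v := by
  funext x
  ext j
  simp only [tensorConv, Pi.sub_apply, PiLp.sub_apply, sub_mul, Finset.sum_sub_distrib]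
  rw [integral_sub]
  · exact integrable_finsetSum _ fun k _ => integrable_finsetSum _ fun l _ =>
      (h j k l).integrable_mul hp hv x k l
  · exact integrable_finsetSum _ fun k _ => integrable_finsetSum _ fun l _ =>
      (h' j k l).integrable_mul hp hv x k l

end Tensor

end Operators

section LpOperators

variable {d : ℕ} {p : ℝ≥0∞}

/-! ### The heat and Oseen operators on `L^p` -/

/-- Associativity of convolution. -/
lemma integral_conv_conv {V : Type*} [NormedAddCommGroup V] [NormedSpace ℝ V] [CompleteSpace V]
    {k₁ k₂ k₃ : E d → ℝ} {F : E d → V} {B : ℝ≥0∞} (hk₁ : Measurable k₁) (hk₂ : Measurable k₂)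
    (hF : AEStronglyMeasurable F volume) {x : E d} (h₁ : ∫⁻ y, ‖k₁ (x - y)‖ₑ ≠ ⊤) (hB : B ≠ ⊤)
    (h₂ : ∀ y, ∫⁻ z, ‖k₂ (y - z)‖ₑ * ‖F z‖ₑ ≤ B)
    (hk : ∀ x, ∫ y, k₁ (x - y) * k₂ y = k₃ x) :
    (Integrable (fun y => k₁ (x - y) • ∫ z, k₂ (y - z) • F z) ∧
      Integrable fun z => k₃ (x - z) • F z) ∧
      ∫ y, k₁ (x - y) • ∫ z, k₂ (y - z) • F z = ∫ z, k₃ (x - z) • F z := by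
  have hint : Integrable (Function.uncurry fun y z : E d => (k₁ (x - y) * k₂ (y - z)) • F z)
      (volume.prod volume) := by
    have hm₁ : Measurable fun z : E d × E d => k₁ (x - z.1) :=
      hk₁.comp (measurable_const.sub measurable_fst)
    have hm₂ : Measurable fun z : E d × E d => k₂ (z.1 - z.2) :=
      hk₂.comp (measurable_fst.sub measurable_snd)
    have hm : AEStronglyMeasurable (Function.uncurry fun y z : E d =>
        (k₁ (x - y) * k₂ (y - z)) • F z) (volume.prod volume) :=
      (hm₁.mul hm₂).aestronglyMeasurable.smul hF.comp_snd
    refine ⟨hm, ?_⟩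
    rw [hasFiniteIntegral_iff_enorm, lintegral_prod _ hm.enorm]
    simp only [Function.uncurry, enorm_smul, enorm_mul, mul_assoc]
    calc ∫⁻ y, ∫⁻ z, ‖k₁ (x - y)‖ₑ * (‖k₂ (y - z)‖ₑ * ‖F z‖ₑ) ≤ ∫⁻ y, ‖k₁ (x - y)‖ₑ * B := by
          refine lintegral_mono fun y => ?_
          rw [lintegral_const_mul' _ _ enorm_ne_top]
          exact mul_le_mul_right (h₂ y) _
      _ = (∫⁻ y, ‖k₁ (x - y)‖ₑ) * B := lintegral_mul_const' _ _ hB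
      _ < ⊤ := ENNReal.mul_lt_top h₁.lt_top hB.lt_top
  simp_rw [← integral_smul, smul_smul]
  have e : ∀ z, ∫ y, (k₁ (x - y) * k₂ (y - z)) • F z = k₃ (x - z) • F z := fun z => by
    rw [integral_smul_const, ← hk (x - z),
      ← integral_sub_right_eq_self (fun y => k₁ (x - z - y) * k₂ y) z]
    simp only [sub_sub_sub_cancel_right]
  refine ⟨⟨hint.integral_prod_left, hint.integral_prod_right.congr (.of_forall e)⟩, ?_⟩
  rw [integral_integral_swap hint]
  exact integral_congr_ae (.of_forall e)

lemma heatKernel_bound {t : ℝ} (ht : 0 < t) :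
    KernelBound (heatKernel d t) (fun x => ENNReal.ofReal (heatKernel d t x)) 1 1
      (ENNReal.ofReal ((4 * Real.pi * t) ^ (-(d : ℝ) / 2))) where
  measurable := (continuous_heatKernel t).measurable
  isMajorant := isMajorant_heatKernel ht
  enorm_le x := by rw [one_mul, Real.enorm_eq_ofReal (heatKernel_nonneg ht.le x)]
  const_ne_top := ENNReal.one_ne_top
  mass_ne_top := ENNReal.one_ne_top
  sup_ne_top := ENNReal.ofReal_ne_top

lemma heatKernel_sub_bound {a t t' : ℝ} (ha : 0 < a) (hat : a ≤ t) (h : t ≤ t') :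
    KernelBound (fun x => heatKernel d t x - heatKernel d t' x)
      (gaussMix (fun s => 1 / s) (Ioc t t')) (ENNReal.ofReal (oseenConst d))
      (ENNReal.ofReal (1 / a * (t' - t))) (ENNReal.ofReal (gaussSup d a)) where
  measurable := ((continuous_heatKernel t).sub (continuous_heatKernel t')).measurable
  isMajorant := isMajorant_gaussMix_Ioc (by fun_prop) (fun s hs => by positivity) ha
    (fun s hs => one_div_le_one_div_of_le ha hs) hat
  enorm_le x := enorm_heatKernel_sub_le (ha.trans_le hat) h x
  const_ne_top := ENNReal.ofReal_ne_top
  mass_ne_top := ENNReal.ofReal_ne_top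
  sup_ne_top := ENNReal.ofReal_ne_top

lemma oseenKernel_bound (j k l : Fin d) {t : ℝ} (ht : 0 < t) :
    KernelBound (oseenKernel j k l t) (gaussMix oseenWeight (Ioi t))
      (ENNReal.ofReal (oseenConst d)) (ENNReal.ofReal (2 * t ^ (-(1 / 2) : ℝ)))
      (ENNReal.ofReal (gaussSup d t)) where
  measurable := measurable_oseenKernel j k l ht
  isMajorant := isMajorant_oseenWeight_Ioi ht
  enorm_le x := enorm_oseenKernel_le j k l ht x
  const_ne_top := ENNReal.ofReal_ne_top
  mass_ne_top := ENNReal.ofReal_ne_top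
  sup_ne_top := ENNReal.ofReal_ne_top

lemma isMajorant_oseenWeight_Ioc {a t : ℝ} (t' : ℝ) (ha : 0 < a) (hat : a ≤ t) :
    IsMajorant (gaussMix (d := d) oseenWeight (Ioc t t'))
      (ENNReal.ofReal (oseenWeight a * (t' - t))) (ENNReal.ofReal (gaussSup d a)) :=
  isMajorant_gaussMix_Ioc measurable_oseenWeight (fun _ hs => Real.rpow_nonneg (le_of_lt hs) _) ha
    (fun _ hs => oseenWeight_anti ha hs) hat

lemma oseenKernel_sub_bound (j k l : Fin d) {a t t' : ℝ} (ha : 0 < a) (hat : a ≤ t)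
    (h : t ≤ t') :
    KernelBound (fun x => oseenKernel j k l t x - oseenKernel j k l t' x)
      (gaussMix oseenWeight (Ioc t t')) (ENNReal.ofReal (oseenConst d))
      (ENNReal.ofReal (oseenWeight a * (t' - t))) (ENNReal.ofReal (gaussSup d a)) where
  measurable := (measurable_oseenKernel j k l (ha.trans_le hat)).sub
    (measurable_oseenKernel j k l (ha.trans_le (hat.trans h)))
  isMajorant := isMajorant_oseenWeight_Ioc t' ha hat
  enorm_le x := enorm_oseenKernel_sub_le j k l (ha.trans_le hat) h x
  const_ne_top := ENNReal.ofReal_ne_top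
  mass_ne_top := ENNReal.ofReal_ne_top
  sup_ne_top := ENNReal.ofReal_ne_top

lemma heatFlow_eq_scalarConv (t : ℝ) (f : E d → E d) :
    heatFlow t f = scalarConv (heatKernel d t) f := rfl

lemma oseenFlow_eq_tensorConv (t : ℝ) (v : E d → E d) :
    oseenFlow t v = tensorConv (fun j k l => oseenKernel j k l t) v := rfl

lemma memLp_heatFlow (hp : 1 ≤ p) {t : ℝ} (ht : 0 < t) {f : E d → E d} (hf : MemLp f p volume) :
    MemLp (heatFlow t f) p volume := (heatKernel_bound ht).memLp_scalarConv hp hf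

lemma memLp_oseenFlow (hp : 2 ≤ p) {t : ℝ} (ht : 0 < t) {v : E d → E d} (hv : MemLp v p volume) :
    MemLp (oseenFlow t v) p volume :=
  memLp_tensorConv (fun j k l => oseenKernel_bound j k l ht) hp (isMajorant_oseenWeight_Ioi ht)
    ENNReal.ofReal_ne_top ENNReal.ofReal_ne_top ENNReal.ofReal_ne_top hv

lemma lintegral_heatKernel_ne_top {t : ℝ} (ht : 0 < t) (x : E d) :
    ∫⁻ y, ‖heatKernel d t (x - y)‖ₑ ≠ ⊤ := by
  rw [lintegral_sub_left_eq_self (fun y => ‖heatKernel d t y‖ₑ)]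
  exact (integrable_heatKernel ht).2.ne

section UniformBounds

variable {k : E d → ℝ} {κ : E d → ℝ≥0∞} {c A M : ℝ≥0∞}

lemma KernelBound.exists_lintegral_le (h : KernelBound k κ c A M) (hp : 1 ≤ p) {f : E d → E d}
    (hf : MemLp f p volume) : ∃ B : ℝ≥0∞, B ≠ ⊤ ∧ ∀ y, ∫⁻ z, ‖k (y - z)‖ₑ * ‖f z‖ₑ ≤ B := by
  refine ⟨_, ?_, fun y => (h.lintegral_enorm_le _ y).trans
    (mul_le_mul_right (h.isMajorant.conv_le hf.1.enorm hp y) _)⟩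
  rw [eLpNorm_enorm_eq]
  exact ENNReal.mul_ne_top h.const_ne_top (ENNReal.mul_ne_top (ENNReal.mul_ne_top
    (ENNReal.rpow_ne_top_of_nonneg ENNReal.toReal_nonneg h.sup_ne_top) h.mass_ne_top) hf.2.ne)

lemma KernelBound.exists_lintegral_mul_le (h : KernelBound k κ c A M) (hp : 2 ≤ p)
    {v : E d → E d} (hv : MemLp v p volume) (i j : Fin d) :
    ∃ B : ℝ≥0∞, B ≠ ⊤ ∧ ∀ y, ∫⁻ z, ‖k (y - z)‖ₑ * ‖v z i * v z j‖ₑ ≤ B := by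
  refine ⟨_, ?_, fun y => le_trans ?_ (mul_le_mul_right
    (h.isMajorant.conv_mul_le hv.1.enorm hv.1.enorm hp y) c)⟩
  · rw [eLpNorm_enorm_eq]
    exact ENNReal.mul_ne_top h.const_ne_top (ENNReal.mul_ne_top (ENNReal.mul_ne_top
      (ENNReal.rpow_ne_top_of_nonneg (mul_nonneg zero_le_two ENNReal.toReal_nonneg) h.sup_ne_top)
      h.mass_ne_top) (ENNReal.mul_ne_top hv.2.ne hv.2.ne))
  · refine le_trans (lintegral_mono fun z => ?_) (h.lintegral_enorm_le _ y)
    rw [enorm_mul (v z i)]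
    gcongr <;> exact enorm_coord_le _ _

end UniformBounds

lemma heatFlow_apply (hp : 1 ≤ p) {t : ℝ} (ht : 0 < t) {f : E d → E d} (hf : MemLp f p volume)
    (x : E d) (j : Fin d) : heatFlow t f x j = ∫ y, heatKernel d t (x - y) • f y j := by
  have := (EuclideanSpace.proj (𝕜 := ℝ) j : E d →L[ℝ] ℝ).integral_comp_comm
    ((heatKernel_bound ht).integrable_smul hp hf x)
  simpa [heatFlow] using this.symm

lemma heatFlow_heatFlow (hp : 1 ≤ p) {t s : ℝ} (ht : 0 < t) (hs : 0 < s) {f : E d → E d}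
    (hf : MemLp f p volume) : heatFlow t (heatFlow s f) = heatFlow (t + s) f := by
  funext x
  obtain ⟨B, hB, hle⟩ := (heatKernel_bound (d := d) hs).exists_lintegral_le hp hf
  exact (integral_conv_conv (continuous_heatKernel t).measurable
    (continuous_heatKernel s).measurable hf.1 (lintegral_heatKernel_ne_top ht x) hB hle
    (integral_heatKernel_conv ht hs)).2

lemma tensorConv_apply {K : Fin d → Fin d → Fin d → E d → ℝ} {κ : E d → ℝ≥0∞} {c A M : ℝ≥0∞}
    (h : ∀ j k l, KernelBound (K j k l) κ c A M) (hp : 2 ≤ p) {v : E d → E d}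
    (hv : MemLp v p volume) (x : E d) (j : Fin d) :
    tensorConv K v x j = ∑ k, ∑ l, ∫ y, K j k l (x - y) • (v y k * v y l) := by
  have hi : ∀ k l, Integrable fun y => K j k l (x - y) * (v y k * v y l) := fun k l =>
    (h j k l).integrable_mul hp hv x k l
  simp only [tensorConv, smul_eq_mul]
  rw [integral_finsetSum _ fun k _ => integrable_finsetSum _ fun l _ => hi k l]
  exact Finset.sum_congr rfl fun k _ => integral_finsetSum _ fun l _ => hi k l

lemma heatFlow_oseenFlow (hp : 2 ≤ p) {t s : ℝ} (ht : 0 < t) (hs : 0 < s) {v : E d → E d}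
    (hv : MemLp v p volume) : heatFlow t (oseenFlow s v) = oseenFlow (t + s) v := by
  have hp1 : 1 ≤ p := one_le_two.trans hp
  have hb := fun j k l => oseenKernel_bound (d := d) j k l hs
  have hb' := fun j k l => oseenKernel_bound (d := d) j k l (show 0 < t + s by positivity)
  choose B hB hle using fun j k l => (hb j k l).exists_lintegral_mul_le hp hv k l
  funext x
  ext j
  have hconv := fun k l => integral_conv_conv (x := x) (F := fun z => v z k * v z l)
    (continuous_heatKernel t).measurable (measurable_oseenKernel j k l hs)
    ((KernelBound.aestronglyMeasurable_coord hv.1 k).mul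
      (KernelBound.aestronglyMeasurable_coord hv.1 l))
    (lintegral_heatKernel_ne_top ht x) (hB j k l) (hle j k l)
    (integral_heatKernel_mul_oseenKernel j k l ht hs)
  rw [heatFlow_apply hp1 ht (memLp_oseenFlow hp hs hv), oseenFlow_eq_tensorConv,
    oseenFlow_eq_tensorConv, tensorConv_apply hb' hp hv]
  simp only [tensorConv_apply hb hp hv, Finset.smul_sum]
  rw [integral_finsetSum _ fun k _ => integrable_finsetSum _ fun l _ => (hconv k l).1.1]
  refine Finset.sum_congr rfl fun k _ => ?_
  rw [integral_finsetSum _ fun l _ => (hconv k l).1.1]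
  exact Finset.sum_congr rfl fun l _ => (hconv k l).2

end LpOperators

section LpSystem

variable {d : ℕ} {p : ℝ≥0∞}

/-! ### The mild system on `L^p` -/

/-- The class in `L^p` of a vector field, and `0` if the field is not in `L^p`. -/
def lpMk (d : ℕ) (p : ℝ≥0∞) (f : E d → E d) : Lp (E d) p (volume : Measure (E d)) :=
  open Classical in if h : MemLp f p volume then h.toLp f else 0

lemma lpMk_eq {f : E d → E d} (h : MemLp f p volume) : lpMk d p f = h.toLp f := dif_pos h

lemma coeFn_lpMk {f : E d → E d} (h : MemLp f p volume) : lpMk d p f =ᵐ[volume] f := by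
  rw [lpMk_eq h]; exact h.coeFn_toLp

lemma lpMk_coeFn (f : Lp (E d) p (volume : Measure (E d))) : lpMk d p f = f := by
  rw [lpMk_eq (Lp.memLp f), Lp.toLp_coeFn]

lemma enorm_lpMk {f : E d → E d} (h : MemLp f p volume) : ‖lpMk d p f‖ₑ = eLpNorm f p volume := by
  rw [Lp.enorm_def, eLpNorm_congr_ae (coeFn_lpMk h)]

lemma enorm_lpMk_sub {f g : E d → E d} (hf : MemLp f p volume) (hg : MemLp g p volume) :
    ‖lpMk d p f - lpMk d p g‖ₑ = eLpNorm (f - g) p volume := by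
  rw [lpMk_eq hf, lpMk_eq hg, ← MemLp.toLp_sub, ← lpMk_eq (hf.sub hg), enorm_lpMk (hf.sub hg)]

lemma eLpNorm_coeFn_sub (f g : Lp (E d) p (volume : Measure (E d))) :
    eLpNorm (⇑f - ⇑g) p volume = ‖f - g‖ₑ := by
  rw [Lp.enorm_def, eLpNorm_congr_ae (Lp.coeFn_sub f g)]

lemma norm_le_of_enorm_le {F : Type*} [NormedAddCommGroup F] {x : F} {b : ℝ} (hb : 0 ≤ b)
    (h : ‖x‖ₑ ≤ ENNReal.ofReal b) : ‖x‖ ≤ b := by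
  rw [← ofReal_norm] at h
  exact (ENNReal.ofReal_le_ofReal_iff hb).1 h

/-- The heat semigroup `e^{tΔ}` on `L^p` for `t > 0`, and `0` for `t ≤ 0`. -/
def heatL (d : ℕ) (p : ℝ≥0∞) [Fact (1 ≤ p)] (t : ℝ) :
    Lp (E d) p (volume : Measure (E d)) →L[ℝ] Lp (E d) p (volume : Measure (E d)) :=
  open Classical in
  if ht : 0 < t then
    LinearMap.mkContinuous
      { toFun := fun f => lpMk d p (heatFlow t f)
        map_add' := fun f g => by
          have hf := memLp_heatFlow (Fact.out : 1 ≤ p) ht (Lp.memLp f)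
          have hg := memLp_heatFlow (Fact.out : 1 ≤ p) ht (Lp.memLp g)
          rw [heatFlow_eq_scalarConv, scalarConv_congr _ (Lp.coeFn_add f g),
            (heatKernel_bound ht).scalarConv_add Fact.out (Lp.memLp f) (Lp.memLp g), lpMk_eq hf,
            lpMk_eq hg, ← MemLp.toLp_add]
          exact lpMk_eq (hf.add hg)
        map_smul' := fun a f => by
          have hf := memLp_heatFlow (Fact.out : 1 ≤ p) ht (Lp.memLp f)
          rw [heatFlow_eq_scalarConv, scalarConv_congr _ (Lp.coeFn_smul a f),
            KernelBound.scalarConv_const_smul, RingHom.id_apply, lpMk_eq hf,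
            ← MemLp.toLp_const_smul]
          exact lpMk_eq (hf.const_smul a) }
      1 fun f => by
        have h := (heatKernel_bound ht).eLpNorm_scalarConv_le (Fact.out : 1 ≤ p)
          (Lp.memLp f).1
        rw [one_mul, one_mul, ← Lp.enorm_def] at h
        rw [one_mul]
        have h2 := enorm_lpMk (memLp_heatFlow (Fact.out : 1 ≤ p) ht (Lp.memLp f))
        change ‖lpMk d p (heatFlow t f)‖ ≤ ‖f‖
        rw [← enorm_le_iff_norm_le, h2]
        exact h
  else 0

lemma heatL_apply [Fact (1 ≤ p)] {t : ℝ} (ht : 0 < t) (f : Lp (E d) p (volume : Measure (E d))) :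
    heatL d p t f = lpMk d p (heatFlow t f) := by
  rw [heatL, dif_pos ht]; rfl

/-- The quadratic map `v ↦ e^{tΔ} ℙ div (v ⊗ v)` on `L^p`. -/
def oseenL (d : ℕ) (p : ℝ≥0∞) (t : ℝ) (v : Lp (E d) p (volume : Measure (E d))) :
    Lp (E d) p (volume : Measure (E d)) := lpMk d p (oseenFlow t v)

lemma coeFn_heatL [Fact (1 ≤ p)] {t : ℝ} (ht : 0 < t) (f : Lp (E d) p (volume : Measure (E d))) :
    heatL d p t f =ᵐ[volume] heatFlow t f := by
  rw [heatL_apply ht]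
  exact coeFn_lpMk (memLp_heatFlow Fact.out ht (Lp.memLp f))

lemma coeFn_oseenL (hp : 2 ≤ p) {t : ℝ} (ht : 0 < t)
    (v : Lp (E d) p (volume : Measure (E d))) : oseenL d p t v =ᵐ[volume] oseenFlow t v :=
  coeFn_lpMk (memLp_oseenFlow hp ht (Lp.memLp v))

/-- A function of a positive time that is locally Lipschitz away from `0` is continuous. -/
lemma continuousOn_of_lipschitz {Y : Type*} [NormedAddCommGroup Y] {f : ℝ → Y}
    (h : ∀ a > 0, ∃ L : ℝ, ∀ t t', a ≤ t → t ≤ t' → ‖f t - f t'‖ ≤ L * (t' - t)) :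
    ContinuousOn f (Ioi 0) := by
  intro t₀ ht₀
  have ht₀' : 0 < t₀ := ht₀
  obtain ⟨L, hL⟩ := h (t₀ / 2) (by positivity)
  refine ContinuousAt.continuousWithinAt ?_
  rw [ContinuousAt, tendsto_iff_norm_sub_tendsto_zero]
  have hlim : Tendsto (fun t => L * |t - t₀|) (𝓝 t₀) (𝓝 0) := by
    have : ContinuousAt (fun t => L * |t - t₀|) t₀ := by fun_prop
    simpa [ContinuousAt] using this
  refine squeeze_zero' (.of_forall fun _ => norm_nonneg _) ?_ hlim
  filter_upwards [Ioi_mem_nhds (show t₀ / 2 < t₀ by linarith)] with t ht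
  rcases le_total t t₀ with h1 | h1
  · rw [abs_of_nonpos (sub_nonpos.2 h1), neg_sub]
    exact hL t t₀ (le_of_lt ht) h1
  · rw [abs_of_nonneg (sub_nonneg.2 h1), norm_sub_rev]
    exact hL t₀ t (by linarith) h1

lemma ofReal_quadratic_bound [Fact (1 ≤ p)] {C m a r : ℝ} (hC : 0 ≤ C) (hm : 0 < m) (ha : 0 ≤ a)
    (x y z : Lp (E d) p (volume : Measure (E d))) :
    (d : ℝ≥0∞) ^ 3 * ENNReal.ofReal C * (ENNReal.ofReal m ^ r * ENNReal.ofReal a *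
      ((‖x‖ₑ + ‖y‖ₑ) * ‖z‖ₑ)) =
    ENNReal.ofReal (d ^ 3 * C * (m ^ r * a) * ((‖x‖ + ‖y‖) * ‖z‖)) := by
  rw [ENNReal.ofReal_mul (by positivity), ENNReal.ofReal_mul (by positivity),
    ENNReal.ofReal_mul (by positivity), ENNReal.ofReal_mul (by positivity),
    ENNReal.ofReal_mul (by positivity), ENNReal.ofReal_add (norm_nonneg x) (norm_nonneg y),
    ENNReal.ofReal_pow (Nat.cast_nonneg d), ENNReal.ofReal_natCast, ENNReal.ofReal_rpow_of_pos hm,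
    ofReal_norm, ofReal_norm, ofReal_norm]
  ring

/-- The factor `‖K_t‖_{q}` in the bounds for the Oseen operator, up to a constant: `r = 1/p` for
`L^p` bounds and `r = 2/p` for pointwise bounds. -/
def oseenBound (d : ℕ) (r t : ℝ) : ℝ :=
  d ^ 3 * oseenConst d * (gaussSup d t ^ r * (2 * t ^ (-(1 / 2) : ℝ)))

lemma oseenBound_nonneg {r t : ℝ} (ht : 0 < t) : 0 ≤ oseenBound d r t := by
  have := oseenConst_pos d
  have := gaussSup_pos (d := d) ht
  unfold oseenBound; positivity

lemma continuousAt_oseenBound (r : ℝ) {t : ℝ} (ht : 0 < t) :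
    ContinuousAt (oseenBound d r) t := by
  have hpi := Real.pi_pos
  have h1 : ContinuousAt (gaussSup d) t := by
    unfold gaussSup
    exact ContinuousAt.rpow_const (by fun_prop) (Or.inl (by positivity))
  have h2 : ContinuousAt (fun t : ℝ => t ^ (-(1 / 2) : ℝ)) t :=
    continuousAt_id.rpow_const (Or.inl ht.ne')
  unfold oseenBound
  exact continuousAt_const.mul ((h1.rpow_const (Or.inl (gaussSup_pos ht).ne')).mul
    (continuousAt_const.mul h2))

/-- The scaling exponent `-1/2 - d/(2p) = (1 - d/p)/2 - 1` of the Oseen operator on `L^p`. -/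
lemma oseenBound_eq (r : ℝ) {t : ℝ} (ht : 0 < t) :
    oseenBound d r t = oseenBound d r 1 * t ^ ((1 - d * r) / 2 - 1) := by
  have hpi := Real.pi_pos
  have h1 : gaussSup d t ^ r = gaussSup d 1 ^ r * t ^ (-(d : ℝ) / 2 * r) := by
    unfold gaussSup
    rw [← Real.rpow_mul (by positivity), ← Real.rpow_mul (by positivity),
      ← Real.mul_rpow (by positivity) ht.le]
    ring_nf
  have h2 : t ^ (-(d : ℝ) / 2 * r) * t ^ (-(1 / 2) : ℝ) = t ^ ((1 - d * r) / 2 - 1) := by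
    rw [← Real.rpow_add ht]
    ring_nf
  unfold oseenBound
  rw [h1, Real.one_rpow, ← h2]
  ring

/-- The factor in the bounds for differences of the Oseen operator at two times in `[a, ∞)`. -/
def oseenTimeBound (d : ℕ) (r a : ℝ) : ℝ :=
  d ^ 3 * oseenConst d * (gaussSup d a ^ r * oseenWeight a)

lemma norm_oseenFlow_sub_apply_le [Fact (1 ≤ p)] (hp : 2 ≤ p) {t : ℝ} (ht : 0 < t)
    (v w : Lp (E d) p (volume : Measure (E d))) (x : E d) :
    ‖oseenFlow t v x - oseenFlow t w x‖ ≤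
      oseenBound d (2 * p⁻¹.toReal) t * ((‖v‖ + ‖w‖) * ‖v - w‖) := by
  have h := enorm_tensorConv_sub_apply_le (fun j k l => oseenKernel_bound j k l ht) hp
    (isMajorant_oseenWeight_Ioi ht) (Lp.memLp v) (Lp.memLp w) x
  rw [eLpNorm_coeFn_sub, ← Lp.enorm_def, ← Lp.enorm_def,
    ofReal_quadratic_bound (oseenConst_pos d).le (gaussSup_pos ht) (by positivity)] at h
  have := oseenBound_nonneg (d := d) (r := 2 * p⁻¹.toReal) ht
  exact norm_le_of_enorm_le (by positivity) h

lemma norm_oseenL_sub_le [Fact (1 ≤ p)] (hp : 2 ≤ p) {t : ℝ} (ht : 0 < t)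
    (v w : Lp (E d) p (volume : Measure (E d))) :
    ‖oseenL d p t v - oseenL d p t w‖ ≤
      oseenBound d p⁻¹.toReal t * ((‖v‖ + ‖w‖) * ‖v - w‖) := by
  have h := eLpNorm_tensorConv_sub_le (fun j k l => oseenKernel_bound j k l ht) hp
    (isMajorant_oseenWeight_Ioi ht) (Lp.memLp v) (Lp.memLp w)
  rw [eLpNorm_coeFn_sub, ← Lp.enorm_def, ← Lp.enorm_def,
    ofReal_quadratic_bound (oseenConst_pos d).le (gaussSup_pos ht) (by positivity)] at h
  have h0 := oseenBound_nonneg (d := d) (r := p⁻¹.toReal) ht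
  refine norm_le_of_enorm_le (by positivity) ?_
  rw [oseenL, oseenL, enorm_lpMk_sub (memLp_oseenFlow hp ht (Lp.memLp v))
    (memLp_oseenFlow hp ht (Lp.memLp w))]
  exact h

section TimeDifference

variable {a t t' : ℝ}

lemma oseenFlow_sub_time (hp : 2 ≤ p) (ht : 0 < t) (ht' : 0 < t') {v : E d → E d}
    (hv : MemLp v p volume) : oseenFlow t v - oseenFlow t' v =
      tensorConv (fun j k l x => oseenKernel j k l t x - oseenKernel j k l t' x) v :=
  tensorConv_sub_kernel (fun j k l => oseenKernel_bound j k l ht)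
    (fun j k l => oseenKernel_bound j k l ht') hp hv

lemma norm_oseenFlow_sub_time_apply_le [Fact (1 ≤ p)] (hp : 2 ≤ p) (ha : 0 < a) (hat : a ≤ t)
    (h : t ≤ t') (v : Lp (E d) p (volume : Measure (E d))) (x : E d) :
    ‖oseenFlow t v x - oseenFlow t' v x‖ ≤
      oseenTimeBound d (2 * p⁻¹.toReal) a * ‖v‖ ^ 2 * (t' - t) := by
  have ht := ha.trans_le hat
  have hw : 0 ≤ oseenWeight a := Real.rpow_nonneg ha.le _
  have hC := oseenConst_pos d
  have hg := gaussSup_pos (d := d) ha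
  have hs := sub_nonneg.2 h
  have hb := enorm_tensorConv_sub_apply_le (fun j k l => oseenKernel_sub_bound j k l ha hat h) hp
    (isMajorant_oseenWeight_Ioc t' ha hat) (Lp.memLp v) (MemLp.zero (ε := E d)) x
  have e := congrFun (oseenFlow_sub_time hp ht (ht.trans_le h) (Lp.memLp v)) x
  rw [tensorConv_zero, Pi.zero_apply, sub_zero, sub_zero, eLpNorm_zero, add_zero, ← e,
    ← Lp.enorm_def] at hb
  have e2 := ofReal_quadratic_bound (p := p) (r := 2 * p⁻¹.toReal) hC.le hg
    (show 0 ≤ oseenWeight a * (t' - t) by positivity) v 0 v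
  rw [enorm_zero, norm_zero, add_zero, add_zero] at e2
  rw [e2] at hb
  refine (norm_le_of_enorm_le (by positivity) hb).trans (le_of_eq ?_)
  unfold oseenTimeBound
  ring

lemma norm_oseenL_sub_time_le [Fact (1 ≤ p)] (hp : 2 ≤ p) (ha : 0 < a) (hat : a ≤ t) (h : t ≤ t')
    (v : Lp (E d) p (volume : Measure (E d))) :
    ‖oseenL d p t v - oseenL d p t' v‖ ≤
      oseenTimeBound d p⁻¹.toReal a * ‖v‖ ^ 2 * (t' - t) := by
  have ht := ha.trans_le hat
  have hw : 0 ≤ oseenWeight a := Real.rpow_nonneg ha.le _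
  have hC := oseenConst_pos d
  have hg := gaussSup_pos (d := d) ha
  have hs := sub_nonneg.2 h
  have hb := eLpNorm_tensorConv_sub_le (fun j k l => oseenKernel_sub_bound j k l ha hat h) hp
    (isMajorant_oseenWeight_Ioc t' ha hat) (Lp.memLp v) (MemLp.zero (ε := E d))
  rw [tensorConv_zero, sub_zero, sub_zero, eLpNorm_zero, add_zero,
    ← oseenFlow_sub_time hp ht (ht.trans_le h) (Lp.memLp v), ← Lp.enorm_def] at hb
  have e2 := ofReal_quadratic_bound (p := p) (r := p⁻¹.toReal) hC.le hg
    (show 0 ≤ oseenWeight a * (t' - t) by positivity) v 0 v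
  rw [enorm_zero, norm_zero, add_zero, add_zero] at e2
  rw [e2, ← enorm_lpMk_sub (memLp_oseenFlow hp ht (Lp.memLp v))
    (memLp_oseenFlow hp (ht.trans_le h) (Lp.memLp v))] at hb
  refine (norm_le_of_enorm_le (by positivity) hb).trans (le_of_eq ?_)
  unfold oseenTimeBound
  ring

lemma norm_heatL_sub_time_le [Fact (1 ≤ p)] (ha : 0 < a) (hat : a ≤ t) (h : t ≤ t')
    (f : Lp (E d) p (volume : Measure (E d))) :
    ‖heatL d p t f - heatL d p t' f‖ ≤ oseenConst d * (1 / a) * ‖f‖ * (t' - t) := by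
  have hp : 1 ≤ p := Fact.out
  have ht := ha.trans_le hat
  have ht' := ht.trans_le h
  have hC := oseenConst_pos d
  have hs := sub_nonneg.2 h
  have hb := (heatKernel_sub_bound (d := d) ha hat h).eLpNorm_scalarConv_le hp (Lp.memLp f).1
  have e : heatFlow t f - heatFlow t' f =
      scalarConv (fun x => heatKernel d t x - heatKernel d t' x) f := by
    funext x
    simp only [scalarConv, sub_smul]
    exact (integral_sub ((heatKernel_bound ht).integrable_smul hp (Lp.memLp f) x)
      ((heatKernel_bound ht').integrable_smul hp (Lp.memLp f) x)).symm
  rw [← e, ← Lp.enorm_def, ← enorm_lpMk_sub (memLp_heatFlow hp ht (Lp.memLp f))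
    (memLp_heatFlow hp ht' (Lp.memLp f)), ← heatL_apply ht, ← heatL_apply ht', ← ofReal_norm f,
    ← ENNReal.ofReal_mul (by positivity), ← ENNReal.ofReal_mul (by positivity)] at hb
  refine (norm_le_of_enorm_le (by positivity) hb).trans (le_of_eq ?_)
  ring

end TimeDifference

lemma continuousAt_oseenFlow_apply [Fact (1 ≤ p)] (hp : 2 ≤ p) (x : E d) {t : ℝ} (ht : 0 < t)
    (v : Lp (E d) p (volume : Measure (E d))) :
    ContinuousAt (fun z : ℝ × Lp (E d) p (volume : Measure (E d)) => oseenFlow z.1 z.2 x)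
      (t, v) := by
  have hc : ContinuousOn (fun t => oseenFlow t v x) (Ioi 0) :=
    continuousOn_of_lipschitz fun a ha =>
      ⟨_, fun t t' hat h => norm_oseenFlow_sub_time_apply_le hp ha hat h v x⟩
  have hq : ∀ s > 0, ∀ w : Lp (E d) p (volume : Measure (E d)),
      ‖oseenFlow s w x - oseenFlow s v x‖ ≤
        oseenBound d (2 * p⁻¹.toReal) s * ((‖w‖ + ‖v‖) * ‖w - v‖) :=
    fun s hs w => norm_oseenFlow_sub_apply_le hp hs w v x
  have hc' := hc.continuousAt (Ioi_mem_nhds ht)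
  exact continuousAt_of_quadratic_bound (Y := E d)
    (Q := fun t (v : Lp (E d) p (volume : Measure (E d))) => oseenFlow t v x)
    (b := oseenBound d (2 * p⁻¹.toReal)) (τ := t) (x := v) ht
    (continuousAt_oseenBound (2 * p⁻¹.toReal) ht) hq hc'

/-- The scaling exponent `σ = (1 - d/p)/2`. -/
def scalingExp (d : ℕ) (p : ℝ≥0∞) : ℝ := (1 - d * p⁻¹.toReal) / 2

/-- This is where `p > d` enters: the kernel `τ ^ (σ - 1)` of the Duhamel term is integrable. -/
lemma scalingExp_pos (hp : (d : ℝ≥0∞) < p) : 0 < scalingExp d p := by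
  unfold scalingExp
  rcases eq_or_ne p ⊤ with rfl | hp'
  · simp
  · have h1 : (d : ℝ) < p.toReal := by
      have := (ENNReal.toReal_lt_toReal (ENNReal.natCast_ne_top d) hp').2 hp
      simpa using this
    have h0 : 0 < p.toReal := (Nat.cast_nonneg d).trans_lt h1
    rw [toReal_inv_eq, mul_one_div]
    have := (div_lt_one h0).2 h1
    linarith

/-- The Navier–Stokes equations in mild form satisfy the hypotheses of the abstract theory. -/
lemma isMildSystem [Fact (1 ≤ p)] (hd : 0 < d) (hp : 2 ≤ p) (hdp : (d : ℝ≥0∞) < p) :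
    IsMildSystem (heatL d p) (oseenL d p) (oseenBound d p⁻¹.toReal 1) (scalingExp d p) where
  exponent_pos := scalingExp_pos hdp
  const_pos := by
    have := oseenConst_pos d
    have := gaussSup_pos (d := d) one_pos
    have : (0 : ℝ) < d := Nat.cast_pos.2 hd
    unfold oseenBound; positivity
  norm_le t ht f := by
    have h := (heatKernel_bound ht).eLpNorm_scalarConv_le (Fact.out : 1 ≤ p) (Lp.memLp f).1
    rw [one_mul, one_mul, ← Lp.enorm_def, ← heatFlow_eq_scalarConv,
      ← enorm_lpMk (memLp_heatFlow Fact.out ht (Lp.memLp f)), ← heatL_apply ht] at h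
    exact enorm_le_iff_norm_le.1 h
  continuousOn_linear f := continuousOn_of_lipschitz fun a ha =>
    ⟨_, fun t t' hat h => norm_heatL_sub_time_le ha hat h f⟩
  map_zero t ht := by
    rw [oseenL, oseenFlow_eq_tensorConv, tensorConv_congr _ (Lp.coeFn_zero (E d) p volume),
      tensorConv_zero, lpMk_eq MemLp.zero]
    exact MemLp.toLp_zero _
  norm_sub_le t ht v w := by
    have := norm_oseenL_sub_le hp ht v w
    rwa [oseenBound_eq _ ht] at this
  continuousOn_quadratic v := continuousOn_of_lipschitz fun a ha =>
    ⟨_, fun t t' hat h => norm_oseenL_sub_time_le hp ha hat h v⟩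
  semigroup t ht s hs f := by
    have hp1 : 1 ≤ p := Fact.out
    rw [heatL_apply ht, heatL_apply (by positivity : 0 < t + s), ← heatFlow_heatFlow hp1 ht hs
      (Lp.memLp f)]
    exact congrArg _ (scalarConv_congr _ (coeFn_heatL hs f))
  semigroup_quadratic t ht s hs v := by
    rw [heatL_apply ht, oseenL, oseenL, ← heatFlow_oseenFlow hp ht hs (Lp.memLp v)]
    exact congrArg _ (scalarConv_congr _ (coeFn_lpMk (memLp_oseenFlow hp hs (Lp.memLp v))))

end LpSystem

section Bridge

variable {d : ℕ} {p : ℝ≥0∞}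

/-! ### Mild solutions as curves in `L^p` -/

/-- Pairing with a function in the dual exponent is a bounded linear map on `L^p`. -/
lemma exists_clm_integral_smul [Fact (1 ≤ p)] {w : E d → ℝ}
    (hw : MemLp w (ENNReal.conjExponent p) volume) :
    ∃ L : Lp (E d) p (volume : Measure (E d)) →L[ℝ] E d, ∀ f, L f = ∫ x, w x • f x := by
  have : Fact (1 ≤ ENNReal.conjExponent p) := ⟨le_self_add⟩
  have : ENNReal.HolderConjugate (ENNReal.conjExponent p) p :=
    (ENNReal.HolderConjugate.conjExponent (Fact.out : 1 ≤ p)).symm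
  refine ⟨(ContinuousLinearMap.lsmul ℝ ℝ).lpPairing volume _ p (hw.toLp w), fun f => ?_⟩
  rw [ContinuousLinearMap.lpPairing_eq_integral]
  exact integral_congr_ae (hw.coeFn_toLp.mono fun x hx => by simp [hx])

lemma exists_clm_setIntegral [Fact (1 ≤ p)] {B : Set (E d)} (hB : MeasurableSet B)
    (hμ : volume B < ⊤) :
    ∃ L : Lp (E d) p (volume : Measure (E d)) →L[ℝ] E d, ∀ f, L f = ∫ x in B, f x := by
  obtain ⟨L, hL⟩ := exists_clm_integral_smul (p := p) (w := B.indicator fun _ => (1 : ℝ))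
    (memLp_indicator_const _ hB 1 (Or.inr hμ.ne))
  refine ⟨L, fun f => ?_⟩
  rw [hL, ← integral_indicator hB]
  congr 1 with x
  by_cases hx : x ∈ B <;> simp [hx]

lemma lintegral_enorm_restrict_le (hp : 1 ≤ p) {f : E d → E d} (hf : MemLp f p volume)
    (B : Set (E d)) : ∫⁻ x in B, ‖f x‖ₑ ≤
      eLpNorm f p volume * volume B ^ (1 - p⁻¹.toReal) := by
  have h := eLpNorm_le_eLpNorm_mul_rpow_measure_univ hp (hf.1.restrict (s := B))
  rw [eLpNorm_one_eq_lintegral_enorm, Measure.restrict_apply_univ, ENNReal.toReal_one, div_one,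
    ← toReal_inv_eq] at h
  exact h.trans (mul_le_mul_left (eLpNorm_mono_measure _ Measure.restrict_le_self) _)

/-- A Bochner integral in `L^p` can be computed pointwise almost everywhere. -/
lemma coeFn_intervalIntegral [Fact (1 ≤ p)] {t : ℝ} (ht : 0 ≤ t)
    {F : ℝ → Lp (E d) p (volume : Measure (E d))} (hF : IntervalIntegrable F volume 0 t)
    {g : ℝ × E d → E d} (hg : StronglyMeasurable g)
    (hgF : ∀ s ∈ Ioo 0 t, (fun x => g (s, x)) =ᵐ[volume] F s) :
    ⇑(∫ s in (0 : ℝ)..t, F s) =ᵐ[volume] fun x => ∫ s in (0 : ℝ)..t, g (s, x) := by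
  have hp : 1 ≤ p := Fact.out
  have hF' : IntegrableOn F (Ioc 0 t) := (intervalIntegrable_iff_integrableOn_Ioc_of_le ht).1 hF
  have hae : ∀ᵐ s ∂volume.restrict (Ioc 0 t), (fun x => g (s, x)) =ᵐ[volume] F s := by
    rw [← Measure.restrict_congr_set Ioo_ae_eq_Ioc]
    filter_upwards [ae_restrict_mem measurableSet_Ioo] with s hs using hgF s hs
  have hprod : ∀ B : Set (E d), volume B < ⊤ →
      Integrable g ((volume.restrict (Ioc 0 t)).prod (volume.restrict B)) := by
    intro B hμ
    refine ⟨hg.aestronglyMeasurable, ?_⟩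
    rw [hasFiniteIntegral_iff_enorm, lintegral_prod _ hg.aestronglyMeasurable.enorm]
    have hC : volume B ^ (1 - p⁻¹.toReal) ≠ ⊤ :=
      ENNReal.rpow_ne_top_of_nonneg (sub_nonneg.2 (toReal_inv_le_one hp)) hμ.ne
    calc ∫⁻ s in Ioc 0 t, ∫⁻ x in B, ‖g (s, x)‖ₑ
        ≤ ∫⁻ s in Ioc 0 t, ‖F s‖ₑ * volume B ^ (1 - p⁻¹.toReal) := by
          refine lintegral_mono_ae (hae.mono fun s hs => ?_)
          rw [lintegral_congr_ae (ae_restrict_of_ae (hs.mono fun x hx => by simp only [hx]) :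
            ∀ᵐ x ∂volume.restrict B, ‖g (s, x)‖ₑ = ‖F s x‖ₑ), Lp.enorm_def]
          exact lintegral_enorm_restrict_le hp (Lp.memLp _) B
      _ = (∫⁻ s in Ioc 0 t, ‖F s‖ₑ) * volume B ^ (1 - p⁻¹.toReal) := lintegral_mul_const' _ _ hC
      _ < ⊤ := ENNReal.mul_lt_top hF'.2 hC.lt_top
  refine ae_eq_of_forall_setIntegral_eq_of_sigmaFinite ?_ ?_ ?_
  · intro B _ hμ
    have : IsFiniteMeasure (volume.restrict B) := ⟨by simpa using hμ⟩
    exact ((Lp.memLp _).restrict B).integrable hp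
  · intro B _ hμ
    simp only [intervalIntegral.integral_of_le ht]
    exact (hprod B hμ).integral_prod_right
  · intro B hB hμ
    obtain ⟨L, hL⟩ := exists_clm_setIntegral (p := p) hB hμ
    simp only [intervalIntegral.integral_of_le ht]
    rw [← integral_integral_swap (f := fun s x => g (s, x)) (hprod B hμ), ← hL,
      ← L.integral_comp_comm hF']
    refine integral_congr_ae (hae.mono fun s hs => ?_)
    simp only [hL]
    exact integral_congr_ae (ae_restrict_of_ae hs.symm)

/-- The Oseen integrand of a continuous curve in `L^p` is jointly measurable in time and space,
after modification off the time interval. -/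
lemma exists_stronglyMeasurable_integrand [Fact (1 ≤ p)] (hp : 2 ≤ p) {t : ℝ}
    {U : ℝ → Lp (E d) p (volume : Measure (E d))} (hU : ContinuousOn U (Ioo 0 t)) :
    ∃ g : ℝ × E d → E d, StronglyMeasurable g ∧
      ∀ s ∈ Ioo 0 t, ∀ x, g (s, x) = oseenFlow (t - s) (U s) x := by
  have hc : ∀ x, Continuous fun s : Ioo 0 t => oseenFlow (t - s) (U s) x := by
    intro x
    rw [continuous_iff_continuousAt]
    intro s
    have h1 : ContinuousAt (fun s : Ioo 0 t => (t - (s : ℝ), U s)) s :=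
      (continuous_const.sub continuous_subtype_val).continuousAt.prodMk
        (continuousOn_iff_continuous_domRestrict.1 hU).continuousAt
    exact ContinuousAt.comp (f := fun s : Ioo 0 t => (t - (s : ℝ), U s))
      (continuousAt_oseenFlow_apply hp x (sub_pos.2 s.2.2) (U s)) h1
  have hm := stronglyMeasurable_uncurry_of_continuous_of_stronglyMeasurable hc fun s =>
    stronglyMeasurable_tensorConv (fun j k l => oseenKernel_bound j k l (sub_pos.2 s.2.2))
      (Lp.stronglyMeasurable (U s))
  have he : MeasurableEmbedding (Prod.map ((↑) : Ioo 0 t → ℝ) (id : E d → E d)) :=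
    (MeasurableEmbedding.subtype_coe measurableSet_Ioo).prodMap MeasurableEmbedding.id
  obtain ⟨g, hg, hgf⟩ := he.exists_stronglyMeasurable_extend hm fun _ => ⟨0⟩
  exact ⟨g, hg, fun s hs x => congrFun hgf (⟨s, hs⟩, x)⟩

/-- The Duhamel term of a curve in `L^p`, computed pointwise. -/
lemma coeFn_duhamelTerm [Fact (1 ≤ p)] (hd : 0 < d) (hp : 2 ≤ p) (hdp : (d : ℝ≥0∞) < p) {t : ℝ}
    (ht : 0 < t) {U : ℝ → Lp (E d) p (volume : Measure (E d))} {M : ℝ}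
    (hU : ContinuousOn U (Ioc 0 t)) (hM : ∀ s ∈ Ioc 0 t, ‖U s‖ ≤ M) :
    ⇑(duhamelTerm (oseenL d p) U t) =ᵐ[volume]
      fun x => ∫ s in (0 : ℝ)..t, oseenFlow (t - s) (U s) x := by
  obtain ⟨g, hg, hgU⟩ := exists_stronglyMeasurable_integrand hp (hU.mono Ioo_subset_Ioc_self)
  refine (coeFn_intervalIntegral ht.le ((isMildSystem hd hp hdp).intervalIntegrable_integrand
    (a := 0) ht (hU.mono (sdiff_subset.trans Ioo_subset_Ioc_self)) hM) hg fun s hs => ?_).trans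
    (.of_forall fun x => ?_)
  · simp only [hgU s hs]
    exact (coeFn_oseenL hp (sub_pos.2 hs.2) (U s)).symm
  · simp only [intervalIntegral.integral_of_le ht.le, integral_Ioc_eq_integral_Ioo]
    exact setIntegral_congr_fun measurableSet_Ioo fun s hs => hgU s hs x

lemma norm_lpMk_le [Fact (1 ≤ p)] {f : E d → E d} (hf : MemLp f p volume) {M : ℝ} (hM : 0 ≤ M)
    (h : eLpNorm f p volume ≤ ENNReal.ofReal M) : ‖lpMk d p f‖ ≤ M :=
  norm_le_of_enorm_le hM (by rwa [enorm_lpMk hf])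

lemma norm_lpMk [Fact (1 ≤ p)] {f : E d → E d} (hf : MemLp f p volume) :
    ‖lpMk d p f‖ = (eLpNorm f p volume).toReal := by
  rw [← toReal_enorm, enorm_lpMk hf]

/-- A mild solution in the pointwise sense is a mild solution in the Banach space `L^p`. -/
lemma IsMildSolution.isAbstractMild [Fact (1 ≤ p)] (hd : 0 < d) (hp : 2 ≤ p)
    (hdp : (d : ℝ≥0∞) < p) {u₀ : E d → E d} {T : ℝ} {u : ℝ → E d → E d}
    (hu₀ : MemLp u₀ p volume) (h : IsMildSolution d p u₀ T u) :
    IsAbstractMild (heatL d p) (oseenL d p) (lpMk d p u₀) T fun t => lpMk d p (u t) := by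
  obtain ⟨M, hM⟩ := h.bounded
  have hM' : ∀ t ∈ Ioc 0 T, ‖lpMk d p (u t)‖ ≤ max M 0 := fun t ht =>
    norm_lpMk_le (h.memLp t ht) (le_max_right _ _)
      ((hM t ht).trans (ENNReal.ofReal_le_ofReal (le_max_left _ _)))
  have hc : ContinuousOn (fun t => lpMk d p (u t)) (Ioc 0 T) := by
    intro t ht
    rw [ContinuousWithinAt, tendsto_iff_edist_tendsto_0]
    refine (h.continuous t ht).congr' ?_
    filter_upwards [self_mem_nhdsWithin] with s hs
    rw [edist_eq_enorm_sub, enorm_lpMk_sub (h.memLp s hs) (h.memLp t ht)]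
  refine ⟨hc, ⟨_, hM'⟩, fun t ht => ?_⟩
  have hsub : Ioc 0 t ⊆ Ioc 0 T := Ioc_subset_Ioc_right ht.2
  refine Lp.ext ?_
  have hD := coeFn_duhamelTerm hd hp hdp ht.1 (hc.mono hsub) fun s hs => hM' s (hsub hs)
  have hS := coeFn_heatL ht.1 (lpMk d p u₀)
  rw [heatFlow_eq_scalarConv, scalarConv_congr _ (coeFn_lpMk hu₀), ← heatFlow_eq_scalarConv] at hS
  filter_upwards [coeFn_lpMk (h.memLp t ht), h.duhamel t ht, hD, hS,
    Lp.coeFn_sub (heatL d p t (lpMk d p u₀)) (duhamelTerm (oseenL d p) (fun t => lpMk d p (u t)) t)]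
    with x h1 h2 h3 h4 h5
  rw [h5, Pi.sub_apply, h3, h4, h1, h2]
  congr 1
  simp only [intervalIntegral.integral_of_le ht.1.le]
  refine setIntegral_congr_fun measurableSet_Ioc fun s hs => ?_
  simp only [oseenFlow_eq_tensorConv, tensorConv_congr _ (coeFn_lpMk (h.memLp s (hsub hs)))]

/-- Conversely, a mild solution in the Banach space `L^p` satisfies the equation pointwise almost
everywhere. -/
lemma IsAbstractMild.isMildSolution [Fact (1 ≤ p)] (hd : 0 < d) (hp : 2 ≤ p)
    (hdp : (d : ℝ≥0∞) < p) {u₀ : E d → E d} {T : ℝ}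
    {U : ℝ → Lp (E d) p (volume : Measure (E d))} (hu₀ : MemLp u₀ p volume)
    (h : IsAbstractMild (heatL d p) (oseenL d p) (lpMk d p u₀) T U) :
    IsMildSolution d p u₀ T fun t => U t := by
  obtain ⟨M, hM⟩ := h.bounded
  refine ⟨fun t _ => Lp.memLp _, ⟨M, fun t ht => ?_⟩, fun t ht => ?_, fun t ht => ?_⟩
  · rw [← Lp.enorm_def, ← ofReal_norm]
    exact ENNReal.ofReal_le_ofReal (hM t ht)
  · have := tendsto_iff_edist_tendsto_0.1 (h.continuousOn t ht)
    simpa only [eLpNorm_coeFn_sub, edist_eq_enorm_sub] using this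
  · have hsub : Ioc 0 t ⊆ Ioc 0 T := Ioc_subset_Ioc_right ht.2
    have hD := coeFn_duhamelTerm hd hp hdp ht.1 (h.continuousOn.mono hsub)
      fun s hs => hM s (hsub hs)
    have hS := coeFn_heatL ht.1 (lpMk d p u₀)
    rw [heatFlow_eq_scalarConv, scalarConv_congr _ (coeFn_lpMk hu₀),
      ← heatFlow_eq_scalarConv] at hS
    have e := Lp.coeFn_sub (heatL d p t (lpMk d p u₀)) (duhamelTerm (oseenL d p) U t)
    rw [← h.eq t ht] at e
    filter_upwards [hD, hS, e] with x h3 h4 h5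
    rw [h5, Pi.sub_apply, h3, h4]

end Bridge

section Divergence

variable {d : ℕ} {p : ℝ≥0∞} {φ : E d → ℝ}

/-! ### The divergence-free condition is preserved -/

lemma pderiv_eq_fderiv (hφ : Differentiable ℝ φ) (j : Fin d) :
    pderiv j φ = fun x => fderiv ℝ φ x (EuclideanSpace.single j 1) :=
  funext fun x => (hφ x).lineDeriv_eq_fderiv

lemma contDiff_pderiv (hφ : ContDiff ℝ ∞ φ) (j : Fin d) : ContDiff ℝ ∞ (pderiv j φ) := by
  rw [pderiv_eq_fderiv (hφ.differentiable (by simp))]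
  exact (hφ.fderiv_right (m := ∞) (by simp)).clm_apply contDiff_const

lemma hasCompactSupport_pderiv (hφ : ContDiff ℝ ∞ φ) (hc : HasCompactSupport φ) (j : Fin d) :
    HasCompactSupport (pderiv j φ) := by
  rw [pderiv_eq_fderiv (hφ.differentiable (by simp))]
  exact hc.fderiv_apply (𝕜 := ℝ) _

lemma hasLineDerivAt_pderiv (hφ : ContDiff ℝ ∞ φ) (j : Fin d) (x : E d) :
    HasLineDerivAt ℝ φ (pderiv j φ x) x (EuclideanSpace.single j 1) :=
  (hφ.differentiable (by simp) x).lineDifferentiableAt.hasLineDerivAt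

lemma pderiv_comm (hφ : ContDiff ℝ ∞ φ) (j k : Fin d) (x : E d) :
    pderiv j (pderiv k φ) x = pderiv k (pderiv j φ) x := by
  have h (i j : Fin d) : pderiv i (pderiv j φ) x =
      fderiv ℝ (fderiv ℝ φ) x (EuclideanSpace.single i 1) (EuclideanSpace.single j 1) := by
    rw [pderiv_eq_fderiv ((contDiff_pderiv hφ j).differentiable (by simp)),
      pderiv_eq_fderiv (hφ.differentiable (by simp))]
    have hd : DifferentiableAt ℝ (fderiv ℝ φ) x :=
      ((hφ.fderiv_right (m := ∞) (by simp)).differentiable (by simp)) x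
    simp only
    rw [fderiv_clm_apply hd (differentiableAt_const _)]
    simp
  rw [h, h]
  exact hφ.contDiffAt.isSymmSndFDerivAt (by
    rw [minSmoothness_of_isRCLikeNormedField]
    exact WithTop.coe_le_coe.2 (le_top : (2 : ℕ∞) ≤ ⊤)) _ _

lemma pderiv_comp_const_add (j : Fin d) (a x : E d) :
    pderiv j (fun y => φ (a + y)) x = pderiv j φ (a + x) := by
  simp only [pderiv, lineDeriv, add_assoc]

lemma hasCompactSupport_comp_const_add (hc : HasCompactSupport φ) (a : E d) :
    HasCompactSupport fun y => φ (a + y) :=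
  hc.comp_homeomorph (Homeomorph.addLeft a)

lemma integrable_mul_of_hasCompactSupport {f ψ : E d → ℝ} (hψ : Continuous ψ)
    (hc : HasCompactSupport ψ) (hf : Continuous f) : Integrable fun x => ψ x * f x :=
  (hψ.mul hf).integrable_of_hasCompactSupport hc.mul_right

lemma continuous_heatD2 (k l : Fin d) (s : ℝ) : Continuous (heatD2 k l s) := by
  have := continuous_heatKernel (d := d) s
  unfold heatD2; fun_prop

lemma continuous_heatD3 (j k l : Fin d) (s : ℝ) : Continuous (heatD3 j k l s) := by
  have := continuous_heatKernel (d := d) s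
  unfold heatD3; fun_prop

lemma heatD3_swap (j k l : Fin d) (s : ℝ) (x : E d) : heatD3 j k l s x = heatD3 k j l s x := by
  unfold heatD3
  rw [delta_comm j k]
  ring

lemma integral_pderiv_mul_heatD3 (hφ : ContDiff ℝ ∞ φ) (hc : HasCompactSupport φ)
    (j k l : Fin d) {s : ℝ} (hs : 0 < s) :
    ∫ x, pderiv j φ x * heatD3 j k l s x = ∫ x, pderiv k φ x * heatD3 j j l s x := by
  -- integration by parts moves the derivative in the direction `i` from the kernel
  have key (i m : Fin d) : ∫ x, pderiv m φ x * heatD3 i j l s x =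
      -∫ x, pderiv i (pderiv m φ) x * heatD2 j l s x := by
    have hm := contDiff_pderiv hφ m
    have hmc := hasCompactSupport_pderiv hφ hc m
    exact integral_bilinear_hasLineDerivAt_right_eq_neg_left_of_integrable
      (B := ContinuousLinearMap.mul ℝ ℝ) (v := EuclideanSpace.single i 1)
      (integrable_mul_of_hasCompactSupport (contDiff_pderiv hm i).continuous
        (hasCompactSupport_pderiv hm hmc i) (continuous_heatD2 j l s))
      (integrable_mul_of_hasCompactSupport hm.continuous hmc (continuous_heatD3 i j l s))
      (integrable_mul_of_hasCompactSupport hm.continuous hmc (continuous_heatD2 j l s))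
      (fun x _ => hasLineDerivAt_pderiv hm i x) (fun x _ => hasLineDerivAt_heatD2 i j l hs x)
  simp only [heatD3_swap j k l]
  rw [key k j, key j k]
  simp only [pderiv_comm hφ j k]

/-- Each slice of the Oseen kernel is divergence free in its first index. -/
lemma sum_integral_pderiv_mul_oseenDensity (hφ : ContDiff ℝ ∞ φ) (hc : HasCompactSupport φ)
    (k l : Fin d) {s : ℝ} (hs : 0 < s) :
    ∑ j, ∫ x, pderiv j φ x * oseenDensity j k l s x = 0 := by
  have hi (m i j k : Fin d) : Integrable fun x => pderiv m φ x * heatD3 i j k s x :=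
    integrable_mul_of_hasCompactSupport (contDiff_pderiv hφ m).continuous
      (hasCompactSupport_pderiv hφ hc m) (continuous_heatD3 i j k s)
  have e (j : Fin d) : ∫ x, pderiv j φ x * oseenDensity j k l s x =
      (∫ x, pderiv k φ x * heatD3 j j l s x) -
        delta j k * ∑ m, ∫ x, pderiv j φ x * heatD3 m m l s x := by
    simp only [oseenDensity, mul_sub, mul_left_comm _ (delta j k),
      Finset.mul_sum _ _ (pderiv _ _ _)]
    rw [integral_sub (hi j j k l) ((integrable_finsetSum _ fun m _ => hi j m m l).const_mul _),
      integral_const_mul, integral_finsetSum _ fun m _ => hi j m m l,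
      integral_pderiv_mul_heatD3 hφ hc j k l hs]
  simp only [e, Finset.sum_sub_distrib, delta, ite_mul, one_mul, zero_mul, Finset.sum_ite_eq',
    Finset.mem_univ, if_true, sub_self]

lemma sum_integral_pderiv_mul_oseenKernel (hφ : ContDiff ℝ ∞ φ) (hc : HasCompactSupport φ)
    (k l : Fin d) {t : ℝ} (ht : 0 < t) :
    ∑ j, ∫ x, pderiv j φ x * oseenKernel j k l t x = 0 := by
  have h (j : Fin d) := integral_mul_oseenKernel_comp j k l ht
    ((contDiff_pderiv hφ j).continuous.integrable_of_hasCompactSupport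
      (hasCompactSupport_pderiv hφ hc j)) measurable_id
  simp only [id] at h
  simp only [fun j => (h j).2]
  rw [← integral_finsetSum _ fun j _ => (h j).1]
  refine (setIntegral_congr_fun measurableSet_Ioi fun s hs => ?_).trans (integral_zero _ _)
  exact sum_integral_pderiv_mul_oseenDensity hφ hc k l (ht.trans hs)

lemma integrable_smul_of_hasCompactSupport (hp : 1 ≤ p) {ψ : E d → ℝ} (hψ : Continuous ψ)
    (hc : HasCompactSupport ψ) {f : E d → E d} (hf : MemLp f p volume) :
    Integrable fun x => ψ x • f x :=
  (hf.locallyIntegrable hp).integrable_smul_left_of_hasCompactSupport hψ hc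

lemma integrable_coord_mul_pderiv (hp : 1 ≤ p) (hφ : ContDiff ℝ ∞ φ) (hc : HasCompactSupport φ)
    {f : E d → E d} (hf : MemLp f p volume) (j : Fin d) :
    Integrable fun x => f x j * pderiv j φ x := by
  have := (EuclideanSpace.proj (𝕜 := ℝ) j : E d →L[ℝ] ℝ).integrable_comp
    (integrable_smul_of_hasCompactSupport hp (contDiff_pderiv hφ j).continuous
      (hasCompactSupport_pderiv hφ hc j) hf)
  simpa [mul_comm] using this

/-- The distributional divergence, tested against `φ`, is a bounded functional on `L^p`. -/
lemma exists_clm_divergence [Fact (1 ≤ p)] (hφ : ContDiff ℝ ∞ φ) (hc : HasCompactSupport φ) :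
    ∃ L : Lp (E d) p (volume : Measure (E d)) →L[ℝ] ℝ,
      ∀ f, L f = ∫ x, ∑ j, f x j * pderiv j φ x := by
  choose Λ hΛ using fun j : Fin d => exists_clm_integral_smul (p := p)
    ((contDiff_pderiv hφ j).continuous.memLp_of_hasCompactSupport
      (hasCompactSupport_pderiv hφ hc j))
  refine ⟨∑ j, (EuclideanSpace.proj (𝕜 := ℝ) j : E d →L[ℝ] ℝ) ∘L Λ j, fun f => ?_⟩
  rw [integral_finsetSum _ fun j _ =>
    integrable_coord_mul_pderiv Fact.out hφ hc (Lp.memLp f) j, sum_apply]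
  refine Finset.sum_congr rfl fun j _ => ?_
  rw [ContinuousLinearMap.comp_apply, hΛ, ← ContinuousLinearMap.integral_comp_comm _
    (integrable_smul_of_hasCompactSupport Fact.out (contDiff_pderiv hφ j).continuous
      (hasCompactSupport_pderiv hφ hc j) (Lp.memLp f))]
  simp [mul_comm]

lemma integral_divergence_congr {f g : E d → E d} (h : f =ᵐ[volume] g) :
    ∫ x, ∑ j, f x j * pderiv j φ x = ∫ x, ∑ j, g x j * pderiv j φ x :=
  integral_congr_ae (h.mono fun x hx => by simp only [hx])

lemma lintegral_pderiv_neg_ne_top (hφ : ContDiff ℝ ∞ φ) (hc : HasCompactSupport φ) (j : Fin d) :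
    ∫⁻ y, ‖pderiv j φ (-(0 - y))‖ₑ ≠ ⊤ := by
  simp only [zero_sub, neg_neg]
  exact ((contDiff_pderiv hφ j).continuous.integrable_of_hasCompactSupport
    (hasCompactSupport_pderiv hφ hc j)).2.ne

/-- `e^{tΔ} ℙ div (v ⊗ v)` is divergence free. -/
lemma integral_divergence_oseenFlow (hp : 2 ≤ p) (hφ : ContDiff ℝ ∞ φ) (hc : HasCompactSupport φ)
    {t : ℝ} (ht : 0 < t) {v : E d → E d} (hv : MemLp v p volume) :
    ∫ x, ∑ j, oseenFlow t v x j * pderiv j φ x = 0 := by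
  have hb := fun j k l => oseenKernel_bound (d := d) j k l ht
  choose B hB hle using fun j k l => (hb j k l).exists_lintegral_mul_le hp hv k l
  have hconv := fun j k l => integral_conv_conv (x := 0) (F := fun z => v z k * v z l)
    (k₁ := fun x => pderiv j φ (-x)) ((contDiff_pderiv hφ j).continuous.measurable.comp
      measurable_neg) (measurable_oseenKernel j k l ht)
    ((KernelBound.aestronglyMeasurable_coord hv.1 k).mul
      (KernelBound.aestronglyMeasurable_coord hv.1 l))
    (lintegral_pderiv_neg_ne_top hφ hc j) (hB j k l) (hle j k l) (fun _ => rfl)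
  simp only [zero_sub, neg_neg] at hconv
  have e : ∀ x, ∑ j, oseenFlow t v x j * pderiv j φ x = ∑ k, ∑ l, ∑ j,
      pderiv j φ x • ∫ z, oseenKernel j k l t (x - z) • (v z k * v z l) := by
    intro x
    simp only [oseenFlow_eq_tensorConv, tensorConv_apply hb hp hv, Finset.sum_mul]
    rw [Finset.sum_comm]
    refine Finset.sum_congr rfl fun k _ => ?_
    rw [Finset.sum_comm]
    exact Finset.sum_congr rfl fun l _ => Finset.sum_congr rfl fun j _ => by
      rw [smul_eq_mul, mul_comm]
  simp only [e]
  rw [integral_finsetSum _ fun k _ => integrable_finsetSum _ fun l _ =>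
    integrable_finsetSum _ fun j _ => (hconv j k l).1.1]
  refine Finset.sum_eq_zero fun k _ => ?_
  rw [integral_finsetSum _ fun l _ => integrable_finsetSum _ fun j _ => (hconv j k l).1.1]
  refine Finset.sum_eq_zero fun l _ => ?_
  rw [integral_finsetSum _ fun j _ => (hconv j k l).1.1]
  simp only [fun j => (hconv j k l).2]
  rw [← integral_finsetSum _ fun j _ => (hconv j k l).1.2]
  refine (integral_congr_ae (.of_forall fun z => ?_)).trans (integral_zero _ _)
  have h0 := sum_integral_pderiv_mul_oseenKernel (hφ.comp (contDiff_const.add contDiff_id))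
    (hasCompactSupport_comp_const_add hc z) k l ht
  simp only [Function.comp_def, id, pderiv_comp_const_add] at h0
  simp only [neg_sub, sub_neg_eq_add, ← Finset.sum_smul]
  rw [← zero_smul ℝ (v z k * v z l), ← h0]
  simp only [add_comm]

lemma exists_kernelBound_of_hasCompactSupport {ψ : E d → ℝ} (hψ : Continuous ψ)
    (hc : HasCompactSupport ψ) : ∃ A M, KernelBound ψ (fun x => ‖ψ x‖ₑ) 1 A M := by
  obtain ⟨C, hC⟩ := hc.exists_bound_of_continuous hψ
  have hC' (x : E d) : ‖ψ x‖ₑ ≤ ENNReal.ofReal C := by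
    rw [← ofReal_norm]
    exact ENNReal.ofReal_le_ofReal (hC x)
  -- the summand `1` makes the bound `κ ≤ M * A` trivial
  refine ⟨(∫⁻ x, ‖ψ x‖ₑ) + 1, ENNReal.ofReal C, hψ.measurable, ⟨hψ.measurable.enorm,
    le_self_add, fun x => (hC' x).trans (le_mul_of_one_le_right' le_add_self)⟩,
    fun x => by rw [one_mul], ENNReal.one_ne_top, ENNReal.add_ne_top.2 ⟨?_, ENNReal.one_ne_top⟩,
    ENNReal.ofReal_ne_top⟩
  exact (hψ.integrable_of_hasCompactSupport hc).2.ne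

/-- The heat flow preserves the divergence-free condition: it averages the translates of a field,
and translations can be moved to the test function. -/
lemma integral_divergence_heatFlow (hp : 1 ≤ p) (hφ : ContDiff ℝ ∞ φ) (hc : HasCompactSupport φ)
    {t : ℝ} (ht : 0 < t) {f : E d → E d} (hf : MemLpSigma d p f) :
    ∫ x, ∑ j, heatFlow t f x j * pderiv j φ x = 0 := by
  obtain ⟨hf, hdiv⟩ := hf
  have hf' : MemLp (fun x => f (-x)) p volume :=
    hf.comp_measurePreserving (Measure.measurePreserving_neg volume)
  have hm := (continuous_heatKernel (d := d) t).measurable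
  have hψm (j : Fin d) := (contDiff_pderiv hφ j).continuous.measurable
  have hcoord {g : E d → E d} {k : E d → ℝ} {B : ℝ≥0∞} (j : Fin d)
      (h : ∀ y, ∫⁻ z, ‖k (y - z)‖ₑ * ‖g z‖ₑ ≤ B) (y : E d) :
      ∫⁻ z, ‖k (y - z)‖ₑ * ‖g z j‖ₑ ≤ B :=
    (lintegral_mono fun z => mul_le_mul_right (enorm_coord_le _ _) _).trans (h y)
  obtain ⟨B₁, hB₁, hle₁⟩ := (heatKernel_bound (d := d) ht).exists_lintegral_le hp hf
  set G : Fin d → E d → ℝ := fun j x => ∫ y, heatKernel d t (x - y) * pderiv j φ y with hG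
  -- the adjoint heat flow acting on the test function
  have h1 (j : Fin d) := integral_conv_conv (x := 0) (F := fun z => f z j)
    (k₁ := fun x => pderiv j φ (-x)) (k₂ := heatKernel d t) (k₃ := fun x => G j (-x))
    ((hψm j).comp measurable_neg) hm (KernelBound.aestronglyMeasurable_coord hf.1 j)
    (lintegral_pderiv_neg_ne_top hφ hc j) hB₁ (hcoord j hle₁) (fun x => by
      simp only [hG]
      rw [← integral_sub_right_eq_self (fun y => heatKernel d t (-x - y) * pderiv j φ y) x]
      refine integral_congr_ae (.of_forall fun y => ?_)
      simp only
      rw [mul_comm, neg_sub, show -x - (y - x) = -y by abel, heatKernel_neg])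
  -- the heat flow as an average of translates
  have h2 (j : Fin d) : Integrable (fun y => heatKernel d t (0 - y) •
        ∫ z, pderiv j φ (y - z) • f (-z) j) ∧
      ∫ y, heatKernel d t (0 - y) • ∫ z, pderiv j φ (y - z) • f (-z) j =
        ∫ z, G j (0 - z) • f (-z) j := by
    obtain ⟨A, M, hb⟩ := exists_kernelBound_of_hasCompactSupport
      (contDiff_pderiv hφ j).continuous (hasCompactSupport_pderiv hφ hc j)
    obtain ⟨B₂, hB₂, hle₂⟩ := hb.exists_lintegral_le hp hf'
    have := integral_conv_conv (x := 0) (F := fun z => f (-z) j) (k₃ := G j) hm (hψm j)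
      (KernelBound.aestronglyMeasurable_coord hf'.1 j) (lintegral_heatKernel_ne_top ht 0) hB₂
      (hcoord j hle₂) (fun x => rfl)
    exact ⟨this.1.1, this.2⟩
  simp only [zero_sub, neg_neg] at h1 h2
  have e (x : E d) : ∑ j, heatFlow t f x j * pderiv j φ x =
      ∑ j, pderiv j φ x • ∫ z, heatKernel d t (x - z) • f z j :=
    Finset.sum_congr rfl fun j _ => by rw [heatFlow_apply hp ht hf, smul_eq_mul, mul_comm]
  simp only [e]
  rw [integral_finsetSum _ fun j _ => (h1 j).1.1]
  have e2 (j : Fin d) : ∫ z, G j z • f z j = ∫ z, G j (-z) • f (-z) j :=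
    (integral_neg_eq_self (fun z => G j z • f z j) volume).symm
  simp only [fun j => (h1 j).2, e2, ← fun j => (h2 j).2]
  rw [← integral_finsetSum _ fun j _ => (h2 j).1]
  refine (integral_congr_ae (.of_forall fun y => ?_)).trans (integral_zero _ _)
  simp only [← Finset.smul_sum]
  have hy := hφ.comp (contDiff_const (c := y).add contDiff_id)
  have hyc := hasCompactSupport_comp_const_add hc y
  have h0 := hdiv _ hy hyc
  rw [integral_finsetSum _ fun j _ => integrable_coord_mul_pderiv hp hy hyc hf j] at h0
  simp only [Function.comp_def, id, pderiv_comp_const_add] at h0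
  rw [← smul_zero (heatKernel d t (-y)), ← h0]
  congr 1
  refine Finset.sum_congr rfl fun j _ => ?_
  rw [← integral_neg_eq_self (fun z => f z j * pderiv j φ (y + z)) volume]
  simp only [smul_eq_mul, mul_comm, sub_eq_add_neg]

/-- The values of a mild solution with divergence-free data are divergence free. -/
lemma IsAbstractMild.memLpSigma [Fact (1 ≤ p)] (hd : 0 < d) (hp : 2 ≤ p)
    (hdp : (d : ℝ≥0∞) < p) {u₀ : E d → E d} {T : ℝ}
    {U : ℝ → Lp (E d) p (volume : Measure (E d))} (hu₀ : MemLpSigma d p u₀)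
    (h : IsAbstractMild (heatL d p) (oseenL d p) (lpMk d p u₀) T U) {t : ℝ} (ht : t ∈ Ioc 0 T) :
    MemLpSigma d p (U t) := by
  refine ⟨Lp.memLp _, fun φ hφ hc => ?_⟩
  obtain ⟨L, hL⟩ := exists_clm_divergence (p := p) hφ hc
  obtain ⟨M, hM⟩ := h.bounded
  have hsub : Ioc 0 t ⊆ Ioc 0 T := Ioc_subset_Ioc_right ht.2
  have hint := (isMildSystem hd hp hdp).intervalIntegrable_integrand (a := 0) ht.1
    (h.continuousOn.mono ((sdiff_subset.trans Ioo_subset_Ioc_self).trans hsub))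
    fun s hs => hM s (hsub hs)
  have h1 : L (heatL d p t (lpMk d p u₀)) = 0 := by
    rw [hL, integral_divergence_congr (coeFn_heatL ht.1 _), heatFlow_eq_scalarConv,
      scalarConv_congr _ (coeFn_lpMk hu₀.1), ← heatFlow_eq_scalarConv]
    exact integral_divergence_heatFlow Fact.out hφ hc ht.1 hu₀
  have h2 : L (duhamelTerm (oseenL d p) U t) = 0 := by
    rw [duhamelTerm, ← L.intervalIntegral_comp_comm hint, intervalIntegral.integral_of_le ht.1.le,
      integral_Ioc_eq_integral_Ioo]
    refine (setIntegral_congr_fun measurableSet_Ioo fun s hs => ?_).trans (integral_zero _ _)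
    rw [hL, integral_divergence_congr (coeFn_oseenL hp (sub_pos.2 hs.2) _)]
    exact integral_divergence_oseenFlow hp hφ hc (sub_pos.2 hs.2) (Lp.memLp _)
  rw [← hL, h.eq t ht, map_sub, h1, h2, sub_zero]

end Divergence

section Sparse

variable {d : ℕ} {p : ℝ≥0∞}

/-! ### Decay of the heat flow of sparse data -/

/-- The bound `(4π)^{-d/2} |B_1|` for the mass of the heat kernel at time `1` on unit balls. -/
def ballConst (d : ℕ) : ℝ :=
  (4 * Real.pi) ^ (-(d : ℝ) / 2) * (volume (Metric.ball (0 : E d) 1)).toReal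

lemma ballConst_nonneg : 0 ≤ ballConst d := by
  have := Real.pi_pos
  unfold ballConst; positivity

/-- The part of the heat kernel at time `T` within distance `ℓ` of the diagonal, with the second
variable in `S`. -/
def nearKernel (T ℓ : ℝ) (S : Set (E d)) (x y : E d) : ℝ≥0∞ :=
  (S ∩ Metric.ball x ℓ).indicator (fun y => ENNReal.ofReal (heatKernel d T (x - y))) y

lemma measurable_nearKernel (T ℓ : ℝ) {S : Set (E d)} (hS : MeasurableSet S) :
    Measurable (Function.uncurry (nearKernel T ℓ S)) := by
  have hs : MeasurableSet {z : E d × E d | z.2 ∈ S ∩ Metric.ball z.1 ℓ} :=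
    (measurable_snd hS).inter (measurableSet_lt (measurable_snd.dist measurable_fst)
      measurable_const)
  exact ((continuous_heatKernel (d := d) T).measurable.comp
    (measurable_fst.sub measurable_snd)).ennreal_ofReal.indicator hs

lemma lintegral_nearKernel_left_le {T : ℝ} (hT : 0 < T) (ℓ : ℝ) (S : Set (E d)) (y : E d) :
    ∫⁻ x, nearKernel T ℓ S x y ≤ 1 := by
  calc ∫⁻ x, nearKernel T ℓ S x y ≤ ∫⁻ x, ENNReal.ofReal (heatKernel d T (x - y)) :=
        lintegral_mono fun x => indicator_le_self _ _ _
    _ = ∫⁻ x, ENNReal.ofReal (heatKernel d T x) :=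
        lintegral_sub_right_eq_self (fun x => ENNReal.ofReal (heatKernel d T x)) y
    _ = 1 := lintegral_heatKernel hT

lemma lintegral_nearKernel_right_le {T β lbar : ℝ} (hT : 0 < T) (hβ : 0 ≤ β) (hl : 0 < lbar)
    {S : Set (E d)} (hS : MeasurableSet S)
    (hSβ : ∀ x : E d, volume (S ∩ Metric.ball x (√T * lbar)) ≤
      ENNReal.ofReal β * volume (Metric.ball x (√T * lbar))) (x : E d) :
    ∫⁻ y, nearKernel T (√T * lbar) S x y ≤ ENNReal.ofReal (ballConst d * β * lbar ^ d) := by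
  have hpi := Real.pi_pos
  have hℓ : 0 < √T * lbar := mul_pos (Real.sqrt_pos.2 hT) hl
  have hc : 0 ≤ (4 * Real.pi * T) ^ (-(d : ℝ) / 2) := by positivity
  have hvol : volume (Metric.ball (0 : E d) 1) =
      ENNReal.ofReal (volume (Metric.ball (0 : E d) 1)).toReal :=
    (ENNReal.ofReal_toReal measure_ball_lt_top.ne).symm
  have hT2 : T ^ (-(d : ℝ) / 2) * √T ^ d = 1 := by
    rw [Real.sqrt_eq_rpow, ← Real.rpow_natCast, ← Real.rpow_mul hT.le, ← Real.rpow_add hT]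
    ring_nf
    exact Real.rpow_zero T
  calc ∫⁻ y, nearKernel T (√T * lbar) S x y
      = ∫⁻ y in S ∩ Metric.ball x (√T * lbar), ENNReal.ofReal (heatKernel d T (x - y)) :=
        lintegral_indicator (hS.inter Metric.isOpen_ball.measurableSet) _
    _ ≤ ∫⁻ _ in S ∩ Metric.ball x (√T * lbar),
          ENNReal.ofReal ((4 * Real.pi * T) ^ (-(d : ℝ) / 2)) :=
        lintegral_mono fun y => ENNReal.ofReal_le_ofReal (heatKernel_le hT _)
    _ = ENNReal.ofReal ((4 * Real.pi * T) ^ (-(d : ℝ) / 2)) *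
          volume (S ∩ Metric.ball x (√T * lbar)) := by
        rw [lintegral_const, Measure.restrict_apply_univ]
    _ ≤ ENNReal.ofReal ((4 * Real.pi * T) ^ (-(d : ℝ) / 2)) * (ENNReal.ofReal β *
          (ENNReal.ofReal ((√T * lbar) ^ d) * volume (Metric.ball (0 : E d) 1))) := by
        refine mul_le_mul_right ((hSβ x).trans (le_of_eq ?_)) _
        rw [Measure.addHaar_ball_of_pos volume x hℓ, finrank_euclideanSpace_fin]
    _ = ENNReal.ofReal (ballConst d * β * lbar ^ d) := by
        rw [hvol, ← ENNReal.ofReal_mul (by positivity), ← ENNReal.ofReal_mul (by positivity),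
          ← ENNReal.ofReal_mul (by positivity), ballConst, mul_pow,
          Real.mul_rpow (by positivity) hT.le]
        congr 1
        linear_combination ((4 * Real.pi) ^ (-(d : ℝ) / 2) * β * lbar ^ d *
          (volume (Metric.ball (0 : E d) 1)).toReal) * hT2

/-- Off the near part, and for the second variable in `S`, the heat kernel is a small multiple of
the heat kernel at twice the time. -/
lemma heatKernel_le_nearKernel_add {T lbar : ℝ} (hT : 0 < T) (hl : 0 < lbar) {S : Set (E d)}
    (x y : E d) (hy : y ∈ S) : ENNReal.ofReal (heatKernel d T (x - y)) ≤
      nearKernel T (√T * lbar) S x y + ENNReal.ofReal (2 ^ ((d : ℝ) / 2) *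
        Real.exp (-(lbar ^ 2 / 8))) * ENNReal.ofReal (heatKernel d (2 * T) (x - y)) := by
  by_cases h : y ∈ Metric.ball x (√T * lbar)
  · rw [nearKernel, indicator_of_mem (show y ∈ S ∩ Metric.ball x (√T * lbar) from ⟨hy, h⟩)]
    exact le_self_add
  · refine le_add_left ?_
    rw [← ENNReal.ofReal_mul (by positivity), heatKernel_eq_mul_two hT]
    have hk := heatKernel_nonneg (d := d) (show 0 ≤ 2 * T by positivity) (x - y)
    have hxy : √T * lbar ≤ ‖x - y‖ := by
      rw [Metric.mem_ball, not_lt, dist_comm, dist_eq_norm] at h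
      exact h
    have hsq : T * lbar ^ 2 ≤ ‖x - y‖ ^ 2 := by
      calc T * lbar ^ 2 = (√T * lbar) ^ 2 := by rw [mul_pow, Real.sq_sqrt hT.le]
        _ ≤ _ := by gcongr
    have : lbar ^ 2 / 8 ≤ ‖x - y‖ ^ 2 / (8 * T) := by
      rw [div_le_div_iff₀ (by norm_num) (by positivity)]
      linarith
    gcongr

lemma aemeasurable_conv {κ : E d → ℝ≥0∞} (hκ : Measurable κ) {f : E d → ℝ≥0∞}
    (hf : AEMeasurable f volume) : AEMeasurable (fun x => ∫⁻ y, κ (x - y) * f y) volume :=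
  AEMeasurable.lintegral_prod_right' (f := fun z : E d × E d => κ (z.1 - z.2) * f z.2)
    ((hκ.comp (measurable_fst.sub measurable_snd)).aemeasurable.mul hf.comp_snd)

/-- The heat flow at time `T` shrinks data that are sparse at scale `√T * lbar`: outside `S` the
data are small, the far part of the kernel is small, and the near part has small mass on `S`. -/
lemma eLpNorm_heatFlow_le_of_sparse (hp : 1 ≤ p) {f : E d → E d} (hf : MemLp f p volume)
    {T ε β lbar : ℝ} (hT : 0 < T) (hl : 0 < lbar) (h : IsSparse d p ε β (√T * lbar) f) :
    eLpNorm (heatFlow T f) p volume ≤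
      (ENNReal.ofReal ε + ENNReal.ofReal (2 ^ ((d : ℝ) / 2) * Real.exp (-(lbar ^ 2 / 8))) +
        ENNReal.ofReal (ballConst d * β * lbar ^ d) ^ (1 - p⁻¹.toReal)) *
      eLpNorm f p volume := by
  obtain ⟨-, ⟨hβ, -⟩, -, S, hS, hSc, hSβ⟩ := h
  set c := ENNReal.ofReal (2 ^ ((d : ℝ) / 2) * Real.exp (-(lbar ^ 2 / 8))) with hc
  set κ := fun x : E d => ENNReal.ofReal (heatKernel d T x) with hκ
  set κ₂ := fun x : E d => ENNReal.ofReal (heatKernel d (2 * T) x) with hκ₂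
  have hM := isMajorant_heatKernel (d := d) hT
  have hM₂ := isMajorant_heatKernel (d := d) (show 0 < 2 * T by positivity)
  set g := fun y => ‖f y‖ₑ with hg
  have hgm : AEMeasurable g volume := hf.1.enorm
  have hgc : AEMeasurable (Sᶜ.indicator g) volume := hgm.indicator hS.compl
  have hn := measurable_nearKernel T (√T * lbar) hS
  set F₁ := fun x => ∫⁻ y, κ (x - y) * Sᶜ.indicator g y with hF₁
  set F₂ := fun x => ∫⁻ y, κ₂ (x - y) * g y with hF₂
  set F₃ := fun x => ∫⁻ y, nearKernel T (√T * lbar) S x y * g y with hF₃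
  have m₁ : AEMeasurable F₁ volume := aemeasurable_conv hM.measurable hgc
  have m₂ : AEMeasurable F₂ volume := aemeasurable_conv hM₂.measurable hgm
  have m₃ : AEMeasurable F₃ volume := AEMeasurable.lintegral_prod_right'
    (f := fun z : E d × E d => nearKernel T (√T * lbar) S z.1 z.2 * g z.2)
    (hn.aemeasurable.mul hgm.comp_snd)
  have hpt : ∀ x, ‖heatFlow T f x‖ₑ ≤ F₁ x + c * F₂ x + F₃ x := by
    intro x
    have h0 := (heatKernel_bound (d := d) hT).enorm_scalarConv_le f x
    rw [one_mul] at h0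
    have hx {k : E d → ℝ≥0∞} (hk : Measurable k) : Measurable fun y => k (x - y) :=
      hk.comp (measurable_const.sub measurable_id)
    have e : F₁ x + c * F₂ x + F₃ x = ∫⁻ y, κ (x - y) * Sᶜ.indicator g y +
        c * (κ₂ (x - y) * g y) + nearKernel T (√T * lbar) S x y * g y := by
      have a₁ : AEMeasurable (fun y => κ (x - y) * Sᶜ.indicator g y) volume :=
        (hx hM.measurable).aemeasurable.mul hgc
      have a₂ : AEMeasurable (fun y => c * (κ₂ (x - y) * g y)) volume :=
        ((hx hM₂.measurable).aemeasurable.mul hgm).const_mul c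
      have a₁₂ : AEMeasurable (fun y => κ (x - y) * Sᶜ.indicator g y + c * (κ₂ (x - y) * g y))
        volume := a₁.add a₂
      rw [lintegral_add_left' a₁₂, lintegral_add_left' a₁,
        lintegral_const_mul' _ _ ENNReal.ofReal_ne_top]
    rw [e]
    refine h0.trans (lintegral_mono fun y => ?_)
    by_cases hy : y ∈ S
    · calc κ (x - y) * g y ≤ (nearKernel T (√T * lbar) S x y + c * κ₂ (x - y)) * g y :=
            mul_le_mul_left (heatKernel_le_nearKernel_add hT hl x y hy) _
        _ = c * (κ₂ (x - y) * g y) + nearKernel T (√T * lbar) S x y * g y := by ring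
        _ ≤ _ := by gcongr; exact le_add_self
    · rw [indicator_of_mem (show y ∈ Sᶜ from hy), add_assoc]
      exact le_self_add
  have n₁ : eLpNorm F₁ p volume ≤ ENNReal.ofReal ε * eLpNorm f p volume := by
    refine (hM.eLpNorm_conv_le hgc hp).trans ?_
    rw [one_mul, eLpNorm_indicator_eq_eLpNorm_restrict hS.compl]
    exact (le_of_eq (eLpNorm_enorm f)).trans hSc.le
  have n₂ : eLpNorm (fun x => c * F₂ x) p volume ≤ c * eLpNorm f p volume := by
    have h2 := hM₂.eLpNorm_conv_le hgm hp
    rw [one_mul, eLpNorm_enorm_eq] at h2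
    refine le_trans ?_ (mul_le_mul_right h2 c)
    exact eLpNorm_le_mul_eLpNorm_of_ae_le_mul'' p m₂.aestronglyMeasurable
      (.of_forall fun x => by simp only [enorm_eq_self]; exact le_rfl)
  have n₃ : eLpNorm F₃ p volume ≤
      ENNReal.ofReal (ballConst d * β * lbar ^ d) ^ (1 - p⁻¹.toReal) * eLpNorm f p volume := by
    have h3 := eLpNorm_lintegral_mul_le (μ := (volume : Measure (E d))) hn hgm
      (lintegral_nearKernel_right_le hT hβ.le hl hS hSβ)
      (lintegral_nearKernel_left_le hT (√T * lbar) S) hp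
    rwa [ENNReal.one_rpow, mul_one, eLpNorm_enorm_eq] at h3
  calc eLpNorm (heatFlow T f) p volume
      ≤ eLpNorm (fun x => F₁ x + c * F₂ x + F₃ x) p volume :=
        eLpNorm_mono_enorm fun x => by simpa using hpt x
    _ ≤ eLpNorm F₁ p volume + eLpNorm (fun x => c * F₂ x) p volume + eLpNorm F₃ p volume :=
        (eLpNorm_add_le (m₁.add (m₂.const_mul c)).aestronglyMeasurable m₃.aestronglyMeasurable
          hp).trans (add_le_add_left (eLpNorm_add_le m₁.aestronglyMeasurable
            (m₂.const_mul c).aestronglyMeasurable hp) _)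
    _ ≤ _ := by rw [add_mul, add_mul]; gcongr

end Sparse

section Criterion

variable {d : ℕ} {p : ℝ≥0∞}

/-! ### Existence constants and the continuation criterion -/

lemma dataSize_eq [Fact (1 ≤ p)] {u₀ : E d → E d} (hu₀ : MemLp u₀ p volume) (T : ℝ) :
    dataSize d p u₀ T = ‖lpMk d p u₀‖ * T ^ scalingExp d p := by
  rw [dataSize, norm_lpMk hu₀, scalingExp]

lemma IsAbstractMild.isUniqueMildSolution [Fact (1 ≤ p)] (hd : 0 < d) (hp : 2 ≤ p)
    (hdp : (d : ℝ≥0∞) < p) {u₀ : E d → E d} {T : ℝ}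
    {U : ℝ → Lp (E d) p (volume : Measure (E d))} (hu₀ : MemLp u₀ p volume)
    (h : IsAbstractMild (heatL d p) (oseenL d p) (lpMk d p u₀) T U) :
    IsUniqueMildSolution d p u₀ T fun t => U t := by
  refine ⟨h.isMildSolution hd hp hdp hu₀, fun T' v hT' hv t ht => ?_⟩
  have := IsAbstractMild.unique (isMildSystem hd hp hdp) (hv.isAbstractMild hd hp hdp hu₀)
    (h.mono hT') t ht
  simp only [← this]
  exact (coeFn_lpMk (hv.memLp t ht)).symm

/-- The smallness condition `A ‖u₀‖ T^σ / σ ≤ 1/8` of the fixed point argument is a bound on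
`‖u₀‖ T^σ` alone. -/
lemma exists_isExistenceConstant [Fact (1 ≤ p)] (hd : 0 < d) (hp : 2 ≤ p)
    (hdp : (d : ℝ≥0∞) < p) : ∃ c, IsExistenceConstant d p c := by
  have hS := isMildSystem hd hp hdp
  set A := oseenBound d p⁻¹.toReal 1
  set σ := scalingExp d p
  have hA := hS.const_pos
  have hσ := hS.exponent_pos
  refine ⟨min 1 (σ / (8 * A)), by positivity, min_le_left _ _, fun u₀ hu₀ T hT hsize => ?_⟩
  rw [dataSize_eq hu₀.1] at hsize
  have h1 := hsize.trans (min_le_right _ _)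
  rw [le_div_iff₀ (by positivity)] at h1
  obtain ⟨U, hU, hUle⟩ := IsAbstractMild.exists_of_small hS hT (x₀ := lpMk d p u₀) (by
    rw [← mul_div_assoc, div_le_iff₀ hσ]
    linarith)
  refine ⟨_, hU.isUniqueMildSolution hd hp hdp hu₀.1, fun t ht => ?_⟩
  rw [← Lp.enorm_def, ← enorm_lpMk hu₀.1, ← ofReal_norm, ← ofReal_norm]
  refine (ENNReal.ofReal_le_ofReal (hUle t ht)).trans (le_of_eq ?_)
  rw [ENNReal.ofReal_mul zero_le_two, ENNReal.ofReal_ofNat]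

/-- The three contributions to the heat flow of sparse data, for parameters as in the criterion. -/
lemma sparse_factor_le {r C γ β lbar V : ℝ} (d : ℕ) (hr : r ≤ 1) (hr0 : 0 ≤ r) (hC : 8 ≤ C)
    (hγ : 0 < γ) (hγ1 : γ ≤ 1) (hl : 0 < lbar) (hβ : 0 < β) (hV : 0 ≤ V)
    (hlog : C * Real.log (C / γ) ≤ lbar ^ 2) (hβr : β ^ (1 - r) ≤ γ / (C * lbar ^ d)) :
    γ / C + 2 ^ ((d : ℝ) / 2) * Real.exp (-(lbar ^ 2 / 8)) + (V * β * lbar ^ d) ^ (1 - r) ≤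
      (1 + 2 ^ ((d : ℝ) / 2) + max 1 V) * (γ / C) := by
  have hC0 : 0 < C := by linarith
  have hq : 8 ≤ C / γ := by
    rw [le_div_iff₀ hγ]
    nlinarith
  have hlog0 : 1 / 8 ≤ Real.log (C / γ) := by
    have h1 := Real.one_sub_inv_le_log_of_pos (show (0 : ℝ) < C / γ by positivity)
    have h2 : (C / γ)⁻¹ ≤ 8⁻¹ := inv_anti₀ (by norm_num) hq
    linarith
  have hl8 : 8 * Real.log (C / γ) ≤ lbar ^ 2 :=
    (mul_le_mul_of_nonneg_right hC (by linarith)).trans hlog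
  -- `C log (C / γ) ≥ 8 * (1 / 8)` forces `lbar ≥ 1`, so the exponent `1 - r` of `lbar ^ d` in the
  -- last term can be raised to `1`.
  have hl1 : 1 ≤ lbar := by
    by_contra! h
    nlinarith
  have hexp : Real.exp (-(lbar ^ 2 / 8)) ≤ γ / C := by
    calc Real.exp (-(lbar ^ 2 / 8)) ≤ Real.exp (-Real.log (C / γ)) :=
          Real.exp_le_exp.2 (by linarith)
      _ = γ / C := by rw [Real.exp_neg, Real.exp_log (by positivity), inv_div]
  have hVr : V ^ (1 - r) ≤ max 1 V := by
    calc V ^ (1 - r) ≤ (max 1 V) ^ (1 - r) :=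
          Real.rpow_le_rpow hV (le_max_right _ _) (by linarith)
      _ ≤ (max 1 V) ^ (1 : ℝ) :=
          Real.rpow_le_rpow_of_exponent_le (le_max_left _ _) (by linarith)
      _ = _ := Real.rpow_one _
  have hld : (lbar ^ d) ^ (1 - r) ≤ lbar ^ d := by
    calc (lbar ^ d) ^ (1 - r) ≤ (lbar ^ d) ^ (1 : ℝ) :=
          Real.rpow_le_rpow_of_exponent_le (one_le_pow₀ hl1) (by linarith)
      _ = _ := Real.rpow_one _
  have hlast : (V * β * lbar ^ d) ^ (1 - r) ≤ max 1 V * (γ / C) := by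
    rw [Real.mul_rpow (by positivity) (by positivity), Real.mul_rpow hV hβ.le]
    calc V ^ (1 - r) * β ^ (1 - r) * (lbar ^ d) ^ (1 - r)
        ≤ max 1 V * (γ / (C * lbar ^ d)) * lbar ^ d := by gcongr
      _ = max 1 V * (γ / C) := by field_simp
  have h2 : (0 : ℝ) < 2 ^ ((d : ℝ) / 2) := by positivity
  nlinarith [mul_le_mul_of_nonneg_left hexp h2.le]

lemma norm_heatL_le_of_sparse [Fact (1 ≤ p)] {u₀ : E d → E d} (hu₀ : MemLp u₀ p volume)
    {T ε β lbar : ℝ} (hT : 0 < T) (hl : 0 < lbar) (h : IsSparse d p ε β (√T * lbar) u₀) :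
    ‖heatL d p T (lpMk d p u₀)‖ ≤
      (ε + 2 ^ ((d : ℝ) / 2) * Real.exp (-(lbar ^ 2 / 8)) +
        (ballConst d * β * lbar ^ d) ^ (1 - p⁻¹.toReal)) * ‖lpMk d p u₀‖ := by
  have hp : 1 ≤ p := Fact.out
  have hε := h.1.1.le
  have hβ := h.2.1.1.le
  have hV := ballConst_nonneg (d := d)
  have hr := sub_nonneg.2 (toReal_inv_le_one hp)
  have hb := eLpNorm_heatFlow_le_of_sparse hp hu₀ hT hl h
  rw [ENNReal.ofReal_rpow_of_nonneg (by positivity) hr, ← ENNReal.ofReal_add hε (by positivity),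
    ← ENNReal.ofReal_add (by positivity) (by positivity), ← enorm_lpMk hu₀, ← ofReal_norm,
    ← ENNReal.ofReal_mul (by positivity)] at hb
  refine norm_le_of_enorm_le (by positivity) ?_
  rwa [Lp.enorm_def, eLpNorm_congr_ae (coeFn_heatL hT _), heatFlow_eq_scalarConv,
    scalarConv_congr _ (coeFn_lpMk hu₀), ← heatFlow_eq_scalarConv]

/-- The solution with sparse data is so small at time `T` that the local theory, restarted from
there, reaches past `T₀`. -/
lemma exists_continuation_of_sparse [Fact (1 ≤ p)] (hd : 0 < d) (hp : 2 ≤ p)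
    (hdp : (d : ℝ≥0∞) < p) {c : ℝ} (hc : IsExistenceConstant d p c) :
    ∃ C₀ : ℝ, 1 ≤ C₀ ∧ ∀ u₀ : E d → E d, MemLpSigma d p u₀ →
      ∀ Tbar T₀ T γ ε β lbar : ℝ,
        0 < Tbar → dataSize d p u₀ Tbar = c →
        Tbar < T₀ → dataSize d p u₀ T₀ * γ = c →
        0 < T → dataSize d p u₀ T = γ / C₀ →
        0 < lbar → C₀ * Real.log (C₀ / γ) ≤ lbar ^ 2 →
        ε = γ / C₀ →
        0 < β → β ^ (1 - p⁻¹.toReal) ≤ γ / (C₀ * lbar ^ d) →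
        IsSparse d p ε β (√T * lbar) u₀ →
        ∃ T₁ : ℝ, T₀ < T₁ ∧ ∃ u : ℝ → E d → E d, IsUniqueMildSolution d p u₀ T₁ u := by
  have hS := isMildSystem hd hp hdp
  obtain ⟨hc0, -, hc⟩ := hc
  set A := oseenBound d p⁻¹.toReal 1
  set σ := scalingExp d p
  have hA := hS.const_pos
  have hσ := hS.exponent_pos
  -- `8` is what the Gaussian tail `exp (-lbar ^ 2 / 8)` needs, `1 / c` makes `T` an admissible time
  -- of local existence, and the sum makes heat flow and Duhamel term together at most `γ ‖u₀‖`.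
  set C := max (max 8 (1 / c)) (1 + 2 ^ ((d : ℝ) / 2) + max 1 (ballConst d) + 4 * A / σ) with hC
  have hC8 : 8 ≤ C := (le_max_left _ _).trans (le_max_left _ _)
  have hCc : 1 / c ≤ C := (le_max_right _ _).trans (le_max_left _ _)
  have hCsum : 1 + 2 ^ ((d : ℝ) / 2) + max 1 (ballConst d) + 4 * A / σ ≤ C := le_max_right _ _
  have hC0 : 0 < C := by linarith
  refine ⟨C, by linarith, fun u₀ hu₀ Tbar T₀ T γ ε β lbar hTbar hcbar hT₀ hcγ hT hsize hl hlog hε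
    hβ hβr hsp => ?_⟩
  rw [dataSize_eq hu₀.1] at hcbar hcγ
  set N := ‖lpMk d p u₀‖ with hN
  have hTbarσ := Real.rpow_pos_of_pos hTbar σ
  have hT₀pos := hTbar.trans hT₀
  have hT₀σ := Real.rpow_pos_of_pos hT₀pos σ
  have hN0 : 0 < N := by
    by_contra! h
    nlinarith
  have hγ : 0 < γ := by
    by_contra! h
    nlinarith [mul_pos hN0 hT₀σ]
  have hγ1 : γ < 1 := by
    have h1 : N * Tbar ^ σ < N * T₀ ^ σ :=
      mul_lt_mul_of_pos_left (Real.rpow_lt_rpow hTbar.le hT₀ hσ) hN0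
    by_contra! h
    nlinarith [mul_pos hN0 hT₀σ]
  obtain ⟨u, ⟨hu, -⟩, hule⟩ := hc u₀ hu₀ T hT (by
    rw [hsize, div_le_iff₀ hC0]
    rw [div_le_iff₀ hc0] at hCc
    linarith)
  rw [dataSize_eq hu₀.1] at hsize
  have hU := hu.isAbstractMild hd hp hdp hu₀.1
  set U : ℝ → Lp (E d) p (volume : Measure (E d)) := fun t => lpMk d p (u t) with hUdef
  have hUle : ∀ t ∈ Ioc 0 T, ‖U t‖ ≤ 2 * N := fun t ht => by
    refine norm_lpMk_le (hu.memLp t ht) (by positivity) ((hule t ht).trans (le_of_eq ?_))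
    rw [ENNReal.ofReal_mul zero_le_two, ENNReal.ofReal_ofNat, hN, ofReal_norm, enorm_lpMk hu₀.1]
  have hTT : T ∈ Ioc 0 T := ⟨hT, le_rfl⟩
  have hsmall : ‖U T‖ ≤ γ * N := by
    have h1 := norm_heatL_le_of_sparse hu₀.1 hT hl hsp
    rw [hε] at h1
    have h2 := h1.trans (mul_le_mul_of_nonneg_right (sparse_factor_le d
      (toReal_inv_le_one (Fact.out : 1 ≤ p)) ENNReal.toReal_nonneg hC8 hγ hγ1.le hl hβ
      ballConst_nonneg hlog hβr) hN0.le)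
    have h3 := hS.norm_duhamelTerm_le hT hUle
    have h4 : A * (2 * N) ^ 2 * (T ^ σ / σ) = 4 * A / σ * (γ / C) * N := by
      rw [← hsize]
      field_simp
      ring
    rw [hU.eq T hTT]
    refine (norm_sub_le _ _).trans ((add_le_add h2 (h3.trans_eq h4)).trans ?_)
    rw [← add_mul, ← add_mul]
    gcongr
    rw [mul_div_assoc', div_le_iff₀ hC0, mul_comm]
    gcongr
  have hUT := hU.memLpSigma hd hp hdp hu₀ hTT
  -- Restart: `‖u(T)‖ T₀ ^ σ ≤ γ ‖u₀‖ T₀ ^ σ = c`, so the solution lives for another time `T₀`.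
  obtain ⟨v, ⟨hv, -⟩, -⟩ := hc (U T) hUT T₀ hT₀pos (by
    rw [dataSize_eq hUT.1, lpMk_coeFn, ← hcγ]
    calc ‖U T‖ * T₀ ^ σ ≤ γ * N * T₀ ^ σ := by gcongr
      _ = _ := by ring)
  have hV := hv.isAbstractMild hd hp hdp hUT.1
  rw [lpMk_coeFn] at hV
  exact ⟨T + T₀, by linarith, _,
    (IsAbstractMild.concat hS hT hU hV).isUniqueMildSolution hd hp hdp hu₀.1⟩

end Criterion

end NavierStokes

end

theorem theorem1p2 (d : ℕ) (hd : 3 ≤ d) (p : ℝ≥0∞) (hp : (d : ℝ≥0∞) < p) :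
    (∃ c : ℝ, NavierStokes.IsExistenceConstant d p c) ∧
    ∀ c : ℝ, NavierStokes.IsExistenceConstant d p c →
      ∃ C₀ : ℝ, 1 ≤ C₀ ∧
        ∀ u₀ : NavierStokes.E d → NavierStokes.E d, NavierStokes.MemLpSigma d p u₀ →
        ∀ Tbar T₀ T γ ε β lbar : ℝ,
          0 < Tbar → NavierStokes.dataSize d p u₀ Tbar = c →
          Tbar < T₀ → NavierStokes.dataSize d p u₀ T₀ * γ = c →
          0 < T → NavierStokes.dataSize d p u₀ T = γ / C₀ →
          0 < lbar → C₀ * Real.log (C₀ / γ) ≤ lbar ^ 2 →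
          ε = γ / C₀ →
          0 < β → β ^ (1 - p⁻¹.toReal) ≤ γ / (C₀ * lbar ^ d) →
          NavierStokes.IsSparse d p ε β (Real.sqrt T * lbar) u₀ →
          ∃ T₁ : ℝ, T₀ < T₁ ∧ ∃ u : ℝ → NavierStokes.E d → NavierStokes.E d,
            NavierStokes.IsUniqueMildSolution d p u₀ T₁ u := by
  have hd0 : 0 < d := by omega
  have hd2 : (2 : ℝ≥0∞) ≤ d := by exact_mod_cast (by omega : 2 ≤ d)
  have hp2 : 2 ≤ p := hd2.trans hp.le
  have : Fact (1 ≤ p) := ⟨one_le_two.trans hp2⟩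
  exact ⟨NavierStokes.exists_isExistenceConstant hd0 hp2 hp, fun c hc =>
    NavierStokes.exists_continuation_of_sparse hd0 hp2 hp hc⟩
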